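/- Let $2\le d\le m$ and let $\boldsymbol T_1,\boldsymbol T_2,\dots$ be i.i.d. random vectors in $\mathbb R^m$ (the sample of the test statistics under the least favorable parameter $\boldsymbol\vartheta^*$) whose one-dimensional marginal distribution functions are continuous and whose copula $C=C_{\boldsymbol T\mid\boldsymbol\vartheta^*}$ is Archimedean: $C(u_1,\dots,u_m)=\psi\big(\sum_{j=1}^m\phi(u_j)\big)$ on $[0,1]^m$, where $\phi:[0,1]\to[0,\infty]$ is continuous, convex and strictly decreasing with $\phi(1)=0$, and $\psi(x)=\inf\{u\in[0,1]:\phi(u)\le x\}$. Let $C^{-1}(v)=\inf\{u\in[0,1]: C(u,\dots,u)\ge v\}$, $v\in[0,1]$, be the quantile function of the diagonal section of $C$. Fix $d$ of the $m$ coordinates, and let $\boldsymbol X_1,\dots,\boldsymbol X_n\in\mathbb R^d$ be the corresponding coordinates of $\boldsymbol T_1,\dots,\boldsymbol T_n$ (so $d=m$ is the use of the full data and $d=2$ the use of two-dimensional marginal data). Let $W_i=\frac1{n+1}\#\{k\le n:\boldsymbol X_k<\boldsymbol X_i\text{ in every coordinate}\}$, and let $K_n$ be the empirical distribution function of $W_1,\dots,W_n$.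 The Genest–Nešlehová–Ziegel generator estimator is $$\hat\psi_n(x)=\frac1n\sum_{i=1}^n\Big(1-\frac x{r_i}\Big)_+^{d-1},\qquad x\ge 0,$$ where the numbers $r_i\in(0,1]$, with $r_i=1$ if $W_i=0$, are determined recursively, in increasing order of $W_i$, by $\hat\psi_n(r_i)=W_i$ (so that $K_n$ is the $d$-dimensional Kendall distribution function of $\hat\psi_n$). Let $\hat\phi_n(u)=\inf\{x\ge0:\hat\psi_n(x)\le u\}$ be its generalized inverse, and let $\hat C_{\boldsymbol T,n}^{-1}(v)=\inf\{u\in[0,1]:\hat\psi_n(m\,\hat\phi_n(u))\ge v\}$ be the quantile function of the estimated diagonal section $u\mapsto\hat\psi_n(m\,\hat\phi_n(u))$. Then: 1. $\hat C_{\boldsymbol T,n}^{-1}(v)=\hat\psi_n\big(\hat\phi_n(v)/m\big)$ for every $v\in(0,1]$ (and $\hat C_{\boldsymbol T,n}^{-1}(0)=0$). 2. $\hat C_{\boldsymbol T,n}^{-1}$ converges to $C^{-1}$ uniformly on $[0,1]$ in probability: for every $\varepsilon>0$, the probability that $|\hat C_{\boldsymbol T,n}^{-1}(v)-C^{-1}(v)|\ge\varepsilon$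 for some $v\in[0,1]$ tends to $0$ as $n\to\infty$. 3. For every $\alpha\in(0,1)$ the estimated local level $\hat\alpha_{\mathrm{loc},n}=1-\hat C_{\boldsymbol T,n}^{-1}(1-\alpha)$ converges in probability to $\alpha_{\mathrm{loc}}=1-C^{-1}(1-\alpha)$. -/

import Mathlib

open MeasureTheory ProbabilityTheory Filter Topology Set
open scoped ENNReal

noncomputable section

/-- A generator `φ : [0,1] → [0,∞]`: continuous, convex, strictly decreasing, `φ 1 = 0`.
The value `φ 0 = ∞` (a strict generator) is allowed; strict monotonicity makes `φ` finite
on `(0,1]`.  Values outside `[0,1]` play no role. -/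
structure IsArchimedeanGenerator (φ : ℝ → ℝ≥0∞) : Prop where
  continuousOn : ContinuousOn φ (Icc 0 1)
  convex : ∀ u ∈ Icc (0 : ℝ) 1, ∀ v ∈ Icc (0 : ℝ) 1, ∀ a b : ℝ, 0 ≤ a → 0 ≤ b → a + b = 1 →
    φ (a * u + b * v) ≤ ENNReal.ofReal a * φ u + ENNReal.ofReal b * φ v
  strictAntiOn : StrictAntiOn φ (Icc 0 1)
  map_one : φ 1 = 0

/-- The generalized inverse `ψ(x) = inf {u ∈ [0,1] | φ(u) ≤ x}` of a generator. -/
def generatorInverse (φ : ℝ → ℝ≥0∞) (x : ℝ≥0∞) : ℝ :=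
  sInf {u : ℝ | u ∈ Icc (0 : ℝ) 1 ∧ φ u ≤ x}

/-- `C` is an `m`-dimensional copula: on `[0,1]^m` it is the distribution function of a
probability measure all of whose margins are uniform on `[0,1]`. -/
def IsCopula {m : ℕ} (C : (Fin m → ℝ) → ℝ) : Prop :=
  ∃ ν : Measure (Fin m → ℝ), IsProbabilityMeasure ν ∧
    (∀ j, ν.map (fun t => t j) = (volume : Measure ℝ).restrict (Icc 0 1)) ∧
    ∀ u ∈ Icc (0 : Fin m → ℝ) 1, C u = ν.real (Iic u)

/-- The distribution function of the `j`-th margin of a law on `ℝ^m`. -/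
def marginalCdf {m : ℕ} (μ : Measure (Fin m → ℝ)) (j : Fin m) (t : ℝ) : ℝ :=
  cdf (μ.map (fun s => s j)) t

/-- `C` is a copula of the law `μ` (Sklar's relation). -/
def IsCopulaOf {m : ℕ} (C : (Fin m → ℝ) → ℝ) (μ : Measure (Fin m → ℝ)) : Prop :=
  IsCopula C ∧ ∀ t : Fin m → ℝ, μ.real (Iic t) = C (fun j => marginalCdf μ j (t j))

/-- `C(u) = ψ(φ(u₁) + … + φ(u_m))` on `[0,1]^m` for some generator `φ` with inverse `ψ`. -/
def IsArchimedean {m : ℕ} (C : (Fin m → ℝ) → ℝ) : Prop :=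
  ∃ φ : ℝ → ℝ≥0∞, IsArchimedeanGenerator φ ∧
    ∀ u ∈ Icc (0 : Fin m → ℝ) 1, C u = generatorInverse φ (∑ j, φ (u j))

/-- The quantile function `v ↦ inf {u ∈ [0,1] | v ≤ D(u)}` of a distribution function `D`
on `[0,1]`. -/
def quantile (D : ℝ → ℝ) (v : ℝ) : ℝ :=
  sInf {u : ℝ | u ∈ Icc (0 : ℝ) 1 ∧ v ≤ D u}

/-- The quantile function of the diagonal section `u ↦ C(u,…,u)`. -/
def diagonalQuantile {m : ℕ} (C : (Fin m → ℝ) → ℝ) (v : ℝ) : ℝ :=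
  quantile (fun u => C (fun _ => u)) v

/-! ### The Genest–Nešlehová–Ziegel generator estimator

For a sample `x₁, …, xₙ` in `ℝ^d`, the pseudo-observations are `Wᵢ = cᵢ / (n+1)`, where `cᵢ` is
the number of sample points that are smaller than `xᵢ` in every coordinate, and the estimated
Kendall distribution `Kₙ` is the empirical distribution of `W₁, …, Wₙ`.  The estimator is
the Williamson `d`-transform `ψ̂(x) = n⁻¹ ∑ᵢ (1 - x / rᵢ)₊ ^ (d-1)` of the discrete radial
distribution (with largest atom normalized to `1`) for which `ψ̂(rᵢ) = Wᵢ`, i.e. for which the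
Kendall distribution of `ψ̂` is `Kₙ`.  The atoms are found recursively from the largest one
downwards. -/

/-- The number `cᵢ` of sample points smaller than `xᵢ` in every coordinate. -/
def gnzCount {n d : ℕ} (x : Fin n → Fin d → ℝ) (i : Fin n) : ℕ :=
  Nat.card {k : Fin n // ∀ l, x k l < x i l}

/-- The mass `p_c = n⁻¹ #{i | cᵢ = c}` that `Kₙ` puts on the point `c / (n+1)`. -/
def gnzMass {n d : ℕ} (x : Fin n → Fin d → ℝ) (c : ℕ) : ℝ :=
  (Nat.card {i : Fin n // gnzCount x i = c} : ℝ) / n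

/-- The atom `r` of the estimated radial distribution that belongs to the point `c / (n+1)`.
It is `1` for `c = 0`; for `c > 0` it is the root `r > 0` of
`∑_{k < c} p_k (1 - r / r_k)₊ ^ (d-1) = c / (n+1)`, which exists and is unique when
`p_c > 0`.  The values for `p_c = 0` are never used with a nonzero weight. -/
def gnzRadius {n d : ℕ} (x : Fin n → Fin d → ℝ) : ℕ → ℝ
  | 0 => 1
  | c + 1 => sInf {r : ℝ | 0 < r ∧
      ∑ k : Fin (c + 1), gnzMass x k * (max 0 (1 - r / gnzRadius x k)) ^ (d - 1)
        = ((c : ℝ) + 1) / ((n : ℝ) + 1)}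
termination_by c => c
decreasing_by exact k.2

/-- The estimator `ψ̂ₙ`. -/
def gnzPsi {n d : ℕ} (x : Fin n → Fin d → ℝ) (y : ℝ) : ℝ :=
  (∑ i : Fin n, (max 0 (1 - y / gnzRadius x (gnzCount x i))) ^ (d - 1)) / n

/-- The estimator `φ̂ₙ`, the generalized inverse of `ψ̂ₙ`. -/
def gnzPhi {n d : ℕ} (x : Fin n → Fin d → ℝ) (u : ℝ) : ℝ :=
  sInf {y : ℝ | 0 ≤ y ∧ gnzPsi x y ≤ u}

/-- The diagonal section `u ↦ ψ̂ₙ(m φ̂ₙ(u))` of the estimated `m`-dimensional copula. -/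
def gnzDiagonal (m : ℕ) {n d : ℕ} (x : Fin n → Fin d → ℝ) (u : ℝ) : ℝ :=
  gnzPsi x (m * gnzPhi x u)

/-- The quantile function of the estimated diagonal section. -/
def gnzDiagonalQuantile (m : ℕ) {n d : ℕ} (x : Fin n → Fin d → ℝ) (v : ℝ) : ℝ :=
  quantile (gnzDiagonal m x) v

/-- The estimated local significance level `1 - Ĉₙ⁻¹(1 - α)`. -/
def gnzLocalLevel (m : ℕ) {n d : ℕ} (x : Fin n → Fin d → ℝ) (α : ℝ) : ℝ :=
  1 - gnzDiagonalQuantile m x (1 - α)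

/-- The coordinates `e 0, …, e (d-1)` of the first `n` observations of a sequence in `ℝ^m`. -/
def subsample {m d : ℕ} (e : Fin d ↪ Fin m) (t : ℕ → Fin m → ℝ) (n : ℕ) :
    Fin n → Fin d → ℝ :=
  fun i l => t i (e l)

end

/-!
The convergence rests on the radial representation of Archimedean copulas.  If a random vector in
`ℝ ^ d`, `d = q + 1`, has an Archimedean copula with generator inverse `ψ`, then the transformed
coordinates `φ (F_j (X_j))` have the survival function `y ↦ ψ (∑ y)`.  Hence `ψ` is the Williamson
transform of the law of their sum `R` (`survival_eq_integral`), which follows from its discrete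
analogue by counting lattice points of a simplex.  With `Z = 1 / R` and `y = 1 / x` this reads
`F(y) = ψ(1 / y) = E[(1 - Z / y)₊ ^ q]`, a continuous distribution function (`williamsonCdf`), and the
Kendall distribution, the law of the joint distribution function at a random point, is the law of
`F(Z)` (`exists_radial_law`).  The estimator has the same form: it is the Williamson transform of a
discrete law `gnzLaw`, whose Kendall distribution is the empirical distribution of the
pseudo-observations (`kendallCdf_gnzLaw`).  Both diagonal quantile functions are `v ↦ F (m · G v)`,
where `G` is the inverse of `F` (`IsArchimedeanGenerator.diagonalQuantile_eq_williamsonCdf`,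
`gnzDiagonalQuantile_eq`), an expression which does not change when `Z` is rescaled.

So it suffices that the Kendall distribution `κ` determines `G` up to scale, and does so
continuously. The function `G` solves `∫_{[0, w)} (1 - G v / G w) ^ q dκ(v) = w`.  Comparing this
equation for two solutions at a point `w` and at the first later point at which their ratio attains
a larger value gives two integral relations.  They yield a Harnack inequality, so that the ratio is
bounded above and below, and then show that a near-minimum and a near-maximum of a nonconstant ratio
cannot coexist (`IsKendallInverse.exists_eq_mul`).  Williamson transforms, normalized at one level,
are relatively compact for pointwise convergence if the Kendall distributions converge, and the
Kendall equation passes to limits; with uniqueness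
this makes `F (a · G v)`, for fixed `v` in `(0, 1)`, a continuous function of the Kendall
distribution in Lévy distance (`exists_delta_stability`).

The empirical Kendall distribution converges by a second moment bound: conditionally on one
observation, the number of observations below it is a sum of independent indicators
(`integral_indicator_mul_sq_le`, `measureReal_not_levyClose_le`).  As the diagonal quantile
functions are monotone with a continuous limit, convergence at finitely many levels gives uniform
convergence (`exists_grid_uniform`), once the left end point is under control.  The limit at `v = 0`
is `F (m · G 0)`, which is positive exactly if `φ 0 < ∞`.  In that case `Z` is bounded away from
`0`, the Kendall distribution function is superlinear at `0`, a dyadic version of the second moment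
bound controls its empirical counterpart near `0` from below (`measureReal_not_kendall_le`), and a
comparison of the two Williamson transforms near their lower end points gives the required lower
bound (`exists_delta_endpoint`).
-/

/-! ### Williamson transforms written as distribution functions -/

/-- The Williamson transform of the law `π` of a positive random variable `Z`, in the variable
`y = 1 / x`: `F(y) = E[(1 - Z / y)₊ ^ q]`.  Dividing outside of the integral makes the junk value
at `y = 0` equal to `0` (for `q ≥ 1`), so that `F` is a continuous distribution function. -/
noncomputable def williamsonCdf (q : ℕ) (π : Measure ℝ) (y : ℝ) : ℝ :=
  (∫ z, (max 0 (y - z)) ^ q ∂π) / y ^ q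

/-- The distribution function of `F(Z)`, where `Z` has law `π` and `F` is its Williamson
transform. -/
noncomputable def kendallCdf (q : ℕ) (π : Measure ℝ) (t : ℝ) : ℝ :=
  π.real {z | williamsonCdf q π z ≤ t}

/-- The properties of the Williamson transforms of probability laws on `(0, ∞)` which are used, and
which survive pointwise limits. -/
structure IsWilliamsonCdf (F : ℝ → ℝ) : Prop where
  zero_of_nonpos : ∀ y ≤ 0, F y = 0
  mono : Monotone F
  cont : Continuous F
  tendsto_one : Tendsto F atTop (𝓝 1)
  convex : ConvexOn ℝ (Ioi 0) (fun x => F x⁻¹)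

/-- The largest `y` with `F y ≤ v`. -/
noncomputable def upperInv (F : ℝ → ℝ) (v : ℝ) : ℝ := sSup {y | F y ≤ v}

theorem IsWilliamsonCdf.nonneg {F : ℝ → ℝ} (hF : IsWilliamsonCdf F) (y : ℝ) : 0 ≤ F y := by
  rcases le_total y 0 with h | h
  · exact (hF.zero_of_nonpos y h).ge
  · exact (hF.zero_of_nonpos 0 le_rfl).ge.trans (hF.mono h)

theorem IsWilliamsonCdf.le_one {F : ℝ → ℝ} (hF : IsWilliamsonCdf F) (y : ℝ) : F y ≤ 1 :=
  hF.mono.ge_of_tendsto hF.tendsto_one y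

theorem IsWilliamsonCdf.pos_of_pos {F : ℝ → ℝ} (hF : IsWilliamsonCdf F) {y : ℝ} (h : 0 < F y) :
    0 < y := by
  by_contra! h'
  exact h.ne' (hF.zero_of_nonpos y h')

/-- Strict monotonicity where `F` is positive: a convex function of `x = 1 / y` that is constant on
an interval does not decrease to the right of it, but `F` tends to `0` as `y` does. -/
theorem IsWilliamsonCdf.lt_of_lt {F : ℝ → ℝ} (hF : IsWilliamsonCdf F) {y y' : ℝ} (h : 0 < F y)
    (hy : y < y') : F y < F y' := by
  have hy0 := hF.pos_of_pos h
  have h0 : Tendsto F (𝓝[>] 0) (𝓝 0) := by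
    have := hF.cont.tendsto 0
    rw [hF.zero_of_nonpos 0 le_rfl] at this
    exact this.mono_left nhdsWithin_le_nhds
  obtain ⟨y'', hy'', hpos⟩ := ((h0.eventually (gt_mem_nhds h)).and self_mem_nhdsWithin).exists
  have hpos : (0 : ℝ) < y'' := hpos
  have hlt : y'' < y := by
    by_contra! hc
    exact absurd (hF.mono hc) (not_le.2 hy'')
  have hinv1 : y'⁻¹ < y⁻¹ := by gcongr
  have hinv2 : y⁻¹ < y''⁻¹ := by gcongr
  have := hF.convex.lt_right_of_left_lt (x := y''⁻¹) (y := y'⁻¹) (z := y⁻¹)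
    (by simpa using hpos) (by simpa using hy0.trans hy) ?_ (by simpa using hy'')
  · simpa using this
  · rw [openSegment_symm, openSegment_eq_Ioo (hinv1.trans hinv2)]
    exact ⟨hinv1, hinv2⟩

theorem IsWilliamsonCdf.lt_one {F : ℝ → ℝ} (hF : IsWilliamsonCdf F) (y : ℝ) : F y < 1 := by
  by_contra! h
  have := hF.lt_of_lt (y := y) (y' := y + 1) (by linarith) (by linarith)
  linarith [hF.le_one (y + 1)]

theorem IsWilliamsonCdf.le_upperInv_iff {F : ℝ → ℝ} (hF : IsWilliamsonCdf F) {v : ℝ}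
    (hv : v ∈ Ico (0 : ℝ) 1) {y : ℝ} : y ≤ upperInv F v ↔ F y ≤ v := by
  obtain ⟨b, hb⟩ := (hF.tendsto_one.eventually (lt_mem_nhds hv.2)).exists
  have hbdd : BddAbove {y | F y ≤ v} := by
    refine ⟨b, fun y hy => ?_⟩
    by_contra! hc
    have := hF.mono hc.le
    have hy' : F y ≤ v := hy
    linarith
  have hne : {y | F y ≤ v}.Nonempty := ⟨0, by simpa [hF.zero_of_nonpos 0 le_rfl] using hv.1⟩
  have hmem : upperInv F v ∈ {y | F y ≤ v} :=
    (isClosed_le hF.cont continuous_const).csSup_mem hne hbdd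
  exact ⟨fun h => (hF.mono h).trans hmem, fun h => le_csSup hbdd h⟩

theorem IsWilliamsonCdf.upperInv_nonneg {F : ℝ → ℝ} (hF : IsWilliamsonCdf F) {v : ℝ}
    (hv : v ∈ Ico (0 : ℝ) 1) : 0 ≤ upperInv F v :=
  (hF.le_upperInv_iff hv).2 (by rw [hF.zero_of_nonpos 0 le_rfl]; exact hv.1)

theorem IsWilliamsonCdf.apply_upperInv {F : ℝ → ℝ} (hF : IsWilliamsonCdf F) {v : ℝ}
    (hv : v ∈ Ico (0 : ℝ) 1) : F (upperInv F v) = v := by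
  refine le_antisymm ((hF.le_upperInv_iff hv).1 le_rfl) ?_
  have h1 : ∀ᶠ y in 𝓝[>] (upperInv F v), v ≤ F y := by
    filter_upwards [self_mem_nhdsWithin] with y hy
    by_contra! hc
    exact absurd ((hF.le_upperInv_iff hv).2 hc.le) (not_le.2 hy)
  exact ge_of_tendsto ((hF.cont.tendsto _).mono_left nhdsWithin_le_nhds) h1

theorem IsWilliamsonCdf.upperInv_le_iff {F : ℝ → ℝ} (hF : IsWilliamsonCdf F) {v : ℝ}
    (hv : v ∈ Ioo (0 : ℝ) 1) {y : ℝ} : upperInv F v ≤ y ↔ v ≤ F y := by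
  have hv' : v ∈ Ico (0 : ℝ) 1 := ⟨hv.1.le, hv.2⟩
  have key := hF.apply_upperInv hv'
  refine ⟨fun h => key ▸ hF.mono h, fun h => ?_⟩
  by_contra! hc
  have := hF.lt_of_lt (hv.1.trans_le h) hc
  linarith

theorem IsWilliamsonCdf.upperInv_pos {F : ℝ → ℝ} (hF : IsWilliamsonCdf F) {v : ℝ}
    (hv : v ∈ Ioo (0 : ℝ) 1) : 0 < upperInv F v :=
  hF.pos_of_pos (by rw [hF.apply_upperInv ⟨hv.1.le, hv.2⟩]; exact hv.1)

theorem IsWilliamsonCdf.strictMonoOn_upperInv {F : ℝ → ℝ} (hF : IsWilliamsonCdf F) :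
    StrictMonoOn (upperInv F) (Ico 0 1) := by
  intro v hv v' hv' h
  by_contra! hc
  have := hF.mono hc
  rw [hF.apply_upperInv hv, hF.apply_upperInv hv'] at this
  linarith

theorem IsWilliamsonCdf.upperInv_apply {F : ℝ → ℝ} (hF : IsWilliamsonCdf F) {y : ℝ}
    (hy : 0 < F y) : upperInv F (F y) = y := by
  refine le_antisymm ((hF.upperInv_le_iff ⟨hy, hF.lt_one y⟩).2 le_rfl) ?_
  exact (hF.le_upperInv_iff ⟨hy.le, hF.lt_one y⟩).2 le_rfl

theorem IsWilliamsonCdf.continuousOn_upperInv {F : ℝ → ℝ} (hF : IsWilliamsonCdf F) :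
    ContinuousOn (upperInv F) (Ico 0 1) := by
  intro v hv
  refine tendsto_order.2 ⟨fun a ha => ?_, fun b hb => ?_⟩
  · rcases hv.1.eq_or_lt with h0 | h0
    · filter_upwards [self_mem_nhdsWithin] with w hw
      exact ha.trans_le (hF.strictMonoOn_upperInv.monotoneOn hv hw (h0 ▸ hw.1))
    · have hlt : F a < v := by
        by_contra! hc
        have h1 := hF.lt_of_lt (h0.trans_le hc) ha
        rw [hF.apply_upperInv hv] at h1
        linarith
      filter_upwards [self_mem_nhdsWithin, mem_nhdsWithin_of_mem_nhds (lt_mem_nhds hlt)]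
        with w hw hw2
      by_contra! hc
      have := hF.mono hc
      rw [hF.apply_upperInv hw] at this
      linarith
  · obtain ⟨c, hc1, hc2⟩ := exists_between hb
    have hlt : v < F c := by
      by_contra! hc
      exact absurd ((hF.le_upperInv_iff hv).2 hc) (not_le.2 hc1)
    filter_upwards [self_mem_nhdsWithin, mem_nhdsWithin_of_mem_nhds (gt_mem_nhds hlt)]
      with w hw hw2
    refine lt_of_le_of_lt ?_ hc2
    by_contra! hc
    have := (hF.le_upperInv_iff hw).1 hc.le
    linarith

/-! ### The Williamson transform of a law on `(0, ∞)` -/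

/-- Layer-cake formula for the truncated moment `E[(y - ζ)₊ ^ q]`. -/
theorem integral_max_sub_pow_eq (q : ℕ) (hq : 1 ≤ q) {α : Type*} [MeasurableSpace α]
    (κ : Measure α) [IsFiniteMeasure κ] {ζ : α → ℝ} (hζ : AEMeasurable ζ κ)
    (h0 : ∀ᵐ a ∂κ, 0 ≤ ζ a) {y : ℝ} (hy : 0 ≤ y) :
    ∫ a, (max 0 (y - ζ a)) ^ q ∂κ
      = ∫ t in Ioc 0 y, κ.real {a | ζ a ≤ y - t} * (q * t ^ (q - 1)) := by
  have hint : ∀ x : ℝ, ∫ t in (0 : ℝ)..x, (q : ℝ) * t ^ (q - 1) = x ^ q := by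
    intro x
    rw [intervalIntegral.integral_const_mul, integral_pow]
    have : q - 1 + 1 = q := by omega
    have h2 : ((q - 1 : ℕ) : ℝ) + 1 = q := by exact_mod_cast this
    rw [this, h2, zero_pow (by omega)]
    have : (q : ℝ) ≠ 0 := by positivity
    field_simp
    simp
  have hmeas : AEMeasurable (fun a => (max 0 (y - ζ a)) ^ q) κ :=
    (aemeasurable_const.max (aemeasurable_const.sub hζ)).pow_const q
  have hLC := lintegral_comp_eq_lintegral_meas_le_mul κ (f := fun a => max 0 (y - ζ a))
    (g := fun t => (q : ℝ) * t ^ (q - 1)) (Eventually.of_forall fun a => le_max_left _ _)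
    (aemeasurable_const.max (aemeasurable_const.sub hζ))
    (fun t _ =>
      (by fun_prop : Continuous fun t : ℝ => (q : ℝ) * t ^ (q - 1)).intervalIntegrable _ _)
    (by filter_upwards [ae_restrict_mem measurableSet_Ioi] with t ht
        have : (0 : ℝ) < t := ht
        positivity)
  simp only [hint] at hLC
  rw [integral_eq_lintegral_of_nonneg_ae (Eventually.of_forall fun a => by positivity)
    hmeas.aestronglyMeasurable, hLC]
  have hanti : Antitone fun t => κ.real {a | ζ a ≤ y - t} := by
    intro t t' h
    refine measureReal_mono (fun a ha => ?_)
    have ha : ζ a ≤ y - t' := ha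
    show ζ a ≤ y - t
    linarith
  rw [integral_eq_lintegral_of_nonneg_ae]
  rotate_left
  · filter_upwards [ae_restrict_mem measurableSet_Ioc] with t ht
    have := ht.1
    positivity
  · exact (hanti.measurable.mul (by fun_prop)).aestronglyMeasurable
  congr 1
  rw [← Ioc_union_Ioi_eq_Ioi hy, lintegral_union measurableSet_Ioi (by
    rw [Set.disjoint_left]; intro t h1 h2; exact absurd h1.2 (not_le.2 h2))]
  have hz : ∫⁻ t in Ioi y, κ {a | t ≤ max 0 (y - ζ a)} * ENNReal.ofReal (q * t ^ (q - 1)) = 0 := by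
    rw [setLIntegral_congr_fun (g := fun _ => 0) measurableSet_Ioi]
    · simp
    · intro t ht
      have ht : y < t := ht
      have : κ {a | t ≤ max 0 (y - ζ a)} = 0 := by
        rw [measure_eq_zero_iff_ae_notMem]
        filter_upwards [h0] with a ha
        simp only [not_le, max_lt_iff]
        constructor <;> linarith
      simp only [this, zero_mul]
  rw [hz, add_zero]
  refine setLIntegral_congr_fun measurableSet_Ioc (fun t ht => ?_)
  have : {a | t ≤ max 0 (y - ζ a)} = {a | ζ a ≤ y - t} := by
    ext a
    rw [mem_ofPred_eq, mem_ofPred_eq, le_max_iff]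
    constructor
    · rintro (h | h)
      · exact absurd h (not_le.2 ht.1)
      · linarith
    · intro h
      right
      linarith
  simp only [this]
  rw [ENNReal.ofReal_mul measureReal_nonneg, ofReal_measureReal]

theorem williamsonCdf_eq (q : ℕ) (π : Measure ℝ) {y : ℝ} (hy : 0 < y) :
    williamsonCdf q π y = ∫ z, (max 0 (1 - z / y)) ^ q ∂π := by
  unfold williamsonCdf
  rw [← integral_div]
  congr 1
  ext z
  rw [← div_pow]
  congr 1
  rcases le_total 0 (y - z) with h | h
  · rw [max_eq_right h, max_eq_right, sub_div, div_self hy.ne']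
    rw [sub_nonneg, div_le_one hy]
    linarith
  · rw [max_eq_left h, max_eq_left, zero_div]
    rw [sub_nonpos, one_le_div hy]
    linarith

theorem pow_sub_pow_le_mul (q : ℕ) {a b : ℝ} (hb : 0 ≤ b) (hab : b ≤ a) (ha : a ≤ 1) :
    a ^ q - b ^ q ≤ q * (a - b) := by
  induction q with
  | zero => simp
  | succ k ih =>
    have h1 : a ^ k ≤ 1 := pow_le_one₀ (hb.trans hab) ha
    have h2 : a ^ (k + 1) - b ^ (k + 1) = a ^ k * (a - b) + b * (a ^ k - b ^ k) := by ring
    have h3 : b ^ k ≤ a ^ k := pow_le_pow_left₀ hb hab k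
    push_cast
    nlinarith [mul_nonneg (sub_nonneg.2 h1) (sub_nonneg.2 hab),
      mul_nonneg (sub_nonneg.2 (hab.trans ha)) (sub_nonneg.2 h3)]

theorem pow_pred_mul_sub_le (q : ℕ) (hq : 1 ≤ q) {a b : ℝ} (hb : 0 ≤ b) (hab : b ≤ a) :
    a ^ (q - 1) * (a - b) ≤ a ^ q - b ^ q := by
  obtain ⟨k, rfl⟩ : ∃ k, q = k + 1 := ⟨q - 1, by omega⟩
  have h3 : b ^ k ≤ a ^ k := pow_le_pow_left₀ hb hab k
  simp only [Nat.add_sub_cancel, pow_succ]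
  nlinarith

/-- On laws on `(0, ∞)` the integrand of the Williamson transform is continuous in `y` on all of
`ℝ`. -/
theorem williamsonCdf_eq_max (q : ℕ) (hq : 1 ≤ q) (π : Measure ℝ) (hpos : ∀ᵐ z ∂π, 0 < z)
    (y : ℝ) : williamsonCdf q π y = ∫ z, (1 - z / max y z) ^ q ∂π := by
  rcases le_or_gt y 0 with hy | hy
  · have h1 : ∫ z, (max 0 (y - z)) ^ q ∂π = 0 := by
      rw [integral_congr_ae (g := fun _ => (0 : ℝ)), integral_zero]
      filter_upwards [hpos] with z hz
      rw [max_eq_left (by linarith), zero_pow (by omega)]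
    rw [williamsonCdf, h1, zero_div, integral_congr_ae (g := fun _ => (0 : ℝ)), integral_zero]
    filter_upwards [hpos] with z hz
    rw [max_eq_right (by linarith), div_self hz.ne', sub_self, zero_pow (by omega)]
  · rw [williamsonCdf_eq q π hy]
    refine integral_congr_ae ?_
    filter_upwards [hpos] with z hz
    congr 1
    rcases le_total y z with h | h
    · rw [max_eq_right h, div_self hz.ne', sub_self, max_eq_left]
      rw [sub_nonpos, one_le_div hy]
      exact h
    · rw [max_eq_left h, max_eq_right]
      rw [sub_nonneg, div_le_one hy]
      exact h

theorem one_sub_div_max_mem {y z : ℝ} (hz : 0 < z) : 1 - z / max y z ∈ Icc (0 : ℝ) 1 := by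
  have h1 : 0 < max y z := lt_max_of_lt_right hz
  have h2 : z / max y z ≤ 1 := (div_le_one h1).2 (le_max_right _ _)
  have h3 : 0 ≤ z / max y z := by positivity
  constructor <;> linarith

theorem one_sub_div_max_mono {y y' z : ℝ} (hz : 0 < z) (h : y ≤ y') :
    1 - z / max y z ≤ 1 - z / max y' z := by
  have h1 : 0 < max y z := lt_max_of_lt_right hz
  have : z / max y' z ≤ z / max y z := by gcongr
  linarith

theorem integrable_williamson_integrand (q : ℕ) (π : Measure ℝ) [IsFiniteMeasure π]
    (hpos : ∀ᵐ z ∂π, 0 < z) (y : ℝ) : Integrable (fun z => (1 - z / max y z) ^ q) π := by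
  refine Integrable.of_bound (C := 1)
    (by apply Measurable.aestronglyMeasurable; fun_prop) ?_
  filter_upwards [hpos] with z hz
  have := one_sub_div_max_mem (y := y) hz
  rw [Real.norm_of_nonneg (pow_nonneg this.1 _)]
  exact pow_le_one₀ this.1 this.2

/-- Convexity in `1 / y` holds under the integral sign, continuity and the limit `1` follow by
dominated convergence. -/
theorem isWilliamsonCdf_williamsonCdf (q : ℕ) (hq : 1 ≤ q) (π : Measure ℝ)
    [IsProbabilityMeasure π] (hpos : ∀ᵐ z ∂π, 0 < z) : IsWilliamsonCdf (williamsonCdf q π) := by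
  have hE := williamsonCdf_eq_max q hq π hpos
  have hmeas : ∀ y : ℝ, AEStronglyMeasurable (fun z => (1 - z / max y z) ^ q) π :=
    fun y => (integrable_williamson_integrand q π hpos y).aestronglyMeasurable
  have hbound : ∀ y : ℝ, ∀ᵐ z ∂π, ‖(1 - z / max y z) ^ q‖ ≤ 1 := by
    intro y
    filter_upwards [hpos] with z hz
    have := one_sub_div_max_mem (y := y) hz
    rw [Real.norm_of_nonneg (pow_nonneg this.1 _)]
    exact pow_le_one₀ this.1 this.2
  refine ⟨fun y hy => ?_, fun y y' h => ?_, ?_, ?_, ?_⟩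
  · rw [hE, integral_congr_ae (g := fun _ => (0 : ℝ)), integral_zero]
    filter_upwards [hpos] with z hz
    rw [max_eq_right (by linarith), div_self hz.ne', sub_self, zero_pow (by omega)]
  · rw [hE, hE]
    refine integral_mono_ae (integrable_williamson_integrand q π hpos y)
      (integrable_williamson_integrand q π hpos y') ?_
    filter_upwards [hpos] with z hz
    exact pow_le_pow_left₀ (one_sub_div_max_mem hz).1 (one_sub_div_max_mono hz h) q
  · simp_rw [continuous_iff_continuousAt]
    intro y
    have : williamsonCdf q π = fun y => ∫ z, (1 - z / max y z) ^ q ∂π := funext hE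
    rw [this]
    refine tendsto_integral_filter_of_dominated_convergence (fun _ => 1)
      (Eventually.of_forall hmeas) (Eventually.of_forall hbound) (integrable_const _) ?_
    filter_upwards [hpos] with z hz
    have hne : max y z ≠ 0 := (lt_max_of_lt_right hz).ne'
    have h1 : Tendsto (fun y : ℝ => max y z) (𝓝 y) (𝓝 (max y z)) :=
      (continuous_id.max continuous_const).tendsto y
    exact (tendsto_const_nhds.sub (tendsto_const_nhds.div h1 hne)).pow q
  · have : williamsonCdf q π = fun y => ∫ z, (1 - z / max y z) ^ q ∂π := funext hE
    rw [this]
    have h1 : (1 : ℝ) = ∫ _, (1 : ℝ) ∂π := by simp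
    nth_rewrite 2 [h1]
    refine tendsto_integral_filter_of_dominated_convergence (fun _ => 1)
      (Eventually.of_forall hmeas) (Eventually.of_forall hbound) (integrable_const _) ?_
    filter_upwards [hpos] with z hz
    have h2 : Tendsto (fun y : ℝ => z / max y z) atTop (𝓝 0) :=
      Tendsto.div_atTop tendsto_const_nhds
        (tendsto_atTop_mono (fun y => le_max_left y z) tendsto_id)
    simpa using (tendsto_const_nhds (x := (1 : ℝ)).sub h2).pow q
  · have hEx : ∀ x : ℝ, 0 < x → williamsonCdf q π x⁻¹ = ∫ z, (max 0 (1 - z * x)) ^ q ∂π := by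
      intro x hx
      rw [williamsonCdf_eq q π (inv_pos.2 hx)]
      simp only [div_inv_eq_mul]
    have hint : ∀ x : ℝ, 0 < x → Integrable (fun z => (max 0 (1 - z * x)) ^ q) π := by
      intro x hx
      refine Integrable.of_bound (C := 1) (by fun_prop) ?_
      filter_upwards [hpos] with z hz
      rw [Real.norm_of_nonneg (by positivity)]
      refine pow_le_one₀ (le_max_left _ _) (max_le zero_le_one ?_)
      nlinarith [mul_pos hz hx]
    refine ⟨convex_Ioi 0, fun x hx x' hx' a b ha hb hab => ?_⟩
    have hx : 0 < x := hx
    have hx' : 0 < x' := hx'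
    have hx'' : 0 < a * x + b * x' := by
      have := (convex_Ioi (0 : ℝ)) hx hx' ha hb hab
      exact this
    simp only [smul_eq_mul]
    rw [hEx x hx, hEx x' hx', hEx _ hx'', ← integral_const_mul, ← integral_const_mul,
      ← integral_add ((hint x hx).const_mul a) ((hint x' hx').const_mul b)]
    refine integral_mono (hint _ hx'') (((hint x hx).const_mul a).add ((hint x' hx').const_mul b))
      fun z => ?_
    have hc : ConvexOn ℝ univ fun x : ℝ => (max 0 (1 - z * x)) ^ q := by
      have h1 : ConvexOn ℝ univ fun x : ℝ => max 0 (1 - z * x) := by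
        refine (convexOn_const (0 : ℝ) convex_univ).sup ⟨convex_univ, fun u _ w _ a b _ _ hab => ?_⟩
        simp only [smul_eq_mul]
        nlinarith
      exact h1.pow (fun _ _ => le_max_left _ _) q
    exact hc.2 (mem_univ x) (mem_univ x') ha hb hab

/-- A modulus of continuity on `(0, ∞)` that does not depend on the law `π`. -/
theorem williamsonCdf_sub_le (q : ℕ) (hq : 1 ≤ q) (π : Measure ℝ) [IsProbabilityMeasure π]
    (hpos : ∀ᵐ z ∂π, 0 < z) {y y' : ℝ} (hy : 0 < y) (h : y ≤ y') :
    williamsonCdf q π y' - williamsonCdf q π y ≤ q * ((y' - y) / y') := by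
  have hy' : 0 < y' := hy.trans_le h
  rw [williamsonCdf_eq_max q hq π hpos, williamsonCdf_eq_max q hq π hpos,
    ← integral_sub (integrable_williamson_integrand q π hpos y')
      (integrable_williamson_integrand q π hpos y)]
  have hc : (q : ℝ) * ((y' - y) / y') = ∫ _, (q : ℝ) * ((y' - y) / y') ∂π := by simp
  rw [hc]
  refine integral_mono_ae ((integrable_williamson_integrand q π hpos y').sub
      (integrable_williamson_integrand q π hpos y)) (integrable_const _) ?_
  filter_upwards [hpos] with z hz
  refine (pow_sub_pow_le_mul q (one_sub_div_max_mem hz).1 (one_sub_div_max_mono hz h)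
    (one_sub_div_max_mem hz).2).trans ?_
  have hq0 : (0 : ℝ) ≤ q := by positivity
  refine mul_le_mul_of_nonneg_left ?_ hq0
  rw [sub_div, div_self hy'.ne']
  rcases le_total z y with h1 | h1
  · rw [max_eq_left h1, max_eq_left (h1.trans h)]
    have h2 : z / y ≤ 1 := (div_le_one hy).2 h1
    have h3 : z / y' = z / y * (y / y') := by field_simp
    have h4 : y / y' ≤ 1 := (div_le_one hy').2 h
    rw [h3]
    nlinarith
  · rw [max_eq_right h1, div_self hz.ne']
    rcases le_total z y' with h2 | h2
    · rw [max_eq_left h2]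
      have : y / y' ≤ z / y' := by gcongr
      linarith
    · rw [max_eq_right h2, div_self hz.ne']
      have : y / y' ≤ 1 := (div_le_one hy').2 h
      linarith

/-- The Williamson transform as a fractional integral of the distribution function of `π`. -/
theorem pow_mul_williamsonCdf (q : ℕ) (hq : 1 ≤ q) (π : Measure ℝ) [IsProbabilityMeasure π]
    (hpos : ∀ᵐ z ∂π, 0 < z) {y : ℝ} (hy : 0 < y) :
    y ^ q * williamsonCdf q π y
      = ∫ t in Ioc 0 y, π.real (Iic (y - t)) * (q * t ^ (q - 1)) := by
  rw [williamsonCdf, mul_div_cancel₀ _ (pow_pos hy q).ne']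
  exact integral_max_sub_pow_eq q hq π aemeasurable_id (hpos.mono fun z hz => hz.le) hy.le

/-- Rescaling the law rescales the argument of the Williamson transform. -/
theorem williamsonCdf_map_div (q : ℕ) (π : Measure ℝ) {c : ℝ} (hc : 0 < c) (y : ℝ) :
    williamsonCdf q (π.map fun z => z / c) y = williamsonCdf q π (c * y) := by
  unfold williamsonCdf
  rw [integral_map (by fun_prop) (by fun_prop), mul_pow]
  rcases eq_or_ne (y ^ q) 0 with h | h
  · simp [h]
  · rw [div_eq_div_iff h (mul_ne_zero (pow_pos hc q).ne' h), ← integral_mul_const,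
      ← integral_mul_const]
    congr 1
    ext z
    have : max 0 (c * y - z) = c * max 0 (y - z / c) := by
      rw [mul_max_of_nonneg _ _ hc.le]
      congr 1
      · simp
      · field_simp
    rw [this, mul_pow]
    ring

/-- The Kendall distribution is invariant under rescaling, so that it determines a law up to scale
at best. -/
theorem kendallCdf_map_div (q : ℕ) (π : Measure ℝ) {c : ℝ} (hc : 0 < c) (t : ℝ)
    (hm : Measurable (williamsonCdf q π)) :
    kendallCdf q (π.map fun z => z / c) t = kendallCdf q π t := by
  unfold kendallCdf
  simp only [williamsonCdf_map_div q π hc]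
  rw [map_measureReal_apply (by fun_prop)]
  · congr 1
    ext z
    simp only [mem_preimage, mem_ofPred_eq]
    rw [mul_div_cancel₀ _ hc.ne']
  · exact measurableSet_le (hm.comp (measurable_const.mul measurable_id)) measurable_const

/-- A sample value lies below `y` exactly when its Williamson transform lies below that of `y`. -/
theorem measureReal_Iic_eq_kendallCdf {q : ℕ} {π : Measure ℝ}
    (hF : IsWilliamsonCdf (williamsonCdf q π)) {y : ℝ} (hy : 0 < williamsonCdf q π y) :
    π.real (Iic y) = kendallCdf q π (williamsonCdf q π y) := by
  unfold kendallCdf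
  congr 1
  ext z
  refine ⟨fun h => hF.mono h, fun h => ?_⟩
  by_contra! hc
  exact absurd (hF.lt_of_lt hy (not_le.1 hc)) (not_lt.2 h)

/-! ### The Kendall equation -/

/-- The equation which ties a Williamson transform `F` to the law `κ` of `F(Z)`: the layer-cake
formula for `F`, in which the distribution function of `Z` is expressed through `κ` and `F`. -/
def KendallEq (q : ℕ) (κ : Measure ℝ) (F : ℝ → ℝ) : Prop :=
  ∀ y > 0, y ^ q * F y = ∫ t in Ioc 0 y,
    (if 0 < F (y - t) then κ.real (Iic (F (y - t))) else 0) * (q * t ^ (q - 1))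

/-- The Williamson transform vanishes only below the support of the law. -/
theorem measure_Iio_eq_zero_of_williamsonCdf_eq_zero (q : ℕ) (hq : 1 ≤ q) (π : Measure ℝ)
    [IsProbabilityMeasure π] (hpos : ∀ᵐ z ∂π, 0 < z) {y : ℝ} (h : williamsonCdf q π y = 0) :
    π (Iio y) = 0 := by
  rw [measure_eq_zero_iff_ae_notMem]
  rw [williamsonCdf_eq_max q hq π hpos, integral_eq_zero_iff_of_nonneg_ae
    (hpos.mono fun z hz => pow_nonneg (one_sub_div_max_mem hz).1 q)
    (integrable_williamson_integrand q π hpos y)] at h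
  filter_upwards [h, hpos] with z hz hz0
  have h1 := pow_eq_zero_iff (by omega : q ≠ 0) |>.1 hz
  have h2 : 0 < max y z := lt_max_of_lt_right hz0
  rw [sub_eq_zero, eq_comm, div_eq_one_iff_eq h2.ne'] at h1
  simp only [mem_Iio, not_lt]
  exact h1 ▸ le_max_left _ _

theorem kendallEq_williamsonCdf (q : ℕ) (hq : 1 ≤ q) (π : Measure ℝ)
    [IsProbabilityMeasure π] (hpos : ∀ᵐ z ∂π, 0 < z) :
    KendallEq q (π.map (williamsonCdf q π)) (williamsonCdf q π) := by
  have hF := isWilliamsonCdf_williamsonCdf q hq π hpos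
  intro y hy
  rw [pow_mul_williamsonCdf q hq π hpos hy]
  refine integral_congr_ae ?_
  have hne : ∀ᵐ t ∂(volume.restrict (Ioc 0 y)), t ≠ y - upperInv (williamsonCdf q π) 0 :=
    ae_restrict_of_ae (by simp [ae_iff, measure_singleton])
  filter_upwards [hne] with t ht
  congr 1
  split_ifs with h
  · rw [map_measureReal_apply hF.cont.measurable measurableSet_Iic,
      measureReal_Iic_eq_kendallCdf hF h]
    rfl
  · have h0 : williamsonCdf q π (y - t) = 0 := le_antisymm (not_lt.1 h) (hF.nonneg _)
    have h1 : y - t ≤ upperInv (williamsonCdf q π) 0 :=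
      (hF.le_upperInv_iff (by simp)).2 h0.le
    have h2 : y - t < upperInv (williamsonCdf q π) 0 := lt_of_le_of_ne h1 (by
      intro h3; apply ht; linarith)
    have h3 := measure_Iio_eq_zero_of_williamsonCdf_eq_zero q hq π hpos
      (hF.apply_upperInv (v := 0) (by simp))
    rw [measureReal_def, measure_mono_null (Iic_subset_Iio.2 h2) h3]
    rfl

/-- The Kendall equation in terms of the inverse `G` of `F`. -/
theorem KendallEq.integral_upperInv {q : ℕ} (hq : 1 ≤ q) {κ : Measure ℝ} [IsFiniteMeasure κ]
    (hκ : κ (Iio 0) = 0) {F : ℝ → ℝ} (hF : IsWilliamsonCdf F) (h : KendallEq q κ F) {w : ℝ}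
    (hw : w ∈ Ioo (0 : ℝ) 1) :
    ∫ v in Ico 0 w, (1 - upperInv F v / upperInv F w) ^ q ∂κ = w := by
  have hy := hF.upperInv_pos hw
  have hw' : w ∈ Ico (0 : ℝ) 1 := ⟨hw.1.le, hw.2⟩
  set y := upperInv F w with hydef
  have h1 := h y hy
  rw [hF.apply_upperInv hw'] at h1
  have hmeas : AEMeasurable (upperInv F) (κ.restrict (Ico 0 1)) :=
    hF.continuousOn_upperInv.aemeasurable measurableSet_Ico
  have hnn : ∀ᵐ v ∂(κ.restrict (Ico 0 1)), 0 ≤ upperInv F v := by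
    filter_upwards [ae_restrict_mem measurableSet_Ico] with v hv using hF.upperInv_nonneg hv
  have h2 := integral_max_sub_pow_eq q hq (κ.restrict (Ico 0 1)) hmeas hnn hy.le
  have h3 : y ^ q * w = ∫ v in Ico 0 1, (max 0 (y - upperInv F v)) ^ q ∂κ := by
    rw [h1, h2]
    refine integral_congr_ae ?_
    have hne : ∀ᵐ t ∂(volume.restrict (Ioc 0 y)), t ≠ y - upperInv F 0 :=
      ae_restrict_of_ae (by simp [ae_iff, measure_singleton])
    filter_upwards [hne] with t ht
    congr 1
    have hms : ∀ {s t : Set ℝ}, (∀ v, v ∈ Ico (0 : ℝ) 1 → (v ∈ s ↔ v ∈ t)) →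
        (κ.restrict (Ico 0 1)).real s = (κ.restrict (Ico 0 1)).real t := by
      intro s t hst
      refine measureReal_congr ?_
      filter_upwards [ae_restrict_mem measurableSet_Ico] with v hv
      exact propext (hst v hv)
    split_ifs with hp
    · have e1 : (κ.restrict (Ico 0 1)).real {v | upperInv F v ≤ y - t}
          = (κ.restrict (Ico 0 1)).real (Iic (F (y - t))) := by
        refine hms fun v hv => ?_
        rw [mem_ofPred_eq, mem_Iic]
        rcases hv.1.eq_or_lt with h0 | h0
        · subst h0
          refine ⟨fun _ => hF.nonneg _, fun _ => ?_⟩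
          by_contra! hc
          exact absurd ((hF.le_upperInv_iff hv).1 hc.le) (not_le.2 hp)
        · exact hF.upperInv_le_iff ⟨h0, hv.2⟩
      rw [e1, measureReal_restrict_apply measurableSet_Iic]
      refine measureReal_congr ?_
      rw [← compl_mem_ae_iff] at hκ
      filter_upwards [hκ] with v hv
      refine propext ⟨fun hv2 => ⟨hv2, ?_, ?_⟩, fun hv2 => hv2.1⟩
      · simpa using hv
      · exact lt_of_le_of_lt hv2 (hF.lt_one _)
    · have e1 : (κ.restrict (Ico 0 1)).real {v | upperInv F v ≤ y - t}
          = (κ.restrict (Ico 0 1)).real ∅ := by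
        refine hms fun v hv => ?_
        simp only [mem_ofPred_eq, mem_empty_iff_false, iff_false, not_le]
        have h4 : F (y - t) ≤ 0 := not_lt.1 hp
        have h5 : y - t ≤ upperInv F 0 := (hF.le_upperInv_iff (by simp)).2 h4
        have h6 : upperInv F 0 ≤ upperInv F v :=
          hF.strictMonoOn_upperInv.monotoneOn (by simp) hv hv.1
        rcases h5.lt_or_eq with h7 | h7
        · linarith
        · exact absurd (by linarith) ht
      rw [e1]
      simp
  have hsub : Ico 0 w ⊆ Ico (0 : ℝ) 1 := Ico_subset_Ico_right hw.2.le
  rw [setIntegral_eq_of_subset_of_forall_sdiff_eq_zero (s := Ico 0 w) measurableSet_Ico hsub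
    (by
      intro v hv
      have hv2 : w ≤ v := by
        by_contra! hc
        exact hv.2 ⟨hv.1.1, hc⟩
      have := hF.strictMonoOn_upperInv.monotoneOn hw' hv.1 hv2
      rw [max_eq_left (by linarith), zero_pow (by omega)])] at h3
  have h4 : ∫ v in Ico 0 w, (1 - upperInv F v / y) ^ q ∂κ
      = (∫ v in Ico 0 w, (max 0 (y - upperInv F v)) ^ q ∂κ) / y ^ q := by
    rw [← integral_div]
    refine setIntegral_congr_fun measurableSet_Ico fun v hv => ?_
    have := (hF.strictMonoOn_upperInv.monotoneOn (hsub hv) hw' hv.2.le)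
    rw [max_eq_right (by linarith), ← div_pow, sub_div, div_self hy.ne']
  rw [h4, ← h3, mul_div_cancel_left₀ _ (pow_pos hy q).ne']

/-! ### Identifiability: the Kendall equation determines `G` up to scale -/

/-- The solutions of the Kendall equation for `κ`, in terms of the inverse `G` of the Williamson
transform. -/
structure IsKendallInverse (q : ℕ) (κ : Measure ℝ) (G : ℝ → ℝ) : Prop where
  nonneg : 0 ≤ G 0
  strictMonoOn : StrictMonoOn G (Ico 0 1)
  continuousOn : ContinuousOn G (Ico 0 1)
  integral_eq : ∀ w ∈ Ioo (0 : ℝ) 1, ∫ v in Ico 0 w, (1 - G v / G w) ^ q ∂κ = w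

theorem KendallEq.isKendallInverse {q : ℕ} (hq : 1 ≤ q) {κ : Measure ℝ} [IsFiniteMeasure κ]
    (hκ : κ (Iio 0) = 0) {F : ℝ → ℝ} (hF : IsWilliamsonCdf F) (h : KendallEq q κ F) :
    IsKendallInverse q κ (upperInv F) :=
  ⟨hF.upperInv_nonneg (by simp), hF.strictMonoOn_upperInv, hF.continuousOn_upperInv,
    fun _ hw => h.integral_upperInv hq hκ hF hw⟩

theorem IsKendallInverse.pos {q : ℕ} {κ : Measure ℝ} {G : ℝ → ℝ} (h : IsKendallInverse q κ G)
    {v : ℝ} (hv : v ∈ Ioo (0 : ℝ) 1) : 0 < G v :=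
  h.nonneg.trans_lt (h.strictMonoOn (by simp) ⟨hv.1.le, hv.2⟩ hv.1)

theorem IsKendallInverse.nonneg' {q : ℕ} {κ : Measure ℝ} {G : ℝ → ℝ} (h : IsKendallInverse q κ G)
    {v : ℝ} (hv : v ∈ Ico (0 : ℝ) 1) : 0 ≤ G v :=
  h.nonneg.trans (h.strictMonoOn.monotoneOn (by simp) hv hv.1)

theorem IsKendallInverse.div_mem {q : ℕ} {κ : Measure ℝ} {G : ℝ → ℝ} (h : IsKendallInverse q κ G)
    {v w : ℝ} (hw : w ∈ Ioo (0 : ℝ) 1) (hv : v ∈ Icc 0 w) : G v / G w ∈ Icc (0 : ℝ) 1 := by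
  have hv' : v ∈ Ico (0 : ℝ) 1 := ⟨hv.1, hv.2.trans_lt hw.2⟩
  have hp := h.pos hw
  refine ⟨div_nonneg (h.nonneg' hv') hp.le, (div_le_one hp).2 ?_⟩
  exact h.strictMonoOn.monotoneOn hv' ⟨hw.1.le, hw.2⟩ hv.2

theorem IsKendallInverse.aemeasurable {q : ℕ} {κ : Measure ℝ} {G : ℝ → ℝ}
    (h : IsKendallInverse q κ G) {w : ℝ} (hw : w ≤ 1) :
    AEMeasurable G (κ.restrict (Ico 0 w)) :=
  (h.continuousOn.mono (Ico_subset_Ico_right hw)).aemeasurable measurableSet_Ico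

theorem integrable_one_sub_mul_pow {α : Type*} [MeasurableSpace α] {κ : Measure α}
    [IsFiniteMeasure κ] {s : α → ℝ} (hs : AEMeasurable s κ)
    (h : ∀ᵐ a ∂κ, s a ∈ Icc (0 : ℝ) 1) {η : ℝ} (hη : η ∈ Icc (0 : ℝ) 1) (q : ℕ) :
    Integrable (fun a => (1 - η * s a) ^ q) κ := by
  refine Integrable.of_bound (C := 1)
    ((aemeasurable_const.sub (hs.const_mul η)).pow_const q).aestronglyMeasurable ?_
  filter_upwards [h] with a ha
  have h1 : 0 ≤ η * s a := mul_nonneg hη.1 ha.1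
  have h2 : η * s a ≤ 1 := mul_le_one₀ hη.2 ha.1 ha.2
  rw [Real.norm_of_nonneg (pow_nonneg (by linarith) _)]
  exact pow_le_one₀ (by linarith) (by linarith)

/-- The two integral relations which the comparison of two solutions provides are incompatible
with any pointwise inequality that makes a nonnegative combination of them dominate `s`. -/
theorem false_of_pointwise {α : Type*} [MeasurableSpace α] {κ : Measure α}
    [IsFiniteMeasure κ] {s s' : α → ℝ} (hs : AEMeasurable s κ) (hs' : AEMeasurable s' κ)
    (h : ∀ᵐ a ∂κ, s a ∈ Icc (0 : ℝ) 1) (h' : ∀ᵐ a ∂κ, s' a ∈ Icc (0 : ℝ) 1)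
    {η p : ℝ} (hη : η ∈ Icc (0 : ℝ) 1) (hp : p ∈ Icc (0 : ℝ) 1) {q : ℕ}
    (h1 : ∫ a, (1 - s a) ^ q ∂κ = ∫ a, (1 - s' a) ^ q ∂κ)
    (h2 : ∫ a, (1 - p * s' a) ^ q ∂κ ≤ ∫ a, (1 - η * s a) ^ q ∂κ)
    (hpos : 0 < ∫ a, s a ∂κ) {c A B : ℝ} (hc : 0 < c) (hB : 0 ≤ B)
    (hpt : ∀ᵐ a ∂κ, c * s a ≤ A * ((1 - s a) ^ q - (1 - s' a) ^ q)
      + B * ((1 - p * s' a) ^ q - (1 - η * s a) ^ q)) : False := by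
  have i1 : Integrable (fun a => (1 - s a) ^ q) κ := by
    simpa using integrable_one_sub_mul_pow hs h (η := 1) (by simp) q
  have i2 : Integrable (fun a => (1 - s' a) ^ q) κ := by
    simpa using integrable_one_sub_mul_pow hs' h' (η := 1) (by simp) q
  have i3 := integrable_one_sub_mul_pow hs h hη q
  have i4 := integrable_one_sub_mul_pow hs' h' hp q
  have i5 : Integrable s κ := by
    refine Integrable.of_bound (C := 1) hs.aestronglyMeasurable ?_
    filter_upwards [h] with a ha
    rw [Real.norm_of_nonneg ha.1]
    exact ha.2
  have iA : Integrable (fun a => A * ((1 - s a) ^ q - (1 - s' a) ^ q)) κ :=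
    (i1.sub i2).const_mul A
  have iB : Integrable (fun a => B * ((1 - p * s' a) ^ q - (1 - η * s a) ^ q)) κ :=
    (i4.sub i3).const_mul B
  have := integral_mono_ae (i5.const_mul c) (iA.add iB) hpt
  simp only [Pi.add_apply] at this
  rw [integral_add iA iB, integral_const_mul,
    integral_const_mul, integral_const_mul, integral_sub i1 i2, integral_sub i4 i3, h1] at this
  nlinarith [mul_pos hc hpos, mul_nonneg hB (sub_nonneg.2 h2)]

/-- Bernoulli bounds `1 - q x ≤ (1 - x) ^ q ≤ 1 - x` make the combination with weights `q p` and `1`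
dominate a multiple of `s`; the terms in `s'` cancel. -/
theorem harnack_pointwise (q : ℕ) {s s' η p : ℝ} (hs : s ∈ Icc (0 : ℝ) 1)
    (hs' : s' ∈ Icc (0 : ℝ) 1) (hη : η ∈ Icc (0 : ℝ) 1) (hp : p ∈ Icc (0 : ℝ) 1) (hq : 1 ≤ q) :
    (η - q ^ 2 * p) * s ≤ (q * p) * ((1 - s) ^ q - (1 - s') ^ q)
      + 1 * ((1 - p * s') ^ q - (1 - η * s) ^ q) := by
  have up : ∀ x ∈ Icc (0 : ℝ) 1, (1 - x) ^ q ≤ 1 - x := fun x hx =>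
    pow_le_of_le_one (by linarith [hx.2]) (by linarith [hx.1]) (by omega)
  have low : ∀ x ∈ Icc (0 : ℝ) 1, 1 - q * x ≤ (1 - x) ^ q := fun x hx => by
    have := one_add_mul_le_pow (a := -x) (by linarith [hx.2]) q
    rw [← sub_eq_add_neg] at this
    linarith
  have a1 := low s hs
  have a2 := up s' hs'
  have a3 := low (p * s') ⟨mul_nonneg hp.1 hs'.1, mul_le_one₀ hp.2 hs'.1 hs'.2⟩
  have a4 := up (η * s) ⟨mul_nonneg hη.1 hs.1, mul_le_one₀ hη.2 hs.1 hs.2⟩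
  have hqp : 0 ≤ (q : ℝ) * p := mul_nonneg (by positivity) hp.1
  nlinarith [mul_nonneg hqp (sub_nonneg.2 a1), mul_nonneg hqp (sub_nonneg.2 a2)]

/-- The pointwise inequality behind identifiability.  Where `s' ≥ ρ² s` the first difference
dominates `s`, elsewhere the second one does; both lose at most a multiple of `ε s`. -/
theorem contraction_pointwise (q : ℕ) (hq : 1 ≤ q) {ρ c ε : ℝ} (hρ : 1 < ρ)
    (hε : 0 < ε) (hc1 : c ≤ (1 - (ρ ^ 2)⁻¹) ^ (q - 1) * (ρ ^ 2 - 1))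
    (hc2 : c ≤ (1 - ρ⁻¹) ^ q) {s s' η p : ℝ} (hs : s ∈ Icc (0 : ℝ) 1)
    (hs' : s' ∈ Icc (0 : ℝ) 1) (hη : η ∈ Ioc (0 : ℝ) 1) (hp : p ∈ Ioc (0 : ℝ) 1)
    (h1 : s ≤ (1 + ε) * s') (h2 : p * s' ≤ (1 + ε) * (η * s)) (hL : p * ρ ^ 3 ≤ η) :
    (c - 2 * q * ε) * s ≤ 1 * ((1 - s) ^ q - (1 - s') ^ q)
      + η⁻¹ * ((1 - p * s') ^ q - (1 - η * s) ^ q) := by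
  have hq0 : (0 : ℝ) ≤ q := by positivity
  have hρ0 : 0 < ρ := by linarith
  have hps0 : 0 ≤ p * s' := mul_nonneg hp.1.le hs'.1
  have hps1 : p * s' ≤ 1 := mul_le_one₀ hp.2 hs'.1 hs'.2
  have hηs0 : 0 ≤ η * s := mul_nonneg hη.1.le hs.1
  have hηs1 : η * s ≤ 1 := mul_le_one₀ hη.2 hs.1 hs.2
  -- the general lower bounds
  have g1 : -(q * ε * s) ≤ (1 - s) ^ q - (1 - s') ^ q := by
    rcases le_total s s' with h | h
    · have := pow_le_pow_left₀ (by linarith [hs'.2] : 0 ≤ 1 - s') (by linarith : 1 - s' ≤ 1 - s) q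
      have : 0 ≤ q * ε * s := mul_nonneg (by positivity) hs.1
      linarith
    · have := pow_sub_pow_le_mul q (by linarith [hs.2] : 0 ≤ 1 - s) (by linarith : 1 - s ≤ 1 - s')
        (by linarith [hs'.1])
      have h3 : (q : ℝ) * (1 - s' - (1 - s)) ≤ q * (ε * s) :=
        mul_le_mul_of_nonneg_left (by nlinarith) hq0
      linarith
  have g2 : -(q * ε * (η * s)) ≤ (1 - p * s') ^ q - (1 - η * s) ^ q := by
    rcases le_total (p * s') (η * s) with h | h
    · have := pow_le_pow_left₀ (by linarith : 0 ≤ 1 - η * s)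
        (by linarith : 1 - η * s ≤ 1 - p * s') q
      have : 0 ≤ q * ε * (η * s) := mul_nonneg (by positivity) hηs0
      linarith
    · have := pow_sub_pow_le_mul q (by linarith : 0 ≤ 1 - p * s')
        (by linarith : 1 - p * s' ≤ 1 - η * s) (by linarith)
      have h3 : (q : ℝ) * (1 - η * s - (1 - p * s')) ≤ q * (ε * (η * s)) :=
        mul_le_mul_of_nonneg_left (by linarith) hq0
      linarith
  have g2' : -(q * ε * s) ≤ η⁻¹ * ((1 - p * s') ^ q - (1 - η * s) ^ q) := by
    have := mul_le_mul_of_nonneg_left g2 (inv_pos.2 hη.1).le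
    have e : η⁻¹ * -(q * ε * (η * s)) = -(q * ε * s) := by
      have := hη.1.ne'
      field_simp
    linarith
  rcases le_or_gt (ρ ^ 2 * s) s' with hB | hB
  · have hs2 : s ≤ (ρ ^ 2)⁻¹ := by
      rw [← one_div, le_div_iff₀ (by positivity)]
      nlinarith [hs'.2]
    have hρ2 : 1 < ρ ^ 2 := one_lt_pow₀ hρ (by norm_num)
    have hss : s ≤ s' := by nlinarith [hs.1]
    have k1 := pow_pred_mul_sub_le q hq (by linarith [hs'.2] : 0 ≤ 1 - s')
      (by linarith : 1 - s' ≤ 1 - s)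
    have hinv : (ρ ^ 2)⁻¹ ≤ 1 := inv_le_one_of_one_le₀ hρ2.le
    have k2 : (1 - (ρ ^ 2)⁻¹) ^ (q - 1) ≤ (1 - s) ^ (q - 1) :=
      pow_le_pow_left₀ (by linarith) (by linarith) _
    have k3 : (1 - (ρ ^ 2)⁻¹) ^ (q - 1) * ((ρ ^ 2 - 1) * s)
        ≤ (1 - s) ^ (q - 1) * (1 - s - (1 - s')) :=
      mul_le_mul k2 (by linarith) (mul_nonneg (by linarith) hs.1)
        (pow_nonneg (by linarith [hs.2]) _)
    have k4 : c * s ≤ (1 - (ρ ^ 2)⁻¹) ^ (q - 1) * ((ρ ^ 2 - 1) * s) := by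
      rw [← mul_assoc]
      exact mul_le_mul_of_nonneg_right hc1 hs.1
    have k5 : 0 ≤ q * ε * s := mul_nonneg (by positivity) hs.1
    linarith
  · have hinv : ρ⁻¹ < 1 := inv_lt_one_of_one_lt₀ hρ
    have hinv0 : 0 < ρ⁻¹ := inv_pos.2 hρ0
    have k0 : p * s' ≤ ρ⁻¹ * (η * s) := by
      have e1 : p * s' ≤ p * (ρ ^ 2 * s) := mul_le_mul_of_nonneg_left hB.le hp.1.le
      have e2 : p * (ρ ^ 2 * s) = ρ⁻¹ * (p * ρ ^ 3 * s) := by field_simp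
      rw [e2] at e1
      exact e1.trans (mul_le_mul_of_nonneg_left (mul_le_mul_of_nonneg_right hL hs.1) hinv0.le)
    have k1 := pow_pred_mul_sub_le q hq (by linarith : 0 ≤ 1 - η * s)
      (by nlinarith : 1 - η * s ≤ 1 - p * s')
    have k2 : (1 - ρ⁻¹) ^ (q - 1) ≤ (1 - p * s') ^ (q - 1) :=
      pow_le_pow_left₀ (by linarith) (by nlinarith) _
    have k3 : (1 - ρ⁻¹) ^ (q - 1) * ((1 - ρ⁻¹) * (η * s))
        ≤ (1 - p * s') ^ (q - 1) * (1 - p * s' - (1 - η * s)) :=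
      mul_le_mul k2 (by linarith) (mul_nonneg (by linarith) hηs0)
        (pow_nonneg (by linarith) _)
    have k4 : (1 - ρ⁻¹) ^ q = (1 - ρ⁻¹) ^ (q - 1) * (1 - ρ⁻¹) := by
      rw [← pow_succ]
      congr 1
      omega
    have k5 : c * (η * s) ≤ (1 - p * s') ^ q - (1 - η * s) ^ q := by
      have := mul_le_mul_of_nonneg_right hc2 hηs0
      rw [k4] at this
      linarith
    have k6 : c * s ≤ η⁻¹ * ((1 - p * s') ^ q - (1 - η * s) ^ q) := by
      have := mul_le_mul_of_nonneg_left k5 (inv_pos.2 hη.1).le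
      have e : η⁻¹ * (c * (η * s)) = c * s := by
        have := hη.1.ne'
        field_simp
      linarith
    have k7 : 0 ≤ q * ε * s := mul_nonneg (by positivity) hs.1
    linarith

/-- If the integral vanished, then `G` would vanish `κ`-almost everywhere on `[0, w)`, and the
Kendall equation would give `κ [0, u) = u` for `u ≤ w`; but `G > 0` on `(0, 1)`, so that `κ` could
only charge `0` there. -/
theorem IsKendallInverse.integral_div_pos {q : ℕ} {κ : Measure ℝ} [IsFiniteMeasure κ] {G : ℝ → ℝ}
    (h : IsKendallInverse q κ G) {w : ℝ} (hw : w ∈ Ioo (0 : ℝ) 1) :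
    0 < ∫ v in Ico 0 w, G v / G w ∂κ := by
  have hnn : ∀ᵐ v ∂(κ.restrict (Ico 0 w)), 0 ≤ G v / G w := by
    filter_upwards [ae_restrict_mem measurableSet_Ico] with v hv
      using (h.div_mem hw ⟨hv.1, hv.2.le⟩).1
  have hint : Integrable (fun v => G v / G w) (κ.restrict (Ico 0 w)) := by
    refine Integrable.of_bound (C := 1)
      ((h.aemeasurable hw.2.le).div_const _).aestronglyMeasurable ?_
    filter_upwards [ae_restrict_mem measurableSet_Ico] with v hv
    have := h.div_mem hw ⟨hv.1, hv.2.le⟩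
    rw [Real.norm_of_nonneg this.1]
    exact this.2
  refine lt_of_le_of_ne (integral_nonneg_of_ae hnn) fun h0 => ?_
  rw [eq_comm, integral_eq_zero_iff_of_nonneg_ae hnn hint] at h0
  have hz : ∀ᵐ v ∂κ, v ∈ Ico 0 w → G v = 0 := by
    rw [← ae_restrict_iff' measurableSet_Ico]
    filter_upwards [h0] with v hv
    simpa [(h.pos hw).ne'] using hv
  have key : ∀ u ∈ Ioc 0 w, κ.real (Ico 0 u) = u := by
    intro u hu
    have hu' : u ∈ Ioo (0 : ℝ) 1 := ⟨hu.1, hu.2.trans_lt hw.2⟩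
    refine Eq.trans ?_ (h.integral_eq u hu')
    rw [setIntegral_congr_ae (g := fun _ => 1) measurableSet_Ico]
    · simp
    · filter_upwards [hz] with v hv hvu
      rw [hv ⟨hvu.1, hvu.2.trans_le hu.2⟩]
      simp
  have e1 := key w ⟨hw.1, le_rfl⟩
  have e2 := key (w / 2) ⟨by linarith [hw.1], by linarith [hw.1]⟩
  have e3 : κ.real (Ico 0 w) = κ.real (Ico 0 (w / 2)) := by
    refine measureReal_congr ?_
    filter_upwards [hz] with v hv
    refine propext ⟨fun hvw => ⟨hvw.1, ?_⟩, fun hvw => ⟨hvw.1, ?_⟩⟩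
    · by_contra! hc
      have : 0 < v := by linarith [hw.1]
      have hvw : v ∈ Ico 0 w := hvw
      exact (h.pos ⟨this, hvw.2.trans hw.2⟩).ne' (hv hvw)
    · have := hvw.2
      linarith [hw.1]
  linarith [hw.1]

/-- Two solutions compared at `w < w'`, where `w'` is the first point at which the ratio of the
solutions reaches its value. -/
theorem IsKendallInverse.comparison {q : ℕ} {κ : Measure ℝ} [IsFiniteMeasure κ] {G₁ G₂ : ℝ → ℝ}
    (h₁ : IsKendallInverse q κ G₁) (h₂ : IsKendallInverse q κ G₂) {w w' : ℝ}
    (hw : w ∈ Ioo (0 : ℝ) 1) (hw' : w' ∈ Ioo (0 : ℝ) 1) (hww : w < w')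
    (hr : ∀ v ∈ Ico w w', G₂ v / G₁ v < G₂ w' / G₁ w') :
    (∫ v in Ico 0 w, (1 - G₁ v / G₁ w) ^ q ∂κ = ∫ v in Ico 0 w, (1 - G₂ v / G₂ w) ^ q ∂κ) ∧
    ∫ v in Ico 0 w, (1 - G₂ w / G₂ w' * (G₂ v / G₂ w)) ^ q ∂κ
      ≤ ∫ v in Ico 0 w, (1 - G₁ w / G₁ w' * (G₁ v / G₁ w)) ^ q ∂κ := by
  refine ⟨by rw [h₁.integral_eq w hw, h₂.integral_eq w hw], ?_⟩
  have p1 := (h₁.pos hw).ne'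
  have p2 := (h₂.pos hw).ne'
  have e1 : ∀ v, G₁ w / G₁ w' * (G₁ v / G₁ w) = G₁ v / G₁ w' := by intro v; field_simp
  have e2 : ∀ v, G₂ w / G₂ w' * (G₂ v / G₂ w) = G₂ v / G₂ w' := by intro v; field_simp
  simp only [e1, e2]
  have hint : ∀ {G : ℝ → ℝ}, IsKendallInverse q κ G →
      IntegrableOn (fun v => (1 - G v / G w') ^ q) (Ico 0 w') κ := by
    intro G hG
    have := integrable_one_sub_mul_pow (κ := κ.restrict (Ico 0 w')) (s := fun v => G v / G w')
      ((hG.aemeasurable hw'.2.le).div_const _) (by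
        filter_upwards [ae_restrict_mem measurableSet_Ico] with v hv
          using hG.div_mem hw' ⟨hv.1, hv.2.le⟩) (η := 1) (by simp) q
    simpa [IntegrableOn] using this
  have hsplit : ∀ {G : ℝ → ℝ}, IsKendallInverse q κ G →
      ∫ v in Ico 0 w, (1 - G v / G w') ^ q ∂κ + ∫ v in Ico w w', (1 - G v / G w') ^ q ∂κ = w' := by
    intro G hG
    refine Eq.trans ?_ (hG.integral_eq w' hw')
    rw [← Ico_union_Ico_eq_Ico hw.1.le hww.le]
    refine (setIntegral_union ?_ measurableSet_Ico ((hint hG).mono_set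
      (Ico_subset_Ico_right hww.le)) ((hint hG).mono_set (Ico_subset_Ico_left hw.1.le))).symm
    rw [Set.disjoint_left]
    intro v hv hv2
    exact absurd hv.2 (not_lt.2 hv2.1)
  have hle : ∫ v in Ico w w', (1 - G₁ v / G₁ w') ^ q ∂κ
      ≤ ∫ v in Ico w w', (1 - G₂ v / G₂ w') ^ q ∂κ := by
    refine setIntegral_mono_on ((hint h₁).mono_set (Ico_subset_Ico_left hw.1.le))
      ((hint h₂).mono_set (Ico_subset_Ico_left hw.1.le)) measurableSet_Ico fun v hv => ?_
    have hv' : v ∈ Ioo (0 : ℝ) 1 := ⟨hw.1.trans_le hv.1, hv.2.trans hw'.2⟩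
    have m1 := h₁.div_mem hw' ⟨hv'.1.le, hv.2.le⟩
    refine pow_le_pow_left₀ (by linarith [m1.2]) ?_ q
    have := hr v hv
    rw [div_lt_div_iff₀ (h₁.pos hv') (h₁.pos hw')] at this
    have : G₂ v / G₂ w' ≤ G₁ v / G₁ w' := by
      rw [div_le_div_iff₀ (h₂.pos hw') (h₁.pos hw')]
      linarith
    linarith
  have := hsplit h₁
  have := hsplit h₂
  linarith

/-- The first point at which the ratio of two solutions reaches a prescribed value above its value
at `w`; before it the ratio is smaller. -/
theorem IsKendallInverse.exists_first_hit {q : ℕ} {κ : Measure ℝ} {G₁ G₂ : ℝ → ℝ}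
    (h₁ : IsKendallInverse q κ G₁) (h₂ : IsKendallInverse q κ G₂) {w w' : ℝ}
    (hw : w ∈ Ioo (0 : ℝ) 1) (hw' : w' ∈ Ioo (0 : ℝ) 1) (hww : w < w')
    (hr : G₂ w / G₁ w < G₂ w' / G₁ w') :
    ∃ u ∈ Ioc w w', G₂ w' / G₁ w' ≤ G₂ u / G₁ u ∧
      ∀ v ∈ Ico w u, G₂ v / G₁ v < G₂ u / G₁ u := by
  have hsub : Icc w w' ⊆ Ico (0 : ℝ) 1 := fun v hv => ⟨hw.1.le.trans hv.1, hv.2.trans_lt hw'.2⟩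
  have hcont : ContinuousOn (fun v => G₂ v / G₁ v) (Icc w w') :=
    (h₂.continuousOn.mono hsub).div (h₁.continuousOn.mono hsub) fun v hv =>
      (h₁.pos ⟨hw.1.trans_le hv.1, hv.2.trans_lt hw'.2⟩).ne'
  have hcomp : IsCompact (Icc w w' ∩ (fun v => G₂ v / G₁ v) ⁻¹' Ici (G₂ w' / G₁ w')) :=
    isCompact_Icc.of_isClosed_subset (hcont.preimage_isClosed_of_isClosed isClosed_Icc isClosed_Ici)
      inter_subset_left
  obtain ⟨u, hu, hmin⟩ := hcomp.exists_isLeast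
    ⟨w', ⟨hww.le, le_rfl⟩, mem_preimage.2 (mem_Ici.2 le_rfl)⟩
  have hu2 : G₂ w' / G₁ w' ≤ G₂ u / G₁ u := hu.2
  refine ⟨u, ⟨lt_of_le_of_ne hu.1.1 ?_, hu.1.2⟩, hu2, fun v hv => ?_⟩
  · rintro rfl
    exact absurd hu2 (not_le.2 hr)
  · by_contra! hc
    exact absurd (hmin ⟨⟨hv.1, hv.2.le.trans hu.1.2⟩, hu2.trans hc⟩) (not_le.2 hv.2)

/-- A Harnack inequality for the ratio of two solutions: at the first point at which the ratio
reaches a value above `q ^ 2` times its value at `w`, the two integral relations would contradict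
`harnack_pointwise`. -/
theorem IsKendallInverse.harnack {q : ℕ} (hq : 1 ≤ q) {κ : Measure ℝ} [IsFiniteMeasure κ]
    {G₁ G₂ : ℝ → ℝ} (h₁ : IsKendallInverse q κ G₁) (h₂ : IsKendallInverse q κ G₂) {w w' : ℝ}
    (hw : w ∈ Ioo (0 : ℝ) 1) (hw' : w' ∈ Ioo (0 : ℝ) 1) (hww : w < w') :
    G₂ w' / G₁ w' ≤ q ^ 2 * (G₂ w / G₁ w) := by
  by_contra! hc
  have hq1 : (1 : ℝ) ≤ q := by exact_mod_cast hq
  have hr : G₂ w / G₁ w < G₂ w' / G₁ w' := by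
    have : 0 < G₂ w / G₁ w := div_pos (h₂.pos hw) (h₁.pos hw)
    exact (le_mul_of_one_le_left this.le (one_le_pow₀ hq1)).trans_lt hc
  obtain ⟨u, hu, hu1, hu2⟩ := h₁.exists_first_hit h₂ hw hw' hww hr
  have huI : u ∈ Ioo (0 : ℝ) 1 := ⟨hw.1.trans hu.1, hu.2.trans_lt hw'.2⟩
  obtain ⟨c1, c2⟩ := h₁.comparison h₂ hw huI hu.1 hu2
  have hη := h₁.div_mem huI ⟨hw.1.le, hu.1.le⟩
  have hp := h₂.div_mem huI ⟨hw.1.le, hu.1.le⟩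
  have hs : ∀ {G : ℝ → ℝ}, IsKendallInverse q κ G →
      ∀ᵐ v ∂(κ.restrict (Ico 0 w)), G v / G w ∈ Icc (0 : ℝ) 1 := fun hG => by
    filter_upwards [ae_restrict_mem measurableSet_Ico] with v hv
      using hG.div_mem hw ⟨hv.1, hv.2.le⟩
  refine false_of_pointwise ((h₁.aemeasurable hw.2.le).div_const _)
    ((h₂.aemeasurable hw.2.le).div_const _) (hs h₁) (hs h₂) hη hp c1 c2 (h₁.integral_div_pos hw)
    (c := G₁ w / G₁ u - q ^ 2 * (G₂ w / G₂ u)) (A := q * (G₂ w / G₂ u)) (B := 1) ?_ zero_le_one ?_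
  · rw [sub_pos]
    have hc2 := hc.trans_le hu1
    have a1 := h₁.pos hw
    have a2 := h₂.pos hw
    have a3 := h₁.pos huI
    have a4 := h₂.pos huI
    rw [← mul_div_assoc, div_lt_div_iff₀ a1 a3] at hc2
    rw [← mul_div_assoc, div_lt_div_iff₀ a4 a3]
    linarith
  · filter_upwards [hs h₁, hs h₂] with v hv1 hv2
    exact harnack_pointwise q hv1 hv2 hη hp hq

/-- Linear bounds between two solutions extend to the end point `0`, which may carry an atom of `κ`.
-/
theorem IsKendallInverse.le_on_Ico {q : ℕ} {κ : Measure ℝ} {G₁ G₂ : ℝ → ℝ}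
    (h₁ : IsKendallInverse q κ G₁) (h₂ : IsKendallInverse q κ G₂) {a b : ℝ}
    (h : ∀ v ∈ Ioo (0 : ℝ) 1, a * G₁ v ≤ b * G₂ v) :
    ∀ v ∈ Ico (0 : ℝ) 1, a * G₁ v ≤ b * G₂ v := by
  intro v hv
  rcases hv.1.eq_or_lt with h0 | h0
  · subst h0
    have hlim : ∀ {G : ℝ → ℝ}, IsKendallInverse q κ G → Tendsto G (𝓝[Ioo 0 1] 0) (𝓝 (G 0)) :=
      fun hG => (hG.continuousOn 0 (by simp)).mono_left (nhdsWithin_mono _ Ioo_subset_Ico_self)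
    have : (𝓝[Ioo (0 : ℝ) 1] 0).NeBot := by
      rw [← mem_closure_iff_nhdsWithin_neBot, closure_Ioo (by norm_num)]
      simp
    refine le_of_tendsto_of_tendsto ((hlim h₁).const_mul a) ((hlim h₂).const_mul b) ?_
    filter_upwards [self_mem_nhdsWithin] with u hu using h u hu
  · exact h v ⟨h0, hv.2⟩

/-- If the ratio of two solutions, with values in `[a, b]`, is almost minimal at `w` and almost
maximal at a later `w'`, then `s = G₁ / G₁ w` and `s' = G₂ / G₂ w` satisfy `s ≤ (1 + ε) s'`, while
the reverse inequality holds after both are rescaled to the first hitting point near `w'`.  By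
`contraction_pointwise` this contradicts the integral relations of `IsKendallInverse.comparison`. -/
theorem IsKendallInverse.false_of_oscillation {q : ℕ} (hq : 1 ≤ q) {κ : Measure ℝ}
    [IsFiniteMeasure κ] {G₁ G₂ : ℝ → ℝ} (h₁ : IsKendallInverse q κ G₁)
    (h₂ : IsKendallInverse q κ G₂) {a b ρ ε c : ℝ} (ha : 0 < a)
    (hlow : ∀ v ∈ Ioo (0 : ℝ) 1, a ≤ G₂ v / G₁ v) (hup : ∀ v ∈ Ioo (0 : ℝ) 1, G₂ v / G₁ v ≤ b)
    (hρ : 1 < ρ) (hρab : a * ρ ^ 4 ≤ b) (hε : 0 < ε) (hερ : (1 + ε) ^ 2 ≤ ρ)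
    (hc1 : c ≤ (1 - (ρ ^ 2)⁻¹) ^ (q - 1) * (ρ ^ 2 - 1)) (hc2 : c ≤ (1 - ρ⁻¹) ^ q)
    (hcε : 2 * q * ε < c) {w w' : ℝ} (hw : w ∈ Ioo (0 : ℝ) 1) (hw' : w' ∈ Ioo (0 : ℝ) 1)
    (hww : w < w') (hwa : G₂ w / G₁ w ≤ a * (1 + ε)) (hwb : b ≤ (1 + ε) * (G₂ w' / G₁ w')) :
    False := by
  have hρ3 : 1 < ρ ^ 3 := one_lt_pow₀ hρ (by norm_num)
  have hkey : a * (1 + ε) * ρ ^ 3 * (1 + ε) ≤ b := by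
    have : a * ρ ^ 3 * (1 + ε) ^ 2 ≤ a * ρ ^ 3 * ρ :=
      mul_le_mul_of_nonneg_left hερ (by positivity)
    nlinarith
  have hkey2 : G₂ w / G₁ w * ρ ^ 3 ≤ G₂ w' / G₁ w' := by
    have h3 : G₂ w / G₁ w * ρ ^ 3 ≤ a * (1 + ε) * ρ ^ 3 :=
      mul_le_mul_of_nonneg_right hwa (by positivity)
    have h4 : (1 + ε) * (G₂ w / G₁ w * ρ ^ 3) ≤ (1 + ε) * (G₂ w' / G₁ w') := by nlinarith
    exact le_of_mul_le_mul_left h4 (by linarith)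
  have hrpos : 0 < G₂ w / G₁ w := div_pos (h₂.pos hw) (h₁.pos hw)
  obtain ⟨u, hu, hu1, hu2⟩ := h₁.exists_first_hit h₂ hw hw' hww (by nlinarith)
  have huI : u ∈ Ioo (0 : ℝ) 1 := ⟨hw.1.trans hu.1, hu.2.trans_lt hw'.2⟩
  obtain ⟨c1, c2⟩ := h₁.comparison h₂ hw huI hu.1 hu2
  have a1 := h₁.pos hw
  have a2 := h₂.pos hw
  have a3 := h₁.pos huI
  have a4 := h₂.pos huI
  have hη := h₁.div_mem huI ⟨hw.1.le, hu.1.le⟩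
  have hp := h₂.div_mem huI ⟨hw.1.le, hu.1.le⟩
  have hs : ∀ {G : ℝ → ℝ}, IsKendallInverse q κ G →
      ∀ᵐ v ∂(κ.restrict (Ico 0 w)), G v / G w ∈ Icc (0 : ℝ) 1 := fun hG => by
    filter_upwards [ae_restrict_mem measurableSet_Ico] with v hv
      using hG.div_mem hw ⟨hv.1, hv.2.le⟩
  have hlow' := h₁.le_on_Ico h₂ (a := a) (b := 1) (fun v hv => by
    rw [one_mul, ← le_div_iff₀ (h₁.pos hv)]; exact hlow v hv)
  have hup' := h₂.le_on_Ico h₁ (a := 1) (b := b) (fun v hv => by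
    rw [one_mul, ← div_le_iff₀ (h₁.pos hv)]; exact hup v hv)
  refine false_of_pointwise ((h₁.aemeasurable hw.2.le).div_const _)
    ((h₂.aemeasurable hw.2.le).div_const _) (hs h₁) (hs h₂) hη hp c1 c2 (h₁.integral_div_pos hw)
    (c := c - 2 * q * ε) (A := 1) (B := (G₁ w / G₁ u)⁻¹) (by linarith)
    (inv_nonneg.2 hη.1) ?_
  filter_upwards [hs h₁, hs h₂, ae_restrict_mem measurableSet_Ico] with v hv1 hv2 hv
  have hvI : v ∈ Ico (0 : ℝ) 1 := ⟨hv.1, hv.2.trans hw.2⟩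
  refine contraction_pointwise q hq hρ hε hc1 hc2 hv1 hv2 ⟨div_pos a1 a3, hη.2⟩
    ⟨div_pos a2 a4, hp.2⟩ ?_ ?_ ?_
  · have e1 := hlow' v hvI
    rw [div_le_iff₀ a1] at hwa
    rw [← mul_div_assoc, div_le_div_iff₀ a1 a2]
    have e0 := h₁.nonneg' hvI
    have e2 : G₁ v * G₂ w ≤ G₁ v * (a * (1 + ε) * G₁ w) := mul_le_mul_of_nonneg_left hwa e0
    have e3 : a * G₁ v * ((1 + ε) * G₁ w) ≤ 1 * G₂ v * ((1 + ε) * G₁ w) :=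
      mul_le_mul_of_nonneg_right e1 (by positivity)
    linarith
  · have e1 := hup' v hvI
    have e2 : b ≤ (1 + ε) * (G₂ u / G₁ u) :=
      hwb.trans (mul_le_mul_of_nonneg_left hu1 (by linarith))
    rw [← mul_div_assoc, le_div_iff₀ a3] at e2
    have e3 : G₂ w / G₂ u * (G₂ v / G₂ w) = G₂ v / G₂ u := by field_simp
    have e4 : G₁ w / G₁ u * (G₁ v / G₁ w) = G₁ v / G₁ u := by field_simp
    rw [e3, e4, ← mul_div_assoc, div_le_div_iff₀ a4 a3]
    have e0 := h₁.nonneg' hvI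
    have e5 : G₁ v * (b * G₁ u) ≤ G₁ v * ((1 + ε) * G₂ u) := mul_le_mul_of_nonneg_left e2 e0
    have e6 : 1 * G₂ v * G₁ u ≤ b * G₁ v * G₁ u := mul_le_mul_of_nonneg_right e1 a3.le
    linarith
  · have e2 := hkey2.trans hu1
    rw [div_mul_eq_mul_div, div_le_div_iff₀ a1 a3] at e2
    rw [div_mul_eq_mul_div, div_le_div_iff₀ a4 a3]
    linarith

/-- Identifiability: two solutions of the Kendall equation agree up to a scale factor.  The ratio
of the two has bounded oscillation by the Harnack inequality, and near-extremal values of the ratio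
at two different points contradict each other unless the oscillation vanishes. -/
theorem IsKendallInverse.exists_eq_mul {q : ℕ} (hq : 1 ≤ q) {κ : Measure ℝ} [IsFiniteMeasure κ]
    {G₁ G₂ : ℝ → ℝ} (h₁ : IsKendallInverse q κ G₁) (h₂ : IsKendallInverse q κ G₂) :
    ∃ c > 0, ∀ v ∈ Ico (0 : ℝ) 1, G₂ v = c * G₁ v := by
  have hq1 : (1 : ℝ) ≤ q := by exact_mod_cast hq
  have hrpos : ∀ v ∈ Ioo (0 : ℝ) 1, 0 < G₂ v / G₁ v :=
    fun v hv => div_pos (h₂.pos hv) (h₁.pos hv)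
  have hH : ∀ u ∈ Ioo (0 : ℝ) 1, ∀ v ∈ Ioo (0 : ℝ) 1, G₂ u / G₁ u ≤ q ^ 2 * (G₂ v / G₁ v) := by
    intro u hu v hv
    rcases lt_trichotomy v u with h | h | h
    · exact h₁.harnack hq h₂ hv hu h
    · subst h
      exact le_mul_of_one_le_left (hrpos v hv).le (one_le_pow₀ hq1)
    · have := h₂.harnack hq h₁ hu hv h
      rw [← inv_div, ← inv_div (G₂ u), ← div_eq_mul_inv, inv_eq_one_div,
        div_le_div_iff₀ (hrpos v hv) (hrpos u hu)] at this
      linarith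
  set S := (fun v => G₂ v / G₁ v) '' Ioo (0 : ℝ) 1 with hS
  have hhalf : (1 / 2 : ℝ) ∈ Ioo (0 : ℝ) 1 := by constructor <;> norm_num
  have hne : S.Nonempty := ⟨_, 1 / 2, hhalf, rfl⟩
  have hbdd : BddAbove S := ⟨q ^ 2 * (G₂ (1 / 2) / G₁ (1 / 2)), by
    rintro _ ⟨u, hu, rfl⟩
    exact hH u hu _ hhalf⟩
  have hlb : (G₂ (1 / 2) / G₁ (1 / 2)) / q ^ 2 ∈ lowerBounds S := by
    rintro _ ⟨u, hu, rfl⟩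
    rw [div_le_iff₀ (by positivity), mul_comm]
    exact hH _ hhalf u hu
  have hbddb : BddBelow S := ⟨_, hlb⟩
  have ha : 0 < sInf S :=
    (div_pos (hrpos _ hhalf) (by positivity)).trans_le (le_csInf hne hlb)
  have hlow : ∀ v ∈ Ioo (0 : ℝ) 1, sInf S ≤ G₂ v / G₁ v := fun v hv => csInf_le hbddb ⟨v, hv, rfl⟩
  have hup : ∀ v ∈ Ioo (0 : ℝ) 1, G₂ v / G₁ v ≤ sSup S := fun v hv => le_csSup hbdd ⟨v, hv, rfl⟩
  rcases (csInf_le_csSup hne hbddb hbdd).eq_or_lt with hab | hab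
  · refine ⟨sInf S, ha, fun v hv => le_antisymm ?_ ?_⟩
    · have := h₂.le_on_Ico h₁ (a := 1) (b := sInf S) (fun v hv => by
        rw [one_mul, ← div_le_iff₀ (h₁.pos hv), hab]; exact hup v hv) v hv
      linarith
    · have := h₁.le_on_Ico h₂ (a := sInf S) (b := 1) (fun v hv => by
        rw [one_mul, ← le_div_iff₀ (h₁.pos hv)]; exact hlow v hv) v hv
      linarith
  exfalso
  set a := sInf S
  set b := sSup S
  -- `b / a = ρ ^ 4` leaves a factor `ρ ^ 3` after the two losses of `1 + ε` at near-extremal points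
  obtain ⟨ρ, hρ, hρab⟩ : ∃ ρ : ℝ, 1 < ρ ∧ a * ρ ^ 4 ≤ b := by
    have h1 : 1 < b / a := (one_lt_div ha).2 hab
    refine ⟨√√(b / a), ?_, ?_⟩
    · rw [Real.lt_sqrt zero_le_one, one_pow, Real.lt_sqrt zero_le_one, one_pow]
      exact h1
    · have : √√(b / a) ^ 4 = b / a := by
        have e : √√(b / a) ^ 4 = (√√(b / a) ^ 2) ^ 2 := by ring
        rw [e, Real.sq_sqrt (Real.sqrt_nonneg _), Real.sq_sqrt (by positivity)]
      rw [this, mul_div_cancel₀ _ ha.ne']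
  have hρ2 : 1 < ρ ^ 2 := one_lt_pow₀ hρ (by norm_num)
  -- `c` is the gain in `contraction_pointwise`, and `2 q ε` its loss
  set c := min ((1 - (ρ ^ 2)⁻¹) ^ (q - 1) * (ρ ^ 2 - 1)) ((1 - ρ⁻¹) ^ q) with hc
  have hc0 : 0 < c := by
    have e1 := inv_lt_one_of_one_lt₀ hρ2
    have e2 := inv_lt_one_of_one_lt₀ hρ
    exact lt_min (mul_pos (pow_pos (by linarith) _) (by linarith)) (pow_pos (by linarith) _)
  obtain ⟨ε, hε, hε1, hε2⟩ : ∃ ε > 0, (1 + ε) ^ 2 ≤ ρ ∧ 2 * q * ε < c := by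
    refine ⟨min (min 1 ((ρ - 1) / 3)) (c / (4 * q)), ?_, ?_, ?_⟩
    · refine lt_min (lt_min one_pos (by linarith)) (by positivity)
    · set ε := min (min 1 ((ρ - 1) / 3)) (c / (4 * q))
      have e1 : ε ≤ 1 := (min_le_left _ _).trans (min_le_left _ _)
      have e2 : ε ≤ (ρ - 1) / 3 := (min_le_left _ _).trans (min_le_right _ _)
      have e3 : 0 < ε := lt_min (lt_min one_pos (by linarith)) (by positivity)
      nlinarith
    · have e1 : min (min 1 ((ρ - 1) / 3)) (c / (4 * q)) ≤ c / (4 * q) := min_le_right _ _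
      have e2 : 2 * (q : ℝ) * (c / (4 * q)) = c / 2 := by field_simp; norm_num
      have e3 : 2 * (q : ℝ) * min (min 1 ((ρ - 1) / 3)) (c / (4 * q))
        ≤ 2 * (q : ℝ) * (c / (4 * q)) := mul_le_mul_of_nonneg_left e1 (by positivity)
      linarith
  obtain ⟨_, ⟨u, hu, rfl⟩, hua⟩ := exists_lt_of_csInf_lt hne
    (show sInf S < a * (1 + ε) by
      have : 0 < a * ε := mul_pos ha hε
      show a < a * (1 + ε)
      linarith)
  obtain ⟨_, ⟨u', hu', rfl⟩, hub⟩ := exists_lt_of_lt_csSup hne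
    (show b / (1 + ε) < sSup S by
      show b / (1 + ε) < b
      rw [div_lt_iff₀ (by linarith)]
      have : 0 < b * ε := mul_pos (ha.trans hab) hε
      linarith)
  simp only at hua hub
  rw [div_lt_iff₀ (by linarith)] at hub
  rcases lt_trichotomy u u' with h | h | h
  · exact h₁.false_of_oscillation hq h₂ ha hlow hup hρ hρab hε hε1 (min_le_left _ _)
      (min_le_right _ _) hε2 hu hu' h hua.le (by linarith)
  · subst h
    have e1 : b < a * (1 + ε) * (1 + ε) := by nlinarith
    have e2 : a * (1 + ε) ^ 2 ≤ a * ρ := mul_le_mul_of_nonneg_left hε1 ha.le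
    have e3 : a * ρ ≤ a * ρ ^ 4 :=
      mul_le_mul_of_nonneg_left (le_self_pow₀ hρ.le (by norm_num)) ha.le
    linarith
  -- if the near-maximum precedes the near-minimum, the inverse ratio is compared instead
  · have hb : 0 < b := ha.trans hab
    refine h₂.false_of_oscillation hq h₁ (a := b⁻¹) (b := a⁻¹) (inv_pos.2 hb) (fun v hv => ?_)
      (fun v hv => ?_) hρ ?_ hε hε1 (min_le_left _ _) (min_le_right _ _) hε2 hu' hu h ?_ ?_
    · rw [← inv_div (G₂ v)]
      exact inv_anti₀ (hrpos v hv) (hup v hv)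
    · rw [← inv_div (G₂ v)]
      exact inv_anti₀ ha (hlow v hv)
    · rw [inv_mul_le_iff₀ hb, le_mul_inv_iff₀ ha]
      linarith
    · rw [← inv_div (G₂ u'), ← div_eq_inv_mul, inv_eq_one_div, div_le_div_iff₀ (hrpos u' hu') hb]
      linarith
    · rw [← inv_div (G₂ u), ← div_eq_mul_inv, inv_eq_one_div, div_le_div_iff₀ ha (hrpos u hu)]
      linarith

/-! ### Stability: Williamson transforms depend continuously on the Kendall distribution -/

/-- The two distribution functions are within Lévy distance `δ`. -/
def LevyClose (δ : ℝ) (K₁ K₂ : ℝ → ℝ) : Prop :=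
  ∀ t, K₁ t ≤ K₂ (t + δ) + δ ∧ K₂ t ≤ K₁ (t + δ) + δ

theorem kendallCdf_mono (q : ℕ) (π : Measure ℝ) [IsFiniteMeasure π] :
    Monotone (kendallCdf q π) := fun _ _ h =>
  measureReal_mono fun _ hz => le_trans hz h

/-- Lévy convergence gives convergence at continuity points of the limit, also along moving
arguments. -/
theorem tendsto_of_levyClose {K : ℝ → ℝ} {Kn : ℕ → ℝ → ℝ} (hKn : ∀ n, Monotone (Kn n))
    (hclose : ∀ δ > 0, ∀ᶠ n in atTop, LevyClose δ (Kn n) K) {x : ℝ} {xn : ℕ → ℝ}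
    (hx : Tendsto xn atTop (𝓝 x)) (hK : ContinuousAt K x) :
    Tendsto (fun n => Kn n (xn n)) atTop (𝓝 (K x)) := by
  rw [Metric.tendsto_nhds]
  intro ε hε
  obtain ⟨δ, hδ, hball⟩ := Metric.continuousAt_iff.1 hK (ε / 2) (by linarith)
  set δ' := min (δ / 3) (ε / 3) with hδ'
  have h0 : 0 < δ' := lt_min (by linarith) (by linarith)
  have h1 : δ' ≤ δ / 3 := min_le_left _ _
  have h2 : δ' ≤ ε / 3 := min_le_right _ _
  filter_upwards [hclose δ' h0, Metric.tendsto_nhds.1 hx δ' h0] with n hn hxn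
  rw [Real.dist_eq, abs_lt] at hxn
  have a1 := (hn (x + δ')).1
  have a2 := (hn (x - δ' - δ')).2
  have a3 := hKn n (show xn n ≤ x + δ' by linarith)
  have a4 := hKn n (show x - δ' - δ' + δ' ≤ xn n by linarith)
  have b1 := hball (x := x + δ' + δ') (by rw [Real.dist_eq, abs_lt]; constructor <;> linarith)
  have b2 := hball (x := x - δ' - δ') (by rw [Real.dist_eq, abs_lt]; constructor <;> linarith)
  rw [Real.dist_eq, abs_lt] at b1 b2 ⊢
  constructor <;> linarith

/-- A Markov-type bound: the mass of `(0, z]` contributes at least `(1 - z / y) ^ q` per unit to the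
Williamson transform at `y ≥ z`. -/
theorem measureReal_mul_le_williamsonCdf (q : ℕ) (hq : 1 ≤ q) (π : Measure ℝ)
    [IsProbabilityMeasure π] (hpos : ∀ᵐ z ∂π, 0 < z) {y z : ℝ} (hz : 0 < z) (hzy : z ≤ y) :
    π.real (Iic z) * (1 - z / y) ^ q ≤ williamsonCdf q π y := by
  have hy := hz.trans_le hzy
  rw [williamsonCdf_eq_max q hq π hpos]
  have h1 : π.real (Iic z) * (1 - z / y) ^ q
      = ∫ x, (Iic z).indicator (fun _ => (1 - z / y) ^ q) x ∂π := by
    rw [integral_indicator measurableSet_Iic, setIntegral_const, smul_eq_mul]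
  rw [h1]
  refine integral_mono_ae ((integrable_const _).indicator measurableSet_Iic)
    (integrable_williamson_integrand q π hpos y) ?_
  filter_upwards [hpos] with x hx
  by_cases hxz : x ∈ Iic z
  · rw [indicator_of_mem hxz]
    have hxz : x ≤ z := hxz
    rw [max_eq_left (hxz.trans hzy)]
    have h2 : z / y ≤ 1 := (div_le_one hy).2 hzy
    have h3 : x / y ≤ z / y := by gcongr
    exact pow_le_pow_left₀ (by linarith) (by linarith) q
  · rw [indicator_of_notMem hxz]
    exact pow_nonneg (one_sub_div_max_mem hx).1 q

theorem map_williamsonCdf_real_Iic {q : ℕ} {π : Measure ℝ}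
    (hF : IsWilliamsonCdf (williamsonCdf q π)) (t : ℝ) :
    (π.map (williamsonCdf q π)).real (Iic t) = kendallCdf q π t := by
  rw [map_measureReal_apply hF.cont.measurable measurableSet_Iic]
  rfl

theorem map_williamsonCdf_Iio_zero {q : ℕ} {π : Measure ℝ}
    (hF : IsWilliamsonCdf (williamsonCdf q π)) : π.map (williamsonCdf q π) (Iio 0) = 0 := by
  rw [Measure.map_apply hF.cont.measurable measurableSet_Iio]
  have : williamsonCdf q π ⁻¹' Iio 0 = ∅ := by
    ext z
    simpa using hF.nonneg z
  rw [this, measure_empty]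

/-- The Kendall distribution function lies strictly above the diagonal, also from the left. -/
theorem exists_lt_lt_kendallCdf (q : ℕ) (hq : 1 ≤ q) (π : Measure ℝ)
    [IsProbabilityMeasure π] (hpos : ∀ᵐ z ∂π, 0 < z) {w : ℝ} (hw : w ∈ Ioo (0 : ℝ) 1) :
    ∃ t < w, w < kendallCdf q π t := by
  have hF := isWilliamsonCdf_williamsonCdf q hq π hpos
  set κ := π.map (williamsonCdf q π) with hκ
  have : IsProbabilityMeasure κ := Measure.isProbabilityMeasure_map hF.cont.measurable.aemeasurable
  have hG := (kendallEq_williamsonCdf q hq π hpos).isKendallInverse hq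
    (map_williamsonCdf_Iio_zero hF) hF
  have h1 := hG.integral_eq w hw
  have h2 := hG.integral_div_pos hw
  have hmem : ∀ᵐ v ∂(κ.restrict (Ico 0 w)),
      upperInv (williamsonCdf q π) v / upperInv (williamsonCdf q π) w ∈ Icc (0 : ℝ) 1 := by
    filter_upwards [ae_restrict_mem measurableSet_Ico] with v hv
      using hG.div_mem hw ⟨hv.1, hv.2.le⟩
  have hae := (hG.aemeasurable hw.2.le).div_const (upperInv (williamsonCdf q π) w)
  have i1 := integrable_one_sub_mul_pow hae hmem (η := 1) (by simp) q
  have i2 := integrable_one_sub_mul_pow hae hmem (η := 1) (by simp) 1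
  simp only [one_mul, pow_one] at i1 i2
  have h3 : w ≤ ∫ v in Ico 0 w,
      (1 - upperInv (williamsonCdf q π) v / upperInv (williamsonCdf q π) w) ∂κ := by
    refine Eq.trans_le h1.symm (integral_mono_ae i1 i2 ?_)
    filter_upwards [hmem] with v hv
    exact pow_le_of_le_one (by linarith [hv.2]) (by linarith [hv.1]) (by omega)
  have i3 : Integrable (fun v => upperInv (williamsonCdf q π) v / upperInv (williamsonCdf q π) w)
      (κ.restrict (Ico 0 w)) := by
    have := (integrable_const (1 : ℝ)).sub i2
    refine this.congr (Eventually.of_forall fun v => ?_)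
    simp
  rw [integral_sub (integrable_const _) i3] at h3
  simp only [integral_const, smul_eq_mul, mul_one, measureReal_restrict_apply_univ] at h3
  have h4 : w < κ.real (Iio w) :=
    lt_of_lt_of_le (by linarith) (measureReal_mono (Ico_subset_Iio_self))
  obtain ⟨u, humono, hulim⟩ := (exists_seq_strictMono_tendsto w)
  have hU : ⋃ n, Iic (u n) = Iio w := iUnion_Iic_eq_Iio_of_lt_of_tendsto hulim.1 hulim.2
  have h5 : Tendsto (fun n => κ.real (Iic (u n))) atTop (𝓝 (κ.real (Iio w))) := by
    rw [← hU]
    refine (ENNReal.tendsto_toReal (measure_ne_top _ _)).comp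
      (tendsto_measure_iUnion_atTop fun m n h => Iic_subset_Iic.2 (humono.monotone h))
  obtain ⟨n, hn⟩ := (h5.eventually (lt_mem_nhds h4)).exists
  exact ⟨u n, hulim.1 n, by rwa [map_williamsonCdf_real_Iic hF] at hn⟩

/-- Compactness: a diagonal subsequence converges at the rationals, and the modulus of continuity of
`williamsonCdf_sub_le` extends the convergence to all `y > 0`.  The limit may lose mass at `0` or at
`∞`. -/
theorem exists_subseq_tendsto_williamsonCdf (q : ℕ) (hq : 1 ≤ q) (πn : ℕ → Measure ℝ)
    [∀ n, IsProbabilityMeasure (πn n)] (hpos : ∀ n, ∀ᵐ z ∂(πn n), 0 < z) :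
    ∃ (ms : ℕ → ℕ) (Φ : ℝ → ℝ), StrictMono ms ∧
      ∀ y > 0, Tendsto (fun n => williamsonCdf q (πn (ms n)) y) atTop (𝓝 (Φ y)) := by
  have hF := fun n => isWilliamsonCdf_williamsonCdf q hq (πn n) (hpos n)
  obtain ⟨ℓ, -, ms, hms, hlim⟩ := (isCompact_univ_pi (fun _ : ℚ => isCompact_Icc (a := (0 : ℝ))
    (b := 1))).tendsto_subseq (x := fun n => fun r : ℚ => williamsonCdf q (πn n) r)
    (fun n r _ => ⟨(hF n).nonneg _, (hF n).le_one _⟩)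
  rw [tendsto_pi_nhds] at hlim
  have hcauchy : ∀ y > 0, ∃ x, Tendsto (fun n => williamsonCdf q (πn (ms n)) y) atTop (𝓝 x) := by
    intro y hy
    refine cauchySeq_tendsto_of_complete (Metric.cauchySeq_iff.2 fun ε hε => ?_)
    have hq0 : (0 : ℝ) < q := by exact_mod_cast hq
    obtain ⟨r, hr1, hr2⟩ := exists_rat_btwn (show y < y + ε * y / (3 * q) by
      have : 0 < ε * y / (3 * q) := by positivity
      linarith)
    have hclose : ∀ n, |williamsonCdf q (πn n) r - williamsonCdf q (πn n) y| ≤ ε / 3 := by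
      intro n
      rw [abs_of_nonneg (sub_nonneg.2 ((hF n).mono hr1.le))]
      refine (williamsonCdf_sub_le q hq (πn n) (hpos n) hy hr1.le).trans ?_
      have hr0 : (0 : ℝ) < r := hy.trans hr1
      calc (q : ℝ) * ((r - y) / r) ≤ q * ((r - y) / y) := by
            have : 0 ≤ (r : ℝ) - y := by linarith
            gcongr
        _ ≤ q * ((ε * y / (3 * q)) / y) := by gcongr; linarith
        _ = ε / 3 := by field_simp
    obtain ⟨N, hN⟩ := Metric.cauchySeq_iff.1 (hlim r).cauchySeq (ε / 3) (by linarith)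
    refine ⟨N, fun m hm n hn => ?_⟩
    have h1 := hN m hm n hn
    have h2 := hclose (ms m)
    have h3 := hclose (ms n)
    simp only [Function.comp] at h1
    rw [Real.dist_eq] at h1 ⊢
    rw [abs_lt] at h1 ⊢
    rw [abs_le] at h2 h3
    constructor <;> linarith
  choose! Φ hΦ using hcauchy
  exact ⟨ms, Φ, hms, hΦ⟩

/-- No mass is lost in the limit if the Kendall distributions converge.  Were the limit `Φ` bounded
away from `0` or from `1`, with extreme value `w`, then `w ≥ K t` for all `t < w`, whereas the
Kendall distribution function `K` of `π` lies strictly above the diagonal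
(`exists_lt_lt_kendallCdf`). -/
theorem isWilliamsonCdf_of_tendsto (q : ℕ) (hq : 1 ≤ q) (π : Measure ℝ) [IsProbabilityMeasure π]
    (hpos : ∀ᵐ z ∂π, 0 < z) (πn : ℕ → Measure ℝ)
    [∀ n, IsProbabilityMeasure (πn n)] (hposn : ∀ n, ∀ᵐ z ∂(πn n), 0 < z)
    (hclose : ∀ δ > 0, ∀ᶠ n in atTop, LevyClose δ (kendallCdf q (πn n)) (kendallCdf q π))
    {v : ℝ} (hv : v ∈ Ioo (0 : ℝ) 1) (hnorm : ∀ n, williamsonCdf q (πn n) 1 = v)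
    {Φ : ℝ → ℝ} (hΦ0 : ∀ y ≤ 0, Φ y = 0)
    (hΦ : ∀ y > 0, Tendsto (fun n => williamsonCdf q (πn n) y) atTop (𝓝 (Φ y))) :
    IsWilliamsonCdf Φ := by
  have hF := fun n => isWilliamsonCdf_williamsonCdf q hq (πn n) (hposn n)
  have hmono' : ∀ y > 0, ∀ y' ≥ y, Φ y ≤ Φ y' := fun y hy y' h =>
    le_of_tendsto_of_tendsto' (hΦ y hy) (hΦ y' (hy.trans_le h)) fun n => (hF n).mono h
  have hnn : ∀ y, 0 ≤ Φ y := by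
    intro y
    rcases le_or_gt y 0 with h | h
    · exact (hΦ0 y h).ge
    · exact ge_of_tendsto' (hΦ y h) fun n => (hF n).nonneg y
  have hle1 : ∀ y, Φ y ≤ 1 := by
    intro y
    rcases le_or_gt y 0 with h | h
    · rw [hΦ0 y h]; exact zero_le_one
    · exact le_of_tendsto' (hΦ y h) fun n => (hF n).le_one y
  have hmono : Monotone Φ := by
    intro y y' h
    rcases le_or_gt y 0 with h0 | h0
    · rw [hΦ0 y h0]; exact hnn y'
    · exact hmono' y h0 y' h
  have hsub : ∀ y > 0, ∀ y' ≥ y, Φ y' - Φ y ≤ q * ((y' - y) / y') := fun y hy y' h =>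
    le_of_tendsto' ((hΦ y' (hy.trans_le h)).sub (hΦ y hy)) fun n =>
      williamsonCdf_sub_le q hq (πn n) (hposn n) hy h
  have h1 : Φ 1 = v := tendsto_nhds_unique (hΦ 1 one_pos) (by simp [hnorm])
  -- a lower bound by the Kendall distribution, which excludes mass escaping to `0` or to `∞`
  have key : ∀ t z y : ℝ, 0 < z → z ≤ y → t < Φ z → 0 < Φ z →
      kendallCdf q π t * (1 - z / y) ^ q ≤ Φ y := by
    intro t z y hz hzy htz hz0
    have hy := hz.trans_le hzy
    have hfac : 0 ≤ (1 - z / y) ^ q :=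
      pow_nonneg (by linarith [(div_le_one hy).2 hzy]) _
    have hδ : ∀ᶠ δ in 𝓝[>] (0 : ℝ), (kendallCdf q π t - δ) * (1 - z / y) ^ q ≤ Φ y := by
      have h2 : ∀ᶠ δ in 𝓝[>] (0 : ℝ), t + δ < Φ z := by
        have : Tendsto (fun δ : ℝ => t + δ) (𝓝[>] 0) (𝓝 (t + 0)) :=
          (tendsto_const_nhds.add tendsto_id).mono_left nhdsWithin_le_nhds
        rw [add_zero] at this
        exact this.eventually (gt_mem_nhds htz)
      filter_upwards [h2, self_mem_nhdsWithin] with δ hδ1 hδ0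
      refine ge_of_tendsto (hΦ y hy) ?_
      filter_upwards [hclose δ hδ0, (hΦ z hz).eventually (lt_mem_nhds hδ1),
        (hΦ z hz).eventually (lt_mem_nhds hz0)] with n hn1 hn2 hn3
      refine le_trans ?_ (measureReal_mul_le_williamsonCdf q hq (πn n) (hposn n) hz hzy)
      refine mul_le_mul_of_nonneg_right ?_ hfac
      rw [measureReal_Iic_eq_kendallCdf (hF n) hn3]
      have := (hn1 t).2
      have := kendallCdf_mono q (πn n) hn2.le
      linarith
    have hlim : Tendsto (fun δ : ℝ => (kendallCdf q π t - δ) * (1 - z / y) ^ q) (𝓝[>] 0)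
        (𝓝 ((kendallCdf q π t - 0) * (1 - z / y) ^ q)) :=
      ((tendsto_const_nhds.sub tendsto_id).mul_const _).mono_left nhdsWithin_le_nhds
    rw [sub_zero] at hlim
    exact le_of_tendsto hlim hδ
  have hzero : ∀ ε > 0, ∃ y > 0, Φ y < ε := by
    by_contra! hcon
    obtain ⟨ε, hε, hcon⟩ := hcon
    set S := Φ '' Ioi 0
    have hS : S.Nonempty := ⟨_, 1, mem_Ioi.2 one_pos, rfl⟩
    have hSb : BddBelow S := ⟨0, by rintro _ ⟨y, -, rfl⟩; exact hnn y⟩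
    have hw0 : 0 < sInf S := hε.trans_le (le_csInf hS (by rintro _ ⟨y, hy, rfl⟩; exact hcon y hy))
    have hw1 : sInf S < 1 := (csInf_le hSb ⟨1, mem_Ioi.2 one_pos, rfl⟩).trans_lt (h1 ▸ hv.2)
    obtain ⟨t, ht1, ht2⟩ := exists_lt_lt_kendallCdf q hq π hpos ⟨hw0, hw1⟩
    have : kendallCdf q π t ≤ sInf S := by
      refine le_csInf hS ?_
      rintro _ ⟨y, hy, rfl⟩
      have hy : 0 < y := hy
      have h2 : ∀ᶠ z in 𝓝[>] (0 : ℝ), kendallCdf q π t * (1 - z / y) ^ q ≤ Φ y := by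
        filter_upwards [self_mem_nhdsWithin, mem_nhdsWithin_of_mem_nhds (gt_mem_nhds hy)]
          with z hz hzy
        have hzS : sInf S ≤ Φ z := csInf_le hSb ⟨z, hz, rfl⟩
        exact key t z y hz (le_of_lt hzy) (ht1.trans_le hzS) (hw0.trans_le hzS)
      have h3 : Tendsto (fun z : ℝ => kendallCdf q π t * (1 - z / y) ^ q) (𝓝[>] 0)
          (𝓝 (kendallCdf q π t * (1 - 0 / y) ^ q)) :=
        (((tendsto_const_nhds.sub (tendsto_id.div_const y)).pow q).const_mul _).mono_left
          nhdsWithin_le_nhds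
      simp only [zero_div, sub_zero, one_pow, mul_one] at h3
      exact le_of_tendsto h3 h2
    linarith
  have hone : ∀ ε > 0, ∃ y > 0, 1 - ε < Φ y := by
    by_contra! hcon
    obtain ⟨ε, hε, hcon⟩ := hcon
    set S := Φ '' Ioi 0
    have hS : S.Nonempty := ⟨_, 1, mem_Ioi.2 one_pos, rfl⟩
    have hSb : BddAbove S := ⟨1, by rintro _ ⟨y, -, rfl⟩; exact hle1 y⟩
    have hw1 : sSup S < 1 :=
      (csSup_le hS (by rintro _ ⟨y, hy, rfl⟩; exact hcon y hy)).trans_lt (by linarith)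
    have hw0 : 0 < sSup S := hv.1.trans_le (h1 ▸ le_csSup hSb ⟨1, mem_Ioi.2 one_pos, rfl⟩)
    obtain ⟨t, ht1, ht2⟩ := exists_lt_lt_kendallCdf q hq π hpos ⟨hw0, hw1⟩
    obtain ⟨_, ⟨z, hz, rfl⟩, hz2⟩ := exists_lt_of_lt_csSup hS (max_lt ht1 hw0)
    have hz : 0 < z := hz
    have h2 : ∀ᶠ y in atTop, kendallCdf q π t * (1 - z / y) ^ q ≤ sSup S := by
      filter_upwards [eventually_ge_atTop z] with y hy
      exact (key t z y hz hy ((le_max_left _ _).trans_lt hz2)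
        ((le_max_right _ _).trans_lt hz2)).trans (le_csSup hSb ⟨y, hz.trans_le hy, rfl⟩)
    have h3 : Tendsto (fun y : ℝ => kendallCdf q π t * (1 - z / y) ^ q) atTop
        (𝓝 (kendallCdf q π t * (1 - 0) ^ q)) :=
      ((tendsto_const_nhds.sub (tendsto_const_nhds.div_atTop tendsto_id)).pow q).const_mul _
    simp only [sub_zero, one_pow, mul_one] at h3
    have := le_of_tendsto h3 h2
    linarith
  refine ⟨hΦ0, hmono, ?_, ?_, ?_⟩
  · rw [continuous_iff_continuousAt]
    intro y
    rcases lt_trichotomy y 0 with h | h | h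
    · refine (continuousAt_const (y := (0 : ℝ))).congr ?_
      filter_upwards [gt_mem_nhds h] with x hx
      exact (hΦ0 x (le_of_lt hx)).symm
    · subst h
      rw [Metric.continuousAt_iff]
      intro ε hε
      obtain ⟨y, hy, hyε⟩ := hzero ε hε
      refine ⟨y, hy, fun {x} hx => ?_⟩
      rw [Real.dist_eq, hΦ0 0 le_rfl, sub_zero, abs_of_nonneg (hnn x)]
      rw [Real.dist_eq, sub_zero] at hx
      exact (hmono ((le_abs_self x).trans hx.le)).trans_lt hyε
    · rw [ContinuousAt, tendsto_iff_dist_tendsto_zero]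
      have hlim : Tendsto (fun x => (q : ℝ) * (|x - y| / y)) (𝓝 y) (𝓝 0) := by
        have : Tendsto (fun x => (q : ℝ) * (|x - y| / y)) (𝓝 y) (𝓝 ((q : ℝ) * (|y - y| / y))) :=
          (by fun_prop : Continuous fun x : ℝ => (q : ℝ) * (|x - y| / y)).tendsto y
        simpa using this
      refine squeeze_zero' (Eventually.of_forall fun _ => dist_nonneg) ?_ hlim
      filter_upwards [lt_mem_nhds h] with x hx
      have hq0 : (0 : ℝ) ≤ q := by positivity
      rw [Real.dist_eq]
      rcases le_total y x with hxy | hxy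
      · rw [abs_of_nonneg (sub_nonneg.2 (hmono hxy)), abs_of_nonneg (sub_nonneg.2 hxy)]
        refine (hsub y h x hxy).trans (mul_le_mul_of_nonneg_left ?_ hq0)
        have : 0 ≤ x - y := sub_nonneg.2 hxy
        gcongr
      · rw [abs_sub_comm, abs_of_nonneg (sub_nonneg.2 (hmono hxy)), abs_sub_comm,
          abs_of_nonneg (sub_nonneg.2 hxy)]
        exact hsub x hx y hxy
  · rw [Metric.tendsto_atTop]
    intro ε hε
    obtain ⟨y, hy, hyε⟩ := hone ε hε
    refine ⟨y, fun x hx => ?_⟩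
    rw [Real.dist_eq, abs_sub_comm, abs_of_nonneg (sub_nonneg.2 (hle1 x))]
    linarith [hmono hx]
  · refine ⟨convex_Ioi 0, fun x hx x' hx' a b ha hb hab => ?_⟩
    have hx'' := (convex_Ioi (0 : ℝ)) hx hx' ha hb hab
    exact le_of_tendsto_of_tendsto' (hΦ _ (inv_pos.2 hx''))
      (((hΦ _ (inv_pos.2 hx)).const_smul a).add ((hΦ _ (inv_pos.2 hx')).const_smul b))
      fun n => (hF n).convex.2 hx hx' ha hb hab

/-- The Kendall equation passes to the limit by dominated convergence, since the integrands converge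
except where the argument of `Φ` is `0`, the lower end point of `Φ`, or one of the countably many
points which `Φ` maps to a discontinuity of the Kendall distribution function. -/
theorem kendallEq_of_tendsto (q : ℕ) (hq : 1 ≤ q) (π : Measure ℝ) [IsProbabilityMeasure π]
    (hpos : ∀ᵐ z ∂π, 0 < z) (πn : ℕ → Measure ℝ)
    [∀ n, IsProbabilityMeasure (πn n)] (hposn : ∀ n, ∀ᵐ z ∂(πn n), 0 < z)
    (hclose : ∀ δ > 0, ∀ᶠ n in atTop, LevyClose δ (kendallCdf q (πn n)) (kendallCdf q π))
    {Φ : ℝ → ℝ} (hW : IsWilliamsonCdf Φ)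
    (hΦ : ∀ y > 0, Tendsto (fun n => williamsonCdf q (πn n) y) atTop (𝓝 (Φ y))) :
    KendallEq q (π.map (williamsonCdf q π)) Φ := by
  have hF := fun n => isWilliamsonCdf_williamsonCdf q hq (πn n) (hposn n)
  have hFπ := isWilliamsonCdf_williamsonCdf q hq π hpos
  have hpt : ∀ z > 0, z ≠ upperInv Φ 0 → (0 < Φ z → ContinuousAt (kendallCdf q π) (Φ z)) →
      Tendsto (fun n => (πn n).real (Iic z)) atTop
        (𝓝 (if 0 < Φ z then kendallCdf q π (Φ z) else 0)) := by
    intro z hz hz0 hcont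
    split_ifs with h
    · refine (tendsto_of_levyClose (fun n => kendallCdf_mono q (πn n)) hclose (hΦ z hz)
        (hcont h)).congr' ?_
      filter_upwards [(hΦ z hz).eventually (lt_mem_nhds h)] with n hn
      exact (measureReal_Iic_eq_kendallCdf (hF n) hn).symm
    · have hΦz : Φ z = 0 := le_antisymm (not_lt.1 h) (hW.nonneg z)
      have h0 : (0 : ℝ) ∈ Ico (0 : ℝ) 1 := by simp
      have hlt : z < upperInv Φ 0 := lt_of_le_of_ne ((hW.le_upperInv_iff h0).2 hΦz.le) hz0
      obtain ⟨z', hz1, hz2⟩ := exists_between hlt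
      have hΦz' : Φ z' = 0 := le_antisymm ((hW.le_upperInv_iff h0).1 hz2.le) (hW.nonneg z')
      have hz' : 0 < z' := hz.trans hz1
      have hfac : 0 < (1 - z / z') ^ q := pow_pos (by linarith [(div_lt_one hz').2 hz1]) _
      have hlim : Tendsto (fun n => williamsonCdf q (πn n) z' / (1 - z / z') ^ q) atTop
          (𝓝 0) := by
        have := (hΦ z' hz').div_const ((1 - z / z') ^ q)
        rwa [hΦz', zero_div] at this
      refine squeeze_zero (fun n => measureReal_nonneg) (fun n => ?_) hlim
      rw [le_div_iff₀ hfac]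
      exact measureReal_mul_le_williamsonCdf q hq (πn n) (hposn n) hz hz1.le
  intro y hy
  have hL : Tendsto (fun n => y ^ q * williamsonCdf q (πn n) y) atTop (𝓝 (y ^ q * Φ y)) :=
    (hΦ y hy).const_mul _
  refine tendsto_nhds_unique hL ?_
  simp only [map_williamsonCdf_real_Iic hFπ]
  simp_rw [fun n => pow_mul_williamsonCdf q hq (πn n) (hposn n) hy]
  refine tendsto_integral_of_dominated_convergence (fun t => (q : ℝ) * t ^ (q - 1)) (fun n => ?_)
    ?_ (fun n => ?_) ?_
  · have hanti : Antitone fun t => (πn n).real (Iic (y - t)) := fun t t' h =>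
      measureReal_mono (Iic_subset_Iic.2 (by linarith))
    exact (hanti.measurable.mul (by fun_prop)).aestronglyMeasurable
  · exact (Continuous.integrableOn_Ioc (by fun_prop))
  · filter_upwards [ae_restrict_mem measurableSet_Ioc] with t ht
    have ht0 : 0 ≤ (q : ℝ) * t ^ (q - 1) := mul_nonneg (by positivity) (pow_nonneg ht.1.le _)
    rw [Real.norm_of_nonneg (mul_nonneg measureReal_nonneg ht0)]
    exact mul_le_of_le_one_left ht0 measureReal_le_one
  · set D := {d | ¬ ContinuousAt (kendallCdf q π) d} with hD
    have hDc : D.Countable := (kendallCdf_mono q π).countable_not_continuousAt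
    have hB : ((fun d => y - upperInv Φ d) '' D ∪ {y, y - upperInv Φ 0}).Countable :=
      (hDc.image _).union ((countable_singleton _).insert _)
    filter_upwards [ae_restrict_mem measurableSet_Ioc, ae_restrict_of_ae (hB.ae_notMem volume)]
      with t ht htB
    refine Tendsto.mul_const _ (hpt (y - t) ?_ ?_ ?_)
    · refine sub_pos.2 (lt_of_le_of_ne ht.2 fun h => htB (Or.inr ?_))
      left; exact h
    · intro h
      refine htB (Or.inr ?_)
      right
      rw [mem_singleton_iff]
      linarith
    · intro h
      by_contra hc
      refine htB (Or.inl ⟨Φ (y - t), hc, ?_⟩)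
      simp only
      rw [hW.upperInv_apply h]
      ring

/-- A normalized sequence of Williamson transforms whose Kendall distributions converge to that of
`π` converges, along a subsequence, to a rescaling of the Williamson transform of `π`. -/
theorem exists_subseq_tendsto_of_normalized (q : ℕ) (hq : 1 ≤ q) (π : Measure ℝ)
    [IsProbabilityMeasure π] (hpos : ∀ᵐ z ∂π, 0 < z) (πn : ℕ → Measure ℝ)
    [∀ n, IsProbabilityMeasure (πn n)] (hposn : ∀ n, ∀ᵐ z ∂(πn n), 0 < z)
    (hclose : ∀ δ > 0, ∀ᶠ n in atTop, LevyClose δ (kendallCdf q (πn n)) (kendallCdf q π))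
    {v : ℝ} (hv : v ∈ Ioo (0 : ℝ) 1) (hnorm : ∀ n, williamsonCdf q (πn n) 1 = v) {a : ℝ}
    (ha : 0 < a) :
    ∃ ms : ℕ → ℕ, Tendsto (fun n => williamsonCdf q (πn (ms n)) a) atTop
      (𝓝 (williamsonCdf q π (a * upperInv (williamsonCdf q π) v))) := by
  obtain ⟨ms, Ψ, hms, hΨ⟩ := exists_subseq_tendsto_williamsonCdf q hq πn hposn
  refine ⟨ms, ?_⟩
  have hF := isWilliamsonCdf_williamsonCdf q hq π hpos
  set F := williamsonCdf q π with hFdef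
  set Φ : ℝ → ℝ := fun y => if 0 < y then Ψ y else 0 with hΦdef
  have hΦ0 : ∀ y ≤ 0, Φ y = 0 := fun y hy => by simp [hΦdef, not_lt.2 hy]
  have hΦ : ∀ y > 0, Tendsto (fun n => williamsonCdf q (πn (ms n)) y) atTop (𝓝 (Φ y)) := by
    intro y hy
    have : Φ y = Ψ y := by
      have hy' : 0 < y := hy
      simp [hΦdef, hy']
    rw [this]
    exact hΨ y hy
  have hclose' : ∀ δ > 0, ∀ᶠ n in atTop,
      LevyClose δ (kendallCdf q (πn (ms n))) (kendallCdf q π) :=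
    fun δ hδ => hms.tendsto_atTop.eventually (hclose δ hδ)
  have hW := isWilliamsonCdf_of_tendsto q hq π hpos (fun n => πn (ms n)) (fun n => hposn (ms n))
    hclose' hv (fun n => hnorm (ms n)) hΦ0 hΦ
  have hK := kendallEq_of_tendsto q hq π hpos (fun n => πn (ms n)) (fun n => hposn (ms n))
    hclose' hW hΦ
  have hprob : IsProbabilityMeasure (π.map F) :=
    Measure.isProbabilityMeasure_map hF.cont.measurable.aemeasurable
  have hκ0 := map_williamsonCdf_Iio_zero hF
  have hG₁ := (kendallEq_williamsonCdf q hq π hpos).isKendallInverse hq hκ0 hF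
  have hG₂ := hK.isKendallInverse hq hκ0 hW
  -- `π` and the limit solve the same Kendall equation; `c` is fixed by the normalization
  obtain ⟨c, hc, hcG⟩ := hG₁.exists_eq_mul hq hG₂
  have hv' : v ∈ Ico (0 : ℝ) 1 := ⟨hv.1.le, hv.2⟩
  have h1 : Φ 1 = v := tendsto_nhds_unique (hΦ 1 one_pos) (by simp [hnorm])
  have hcv : 1 = c * upperInv F v := by
    rw [← hcG v hv', ← h1, hW.upperInv_apply (h1 ▸ hv.1)]
  have hgoal : Φ a = F (a * upperInv F v) := by
    have hwI : Φ a ∈ Ico (0 : ℝ) 1 := ⟨hW.nonneg a, hW.lt_one a⟩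
    rcases hwI.1.eq_or_lt with h0 | h0
    · have h2 : a ≤ upperInv Φ 0 := (hW.le_upperInv_iff (by simp)).2 h0.ge
      rw [hcG 0 (by simp)] at h2
      have h3 : a * upperInv F v ≤ upperInv F 0 := by
        have h4 := hG₁.nonneg
        have h5 : a * upperInv F v ≤ c * upperInv F 0 * upperInv F v :=
          mul_le_mul_of_nonneg_right h2 (hF.upperInv_nonneg hv')
        nlinarith
      rw [← h0]
      exact le_antisymm (hF.nonneg _) ((hF.le_upperInv_iff (by simp)).1 h3)
    · have h2 := hW.upperInv_apply h0
      rw [hcG _ hwI] at h2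
      have h3 : a * upperInv F v = upperInv F (Φ a) := by
        calc a * upperInv F v = c * upperInv F (Φ a) * upperInv F v := by rw [h2]
          _ = c * upperInv F v * upperInv F (Φ a) := by ring
          _ = upperInv F (Φ a) := by rw [← hcv, one_mul]
      rw [h3, hF.apply_upperInv hwI]
  rw [← hgoal]
  exact hΦ a ha

/-- Stability: at a fixed level `v` the function `F (a · G v)` of the law `π` depends continuously
on the Kendall distribution. -/
theorem exists_delta_stability (q : ℕ) (hq : 1 ≤ q) (π : Measure ℝ)
    [IsProbabilityMeasure π] (hpos : ∀ᵐ z ∂π, 0 < z) {v : ℝ} (hv : v ∈ Ioo (0 : ℝ) 1) {a : ℝ}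
    (ha : 0 < a) {ε : ℝ} (hε : 0 < ε) :
    ∃ δ > 0, ∀ ρ : Measure ℝ, IsProbabilityMeasure ρ → (∀ᵐ z ∂ρ, 0 < z) →
      LevyClose δ (kendallCdf q ρ) (kendallCdf q π) →
      |williamsonCdf q ρ (a * upperInv (williamsonCdf q ρ) v)
        - williamsonCdf q π (a * upperInv (williamsonCdf q π) v)| < ε := by
  by_contra! hcon
  have hδ : ∀ n : ℕ, (0 : ℝ) < 1 / ((n : ℝ) + 1) := fun n => by positivity
  -- a sequence of counterexamples, rescaled so that the Williamson transforms equal `v` at `1`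
  choose ρ hρ hρpos hρclose hρε using fun n : ℕ => hcon (1 / ((n : ℝ) + 1)) (hδ n)
  have hW := fun n => isWilliamsonCdf_williamsonCdf q hq (ρ n) (hρpos n)
  have hc := fun n => (hW n).upperInv_pos hv
  set c := fun n => upperInv (williamsonCdf q (ρ n)) v with hcdef
  have hprob : ∀ n, IsProbabilityMeasure ((ρ n).map fun z => z / c n) := fun n =>
    Measure.isProbabilityMeasure_map (by fun_prop)
  have hposn : ∀ n, ∀ᵐ z ∂((ρ n).map fun z => z / c n), 0 < z := by
    intro n
    rw [ae_map_iff (by fun_prop) measurableSet_Ioi]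
    filter_upwards [hρpos n] with z hz using div_pos hz (hc n)
  have hclose : ∀ δ > 0, ∀ᶠ n in atTop, LevyClose δ
      (kendallCdf q ((ρ n).map fun z => z / c n)) (kendallCdf q π) := by
    intro δ hδ
    have h1 : ∀ᶠ n : ℕ in atTop, 1 / ((n : ℝ) + 1) < δ :=
      (tendsto_one_div_add_atTop_nhds_zero_nat (𝕜 := ℝ)).eventually (gt_mem_nhds hδ)
    filter_upwards [h1] with n hn t
    rw [kendallCdf_map_div q (ρ n) (hc n) _ (hW n).cont.measurable,
      kendallCdf_map_div q (ρ n) (hc n) _ (hW n).cont.measurable]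
    have h2 := hρclose n t
    have h3 := kendallCdf_mono q (ρ n) (show t + 1 / ((n : ℝ) + 1) ≤ t + δ by linarith)
    have h4 := kendallCdf_mono q π (show t + 1 / ((n : ℝ) + 1) ≤ t + δ by linarith)
    exact ⟨by linarith [h2.1], by linarith [h2.2]⟩
  obtain ⟨ms, hms⟩ := exists_subseq_tendsto_of_normalized q hq π hpos
    (fun n => (ρ n).map fun z => z / c n) hposn hclose hv (fun n => by
      rw [williamsonCdf_map_div q (ρ n) (hc n), mul_one]
      exact (hW n).apply_upperInv ⟨hv.1.le, hv.2⟩) ha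
  obtain ⟨n, hn⟩ := (Metric.tendsto_nhds.1 hms ε hε).exists
  rw [Real.dist_eq, williamsonCdf_map_div q _ (hc _), mul_comm] at hn
  exact absurd hn (not_lt.2 (hρε (ms n)))

/-! ### The lower end point of the radial law -/

theorem ae_upperInv_zero_le (q : ℕ) (hq : 1 ≤ q) (π : Measure ℝ) [IsProbabilityMeasure π]
    (hpos : ∀ᵐ z ∂π, 0 < z) : ∀ᵐ z ∂π, upperInv (williamsonCdf q π) 0 ≤ z := by
  have hF := isWilliamsonCdf_williamsonCdf q hq π hpos
  have := measure_Iio_eq_zero_of_williamsonCdf_eq_zero q hq π hpos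
    (hF.apply_upperInv (v := 0) (by simp))
  rw [measure_eq_zero_iff_ae_notMem] at this
  filter_upwards [this] with z hz using not_lt.1 hz

/-- The upper counterpart of `measureReal_mul_le_williamsonCdf` for laws on `[z₀, ∞)`. -/
theorem williamsonCdf_le_of_ae_le (q : ℕ) (hq : 1 ≤ q) (π : Measure ℝ) [IsProbabilityMeasure π]
    (hpos : ∀ᵐ z ∂π, 0 < z) {z₀ y : ℝ} (hz₀ : ∀ᵐ z ∂π, z₀ ≤ z) (hy0 : 0 < y) :
    williamsonCdf q π y ≤ (1 - z₀ / y) ^ q * π.real (Iic y) := by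
  rw [williamsonCdf_eq_max q hq π hpos]
  have h1 : (1 - z₀ / y) ^ q * π.real (Iic y)
      = ∫ x, (Iic y).indicator (fun _ => (1 - z₀ / y) ^ q) x ∂π := by
    rw [integral_indicator measurableSet_Iic, setIntegral_const, smul_eq_mul, mul_comm]
  rw [h1]
  refine integral_mono_ae (integrable_williamson_integrand q π hpos y)
    ((integrable_const _).indicator measurableSet_Iic) ?_
  filter_upwards [hpos, hz₀] with x hx hx0
  by_cases hxy : x ∈ Iic y
  · rw [indicator_of_mem hxy]
    have hxy : x ≤ y := hxy
    rw [max_eq_left hxy]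
    have h2 : x / y ≤ 1 := (div_le_one hy0).2 hxy
    have h3 : z₀ / y ≤ x / y := by gcongr
    exact pow_le_pow_left₀ (by linarith) (by linarith) q
  · rw [indicator_of_notMem hxy, max_eq_right (not_le.1 hxy).le, div_self hx.ne', sub_self,
      zero_pow (by omega)]

theorem measureReal_Iic_le_kendallCdf {q : ℕ} {π : Measure ℝ} [IsFiniteMeasure π]
    (hF : IsWilliamsonCdf (williamsonCdf q π)) (y : ℝ) :
    π.real (Iic y) ≤ kendallCdf q π (williamsonCdf q π y) :=
  measureReal_mono fun _ hz => hF.mono hz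

theorem kendallCdf_tendsto_right (q : ℕ) (π : Measure ℝ) [IsProbabilityMeasure π]
    (hF : IsWilliamsonCdf (williamsonCdf q π)) (t : ℝ) :
    ContinuousWithinAt (kendallCdf q π) (Ici t) t := by
  have hprob : IsProbabilityMeasure (π.map (williamsonCdf q π)) :=
    Measure.isProbabilityMeasure_map hF.cont.measurable.aemeasurable
  have : kendallCdf q π = cdf (π.map (williamsonCdf q π)) := by
    ext s
    rw [cdf_eq_real, map_williamsonCdf_real_Iic hF]
  rw [this]
  exact (cdf (π.map (williamsonCdf q π))).right_continuous t

/-- If the support of `π` is bounded away from `0`, the Kendall distribution function is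
superlinear at `0`. -/
theorem exists_mul_le_kendallCdf (q : ℕ) (hq : 1 ≤ q) (π : Measure ℝ) [IsProbabilityMeasure π]
    (hpos : ∀ᵐ z ∂π, 0 < z) (hz₀ : 0 < upperInv (williamsonCdf q π) 0) (L : ℝ) :
    ∃ s₀ > 0, ∀ s ∈ Icc 0 s₀, L * s ≤ kendallCdf q π s := by
  have hF := isWilliamsonCdf_williamsonCdf q hq π hpos
  set F := williamsonCdf q π with hFdef
  set z₀ := upperInv F 0 with hz₀def
  have hlim : Tendsto (fun s => |L| * (1 - z₀ / upperInv F s)) (𝓝[Ico 0 1] 0)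
      (𝓝 (|L| * (1 - z₀ / z₀))) :=
    (tendsto_const_nhds.sub (tendsto_const_nhds.div (hF.continuousOn_upperInv 0 (by simp))
      hz₀.ne')).const_mul _
  rw [div_self hz₀.ne', sub_self, mul_zero] at hlim
  have hev := hlim.eventually (gt_mem_nhds zero_lt_one)
  rw [eventually_nhdsWithin_iff, Metric.eventually_nhds_iff] at hev
  obtain ⟨η, hη, hev⟩ := hev
  refine ⟨min (η / 2) (1 / 2), by positivity, fun s hs => ?_⟩
  rcases hs.1.eq_or_lt with h0 | h0
  · rw [← h0, mul_zero]
    exact measureReal_nonneg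
  have hs1 : s ≤ η / 2 := hs.2.trans (min_le_left _ _)
  have hs2 : s ≤ 1 / 2 := hs.2.trans (min_le_right _ _)
  have hsI : s ∈ Ico (0 : ℝ) 1 := ⟨hs.1, by linarith⟩
  have h1 := hev (y := s) (by rw [Real.dist_eq, sub_zero, abs_of_pos h0]; linarith) hsI
  have hGs : z₀ ≤ upperInv F s := hF.strictMonoOn_upperInv.monotoneOn (by simp) hsI hs.1
  have hGs0 := hz₀.trans_le hGs
  have h2 := williamsonCdf_le_of_ae_le q hq π hpos (ae_upperInv_zero_le q hq π hpos) hGs0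
  have h3 := measureReal_Iic_le_kendallCdf hF (upperInv F s)
  rw [← hFdef, hF.apply_upperInv hsI] at h2 h3
  have h4 : z₀ / upperInv F s ≤ 1 := (div_le_one hGs0).2 hGs
  have h5 : 0 ≤ z₀ / upperInv F s := by positivity
  have h6 : (1 - z₀ / upperInv F s) ^ q ≤ 1 - z₀ / upperInv F s :=
    pow_le_of_le_one (by linarith) (by linarith) (by omega)
  have hK0 : 0 ≤ kendallCdf q π s := measureReal_nonneg
  have h7 : s ≤ (1 - z₀ / upperInv F s) * kendallCdf q π s :=
    h2.trans (mul_le_mul h6 h3 measureReal_nonneg (by linarith))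
  calc L * s ≤ |L| * s := mul_le_mul_of_nonneg_right (le_abs_self L) hs.1
    _ ≤ |L| * ((1 - z₀ / upperInv F s) * kendallCdf q π s) :=
      mul_le_mul_of_nonneg_left h7 (abs_nonneg L)
    _ = |L| * (1 - z₀ / upperInv F s) * kendallCdf q π s := by ring
    _ ≤ 1 * kendallCdf q π s := mul_le_mul_of_nonneg_right h1.le hK0
    _ = kendallCdf q π s := one_mul _

/-- Comparison at the lower end point of the support.  If the Kendall distribution function of `ρ`
dominates half of that of `π`, up to a dilation of the argument by `2 M`, then the Williamson
transform of `ρ` dominates a dilation of that of `π`: stretching the distance to the end point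
by `A` gains the factor `A ^ q`, which outweighs the loss. -/
theorem comparison_at_endpoint (q : ℕ) (hq : 1 ≤ q) (π : Measure ℝ) [IsProbabilityMeasure π]
    (hpos : ∀ᵐ z ∂π, 0 < z) {z₀ : ℝ} (hz₀def : upperInv (williamsonCdf q π) 0 = z₀) (hz₀ : 0 < z₀)
    {M A t₀ u₀ : ℝ} (hM : 0 < M) (hA : 0 < A) (hAM : 2 ^ (q + 3) * M ≤ (A * z₀) ^ q)
    (hu₀ : u₀ ≤ 1) (ht₀ : 2 * M * williamsonCdf q π (z₀ + u₀ / A) ≤ t₀)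
    (ρ : Measure ℝ) [IsProbabilityMeasure ρ] (hρ : ∀ᵐ z ∂ρ, 1 ≤ z) (hρ1 : 0 < ρ.real (Iic 1))
    (hK : ∀ t ∈ Icc 0 t₀, kendallCdf q π (t / (2 * M)) ≤ 2 * kendallCdf q ρ t) :
    ∀ u ∈ Ioc 0 u₀, 2 * M * williamsonCdf q π (z₀ + u / A) ≤ williamsonCdf q ρ (1 + u) := by
  have hρpos : ∀ᵐ z ∂ρ, 0 < z := hρ.mono fun z hz => one_pos.trans_le hz
  have hF := isWilliamsonCdf_williamsonCdf q hq π hpos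
  have hH := isWilliamsonCdf_williamsonCdf q hq ρ hρpos
  set F := williamsonCdf q π with hFdef
  set H := williamsonCdf q ρ with hHdef
  have hzle : ∀ᵐ z ∂π, z₀ ≤ z := hz₀def ▸ ae_upperInv_zero_le q hq π hpos
  have hFz₀ : F z₀ = 0 := hz₀def ▸ hF.apply_upperInv (v := 0) (by simp)
  have hlow : ∀ u ∈ Ioc 0 u₀, ρ.real (Iic 1) * u ^ q / 2 ^ q ≤ H (1 + u) := by
    intro u hu
    refine le_trans ?_ (measureReal_mul_le_williamsonCdf q hq ρ hρpos one_pos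
      (show (1 : ℝ) ≤ 1 + u by linarith [hu.1]))
    rw [mul_div_assoc, ← div_pow]
    have h1 : u / 2 ≤ 1 - 1 / (1 + u) := by
      have : 1 - 1 / (1 + u) = u / (1 + u) := by
        have : (1 + u) ≠ 0 := by linarith [hu.1]
        field_simp
        ring
      rw [this]
      exact div_le_div_of_nonneg_left hu.1.le (by linarith [hu.1]) (by linarith [hu.2])
    exact mul_le_mul_of_nonneg_left (pow_le_pow_left₀ (by linarith [hu.1]) h1 q) measureReal_nonneg
  have hHpos : ∀ u ∈ Ioc 0 u₀, 0 < H (1 + u) := fun u hu => by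
    refine lt_of_lt_of_le ?_ (hlow u hu)
    have := pow_pos hu.1 q
    positivity
  -- the gain in one step
  have step : ∀ u ∈ Ioc 0 u₀, (∀ s ∈ Ioo 0 u, 2 * M * F (z₀ + s / A) ≤ H (1 + s)) →
      2 * (2 * M * F (z₀ + u / A)) ≤ H (1 + u) := by
    intro u hu hs
    have h1u : (0 : ℝ) < 1 + u := by linarith [hu.1]
    have hk : ∀ s ∈ Ioo 0 u, π.real (Iic (z₀ + s / A)) ≤ 2 * ρ.real (Iic (1 + s)) := by
      intro s hsu
      have hsu₀ : s ∈ Ioc 0 u₀ := ⟨hsu.1, hsu.2.le.trans hu.2⟩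
      have e1 := measureReal_Iic_le_kendallCdf hF (z₀ + s / A)
      have e2 := hK (2 * M * F (z₀ + s / A)) ⟨mul_nonneg (by positivity) (hF.nonneg _), by
        refine le_trans (mul_le_mul_of_nonneg_left (hF.mono ?_) (by positivity)) ht₀
        have : s / A ≤ u₀ / A := by gcongr; exact hsu₀.2
        linarith⟩
      rw [mul_div_cancel_left₀ _ (by positivity)] at e2
      have e3 := kendallCdf_mono q ρ (hs s hsu)
      rw [measureReal_Iic_eq_kendallCdf hH (hHpos s hsu₀)]
      linarith
    have hanti : ∀ {κ : Measure ℝ} [IsFiniteMeasure κ] {f : ℝ → ℝ},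
        Antitone fun t => κ.real {z | f z ≤ u - t} := by
      intro κ _ f t t' h
      refine measureReal_mono fun z hz => ?_
      have hz : f z ≤ u - t' := hz
      show f z ≤ u - t
      linarith
    have hint : ∀ {κ : Measure ℝ} [IsProbabilityMeasure κ] {f : ℝ → ℝ},
        IntegrableOn (fun t => κ.real {z | f z ≤ u - t} * (q * t ^ (q - 1))) (Ioc 0 u) := by
      intro κ _ f
      refine Integrable.mono' (g := fun t => (q : ℝ) * t ^ (q - 1))
        (Continuous.integrableOn_Ioc (by fun_prop))
        (hanti.measurable.mul (by fun_prop)).aestronglyMeasurable ?_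
      filter_upwards [ae_restrict_mem measurableSet_Ioc] with t ht
      have ht0 : 0 ≤ (q : ℝ) * t ^ (q - 1) := mul_nonneg (by positivity) (pow_nonneg ht.1.le _)
      rw [Real.norm_of_nonneg (mul_nonneg measureReal_nonneg ht0)]
      exact mul_le_of_le_one_left ht0 measureReal_le_one
    have i1 := integral_max_sub_pow_eq q hq π (ζ := fun z => A * (z - z₀)) (by fun_prop)
      (hzle.mono fun z hz => mul_nonneg hA.le (by linarith)) hu.1.le
    have i2 := integral_max_sub_pow_eq q hq ρ (ζ := fun z => z - 1) (by fun_prop)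
      (hρ.mono fun z hz => by linarith) hu.1.le
    have e1 : (1 + u) ^ q * H (1 + u) = ∫ z, (max 0 (u - (z - 1))) ^ q ∂ρ := by
      rw [hHdef, williamsonCdf, mul_div_cancel₀ _ (pow_pos h1u q).ne']
      congr 1
      ext z
      congr 2
      ring
    have e2 : A ^ q * ((z₀ + u / A) ^ q * F (z₀ + u / A))
        = ∫ z, (max 0 (u - A * (z - z₀))) ^ q ∂π := by
      have hp : 0 < z₀ + u / A := by have := hu.1; positivity
      rw [hFdef, williamsonCdf, mul_div_cancel₀ _ (pow_pos hp q).ne', ← integral_const_mul]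
      congr 1
      ext z
      rw [← mul_pow, mul_max_of_nonneg _ _ hA.le]
      congr 2
      · simp
      · field_simp
        ring
    have e3 : ∫ z, (max 0 (u - A * (z - z₀))) ^ q ∂π
        ≤ 2 * ∫ z, (max 0 (u - (z - 1))) ^ q ∂ρ := by
      rw [i1, i2, ← integral_const_mul]
      refine integral_mono_ae hint (hint.const_mul 2) ?_
      have hne : ∀ᵐ t ∂(volume.restrict (Ioc 0 u)), t ≠ u :=
        ae_restrict_of_ae (by simp [ae_iff, measure_singleton])
      filter_upwards [ae_restrict_mem measurableSet_Ioc, hne] with t ht htu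
      have ht0 : 0 ≤ (q : ℝ) * t ^ (q - 1) := mul_nonneg (by positivity) (pow_nonneg ht.1.le _)
      have htu' : t < u := lt_of_le_of_ne ht.2 htu
      have s1 : {z | A * (z - z₀) ≤ u - t} = Iic (z₀ + (u - t) / A) := by
        ext z
        rw [mem_ofPred_eq, mem_Iic, ← sub_le_iff_le_add', le_div_iff₀ hA, mul_comm]
      have s2 : {z : ℝ | z - 1 ≤ u - t} = Iic (1 + (u - t)) := by
        ext z
        rw [mem_ofPred_eq, mem_Iic, ← sub_le_iff_le_add']
      simp only [s1, s2]
      have := hk (u - t) ⟨by linarith, by linarith [ht.1]⟩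
      nlinarith
    rw [← e1, ← e2] at e3
    have e4 : (A * z₀) ^ q * F (z₀ + u / A) ≤ A ^ q * ((z₀ + u / A) ^ q * F (z₀ + u / A)) := by
      rw [mul_pow, mul_assoc]
      refine mul_le_mul_of_nonneg_left (mul_le_mul_of_nonneg_right ?_ (hF.nonneg _)) (by positivity)
      refine pow_le_pow_left₀ hz₀.le ?_ q
      have := hu.1
      have : 0 ≤ u / A := by positivity
      linarith
    have e5 : 2 ^ (q + 3) * M * F (z₀ + u / A) ≤ (A * z₀) ^ q * F (z₀ + u / A) :=
      mul_le_mul_of_nonneg_right hAM (hF.nonneg _)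
    have e6 : (1 + u) ^ q * H (1 + u) ≤ 2 ^ q * H (1 + u) :=
      mul_le_mul_of_nonneg_right (pow_le_pow_left₀ h1u.le (by linarith [hu.2]) q) (hH.nonneg _)
    have e7 : (2 : ℝ) ^ q * (8 * M * F (z₀ + u / A)) ≤ 2 ^ q * (2 * H (1 + u)) := by
      rw [pow_add] at e5
      linarith
    have := le_of_mul_le_mul_left e7 (by positivity)
    linarith
  -- the comparison holds near the end point because the lowest atom of `ρ` is heavy enough
  have hK0 : kendallCdf q ρ 0 ≤ ρ.real (Iic 1) := by
    refine measureReal_mono fun z hz => ?_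
    by_contra! hc
    have hz : H z ≤ 0 := hz
    have h1z : 1 < z := not_le.1 hc
    have h2 : 1 / z < 1 := (div_lt_one (by linarith)).2 h1z
    have := measureReal_mul_le_williamsonCdf q hq ρ hρpos one_pos h1z.le
    have h3 : 0 < ρ.real (Iic 1) * (1 - 1 / z) ^ q := mul_pos hρ1 (pow_pos (by linarith) q)
    linarith
  intro u hu
  have ht00 : 0 ≤ t₀ := le_trans (mul_nonneg (by positivity) (hF.nonneg _)) ht₀
  have start : ∃ u₁ > 0, ∀ s ∈ Ioo 0 u₁, s ∈ Ioc 0 u₀ → 2 * M * F (z₀ + s / A) ≤ H (1 + s) := by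
    have h1 : kendallCdf q π 0 < 4 * ρ.real (Iic 1) := by
      have := hK 0 ⟨le_rfl, ht00⟩
      rw [zero_div] at this
      linarith
    have h2 : Tendsto (fun s => F (z₀ + s / A)) (𝓝[>] 0) (𝓝[≥] 0) := by
      refine tendsto_nhdsWithin_iff.2 ⟨?_, Eventually.of_forall fun s => hF.nonneg _⟩
      have : Tendsto (fun s => F (z₀ + s / A)) (𝓝 0) (𝓝 (F (z₀ + 0 / A))) :=
        (hF.cont.comp (by fun_prop : Continuous fun s : ℝ => z₀ + s / A)).tendsto 0
      rw [zero_div, add_zero, hFz₀] at this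
      exact this.mono_left nhdsWithin_le_nhds
    have h3 : ∀ᶠ s in 𝓝[>] 0, kendallCdf q π (F (z₀ + s / A)) < 4 * ρ.real (Iic 1) :=
      ((kendallCdf_tendsto_right q π hF 0).tendsto.comp h2).eventually (gt_mem_nhds h1)
    obtain ⟨u₁, hu₁, hs⟩ := mem_nhdsGT_iff_exists_Ioo_subset.1 h3
    refine ⟨u₁, hu₁, fun s hs1 hs2 => ?_⟩
    have h4 : kendallCdf q π (F (z₀ + s / A)) < 4 * ρ.real (Iic 1) := hs hs1
    have hsA : 0 < s / A := div_pos hs1.1 hA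
    have hy : 0 < z₀ + s / A := by linarith
    have h5 := williamsonCdf_le_of_ae_le q hq π hpos hzle hy
    have h6 := measureReal_Iic_le_kendallCdf hF (z₀ + s / A)
    have h7 : (1 - z₀ / (z₀ + s / A)) ^ q ≤ (s / (A * z₀)) ^ q := by
      have e : 1 - z₀ / (z₀ + s / A) = (s / A) / (z₀ + s / A) := by
        rw [eq_div_iff hy.ne', sub_mul, div_mul_cancel₀ _ hy.ne']
        ring
      rw [e, div_mul_eq_div_div s A z₀]
      refine pow_le_pow_left₀ (by positivity) ?_ q
      exact div_le_div_of_nonneg_left hsA.le hz₀ (by linarith)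
    have h8 : F (z₀ + s / A) ≤ (s / (A * z₀)) ^ q * (4 * ρ.real (Iic 1)) :=
      h5.trans (mul_le_mul h7 (by linarith) measureReal_nonneg
        (pow_nonneg (div_nonneg hs1.1.le (by positivity)) q))
    refine le_trans ?_ (hlow s hs2)
    have h9 : 2 * M * (s / (A * z₀)) ^ q * 4 ≤ s ^ q / 2 ^ q := by
      rw [div_pow, ← mul_div_assoc, div_mul_eq_mul_div, div_le_div_iff₀ (by positivity)
        (by positivity)]
      have : 0 < s ^ q := pow_pos hs1.1 q
      calc 2 * M * s ^ q * 4 * 2 ^ q = s ^ q * (2 ^ (q + 3) * M) := by rw [pow_add]; ring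
        _ ≤ s ^ q * (A * z₀) ^ q := mul_le_mul_of_nonneg_left hAM this.le
    calc 2 * M * F (z₀ + s / A) ≤ 2 * M * ((s / (A * z₀)) ^ q * (4 * ρ.real (Iic 1))) :=
          mul_le_mul_of_nonneg_left h8 (by positivity)
      _ = 2 * M * (s / (A * z₀)) ^ q * 4 * ρ.real (Iic 1) := by ring
      _ ≤ s ^ q / 2 ^ q * ρ.real (Iic 1) := mul_le_mul_of_nonneg_right h9 measureReal_nonneg
      _ = ρ.real (Iic 1) * s ^ q / 2 ^ q := by ring
  -- at a first failure the gain would contradict continuity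
  obtain ⟨u₁, hu₁, hstart⟩ := start
  by_contra! hbad
  set B := {s | s ∈ Ioc 0 u₀ ∧ H (1 + s) < 2 * M * F (z₀ + s / A)} with hB
  have hBne : B.Nonempty := ⟨u, hu, hbad⟩
  have hBb : BddBelow B := ⟨0, fun s hs => hs.1.1.le⟩
  set b := sInf B with hb
  have hb1 : u₁ ≤ b := by
    refine le_csInf hBne fun s hs => ?_
    by_contra! hc
    exact absurd (hstart s ⟨hs.1.1, hc⟩ hs.1) (not_le.2 hs.2)
  have hbu : b ≤ u := csInf_le hBb ⟨hu, hbad⟩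
  have hbI : b ∈ Ioc 0 u₀ := ⟨lt_of_lt_of_le hu₁ hb1, hbu.trans hu.2⟩
  have hstep := step b hbI fun s hs => by
    by_contra! hc
    exact absurd (csInf_le hBb ⟨⟨hs.1, hs.2.le.trans hbI.2⟩, hc⟩) (not_le.2 hs.2)
  have hFb : 0 < F (z₀ + b / A) := by
    by_contra! hc
    have h1 := (hF.le_upperInv_iff (by simp)).2 hc
    rw [hz₀def] at h1
    have : 0 < b / A := div_pos hbI.1 hA
    linarith
  have hcont : Continuous fun s => H (1 + s) - 2 * M * F (z₀ + s / A) :=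
    (hH.cont.comp (by fun_prop)).sub ((hF.cont.comp (by fun_prop)).const_mul _)
  have hpos' : 0 < H (1 + b) - 2 * M * F (z₀ + b / A) := by
    have : 0 < 2 * M * F (z₀ + b / A) := by positivity
    linarith
  have hev : ∀ᶠ s in 𝓝 b, 0 < H (1 + s) - 2 * M * F (z₀ + s / A) :=
    hcont.continuousAt.eventually (lt_mem_nhds hpos')
  have hcl : b ∈ closure B := csInf_mem_closure hBne hBb
  obtain ⟨s, hs1, hs2⟩ := mem_closure_iff_frequently.1 hcl |>.and_eventually hev |>.exists
  linarith [hs1.2]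

/-- Lower semicontinuity at the left end point `v = 0`, where Lévy convergence alone does not
suffice: the additional lower bound on the Kendall distribution of `ρ` near `0` forces the inverse
of its Williamson transform at a small level `v` to be close to its lower end point `1`, and
stability applies at that level `v`. -/
theorem exists_delta_endpoint (q : ℕ) (hq : 1 ≤ q) (π : Measure ℝ) [IsProbabilityMeasure π]
    (hpos : ∀ᵐ z ∂π, 0 < z) (hz₀ : 0 < upperInv (williamsonCdf q π) 0)
    {M t₀ a ε : ℝ} (hM : 0 < M) (ht₀ : 0 < t₀) (ha : 0 < a) (hε : 0 < ε) :
    ∃ δ > 0, ∀ ρ : Measure ℝ, IsProbabilityMeasure ρ → (∀ᵐ z ∂ρ, 1 ≤ z) → 0 < ρ.real (Iic 1) →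
      (∀ t ∈ Icc 0 t₀, kendallCdf q π (t / (2 * M)) ≤ 2 * kendallCdf q ρ t) →
      LevyClose δ (kendallCdf q ρ) (kendallCdf q π) →
      williamsonCdf q π (a * upperInv (williamsonCdf q π) 0) - ε < williamsonCdf q ρ a := by
  have hF := isWilliamsonCdf_williamsonCdf q hq π hpos
  set F := williamsonCdf q π with hFdef
  set z₀ := upperInv F 0 with hz₀def
  have hFz₀ : F z₀ = 0 := hF.apply_upperInv (v := 0) (by simp)
  obtain ⟨A, hA, hAM⟩ : ∃ A > 0, 2 ^ (q + 3) * M ≤ (A * z₀) ^ q := by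
    refine ⟨(1 + 2 ^ (q + 3) * M) / z₀, by positivity, ?_⟩
    rw [div_mul_cancel₀ _ hz₀.ne']
    have h1 : (1 : ℝ) ≤ 1 + 2 ^ (q + 3) * M := by
      have : 0 < 2 ^ (q + 3) * M := by positivity
      linarith
    exact le_trans (by linarith) (le_self_pow₀ h1 (by omega))
  -- `u` is small enough for the comparison and for `F (a z₀ / (1 + u))` to be close to `F (a z₀)`
  have hc1 : Continuous fun u => 2 * M * F (z₀ + u / A) :=
    (hF.cont.comp (by fun_prop)).const_mul _
  have hc2 : ContinuousAt (fun u => F (a / (1 + u) * z₀)) 0 := by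
    refine hF.cont.continuousAt.comp ?_
    refine ContinuousAt.mul_const (continuousAt_const.div (by fun_prop) (by norm_num)) z₀
  have e1 : ∀ᶠ u in 𝓝[>] (0 : ℝ), 2 * M * F (z₀ + u / A) < min t₀ 1 := by
    have := hc1.tendsto 0
    simp only [zero_div, add_zero, hFz₀, mul_zero] at this
    exact (this.mono_left nhdsWithin_le_nhds).eventually (gt_mem_nhds (lt_min ht₀ one_pos))
  have e2 : ∀ᶠ u in 𝓝[>] (0 : ℝ), F (a * z₀) - ε / 2 < F (a / (1 + u) * z₀) := by
    have := hc2.tendsto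
    simp only [add_zero, div_one] at this
    exact (this.mono_left nhdsWithin_le_nhds).eventually (lt_mem_nhds (by linarith))
  have e3 : ∀ᶠ u in 𝓝[>] (0 : ℝ), u < 1 := mem_nhdsWithin_of_mem_nhds (gt_mem_nhds one_pos)
  obtain ⟨u, ⟨⟨hu1, hu2⟩, hu3⟩, hu0⟩ := (((e1.and e2).and e3).and self_mem_nhdsWithin).exists
  have hu0 : 0 < u := hu0
  set v := 2 * M * F (z₀ + u / A) with hvdef
  have hFu : 0 < F (z₀ + u / A) := by
    by_contra! hc
    have h1 := (hF.le_upperInv_iff (by simp)).2 hc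
    have : 0 < u / A := div_pos hu0 hA
    linarith
  have hv : v ∈ Ioo (0 : ℝ) 1 := ⟨by positivity, hu1.trans_le (min_le_right _ _)⟩
  obtain ⟨δ, hδ, hstab⟩ := exists_delta_stability q hq π hpos hv (a := a / (1 + u))
    (by positivity) (half_pos hε)
  refine ⟨δ, hδ, fun ρ hρ hρ1 hρ2 hK hclose => ?_⟩
  have hρpos : ∀ᵐ z ∂ρ, 0 < z := hρ1.mono fun z hz => one_pos.trans_le hz
  have hH := isWilliamsonCdf_williamsonCdf q hq ρ hρpos
  have h1 := comparison_at_endpoint q hq π hpos rfl hz₀ hM hA hAM hu3.le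
    (hu1.le.trans (min_le_left _ _)) ρ hρ1 hρ2 hK u ⟨hu0, le_rfl⟩
  have h2 : upperInv (williamsonCdf q ρ) v ≤ 1 + u := (hH.upperInv_le_iff hv).2 h1
  have h3 := hstab ρ hρ hρpos hclose
  rw [abs_lt] at h3
  have h4 : williamsonCdf q ρ (a / (1 + u) * upperInv (williamsonCdf q ρ) v)
      ≤ williamsonCdf q ρ a := by
    refine hH.mono ?_
    rw [div_mul_eq_mul_div, div_le_iff₀ (by linarith)]
    exact mul_le_mul_of_nonneg_left h2 ha.le
  have h5 : F (a / (1 + u) * z₀) ≤ F (a / (1 + u) * upperInv F v) := by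
    refine hF.mono (mul_le_mul_of_nonneg_left ?_ (by positivity))
    exact hF.strictMonoOn_upperInv.monotoneOn (by simp) ⟨hv.1.le, hv.2⟩ hv.1.le
  linarith [h3.1]

/-! ### The estimated radial law -/

theorem gnzCount_lt_gnzCount {n d : ℕ} (hd : 1 ≤ d) (x : Fin n → Fin d → ℝ) {k i : Fin n}
    (h : ∀ l, x k l < x i l) : gnzCount x k < gnzCount x i := by
  unfold gnzCount
  rw [Nat.card_eq_fintype_card, Nat.card_eq_fintype_card, Fintype.card_subtype,
    Fintype.card_subtype]
  refine Finset.card_lt_card ⟨fun j hj => ?_, fun hsub => ?_⟩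
  · simp only [Finset.mem_filter_univ] at hj ⊢
    exact fun l => (hj l).trans (h l)
  · have := hsub (Finset.mem_filter_univ k |>.2 h)
    simp only [Finset.mem_filter_univ] at this
    exact lt_irrefl _ (this ⟨0, hd⟩)

theorem gnzCount_eq_card {n d : ℕ} (x : Fin n → Fin d → ℝ) (i : Fin n) :
    gnzCount x i = (Finset.univ.filter fun k => ∀ l, x k l < x i l).card := by
  unfold gnzCount
  rw [Nat.card_eq_fintype_card, Fintype.card_subtype]

/-- There are at least `c` sample points with a count below `c`, if `c` is the count of a sample
point. -/
theorem gnzCount_le_card {n d : ℕ} (hd : 1 ≤ d) (x : Fin n → Fin d → ℝ) (i : Fin n) :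
    gnzCount x i ≤ (Finset.univ.filter fun k => gnzCount x k < gnzCount x i).card := by
  conv_lhs => rw [gnzCount_eq_card]
  refine Finset.card_le_card fun k hk => ?_
  simp only [Finset.mem_filter_univ] at hk ⊢
  exact gnzCount_lt_gnzCount hd x hk

theorem exists_gnzCount_eq_zero {n d : ℕ} (hn : 0 < n) (hd : 1 ≤ d) (x : Fin n → Fin d → ℝ) :
    ∃ i, gnzCount x i = 0 := by
  have : Nonempty (Fin n) := ⟨⟨0, hn⟩⟩
  obtain ⟨i, hi⟩ := Finite.exists_min (gnzCount x)
  refine ⟨i, ?_⟩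
  by_contra h
  have h1 := gnzCount_le_card hd x i
  have h2 : (Finset.univ.filter fun k => gnzCount x k < gnzCount x i).card = 0 := by
    rw [Finset.card_eq_zero, Finset.filter_eq_empty_iff]
    intro k _
    exact not_lt.2 (hi k)
  omega

/-- The part of the estimator that is due to the sample points with count below `c`. -/
noncomputable def gnzPartial {n d : ℕ} (x : Fin n → Fin d → ℝ) (c : ℕ) (y : ℝ) : ℝ :=
  (∑ i : Fin n, if gnzCount x i < c then (max 0 (1 - y / gnzRadius x (gnzCount x i))) ^ (d - 1)
    else 0) / n

theorem sum_gnzMass_mul {n d : ℕ} (x : Fin n → Fin d → ℝ) (c : ℕ) (f : ℕ → ℝ) :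
    ∑ k : Fin c, gnzMass x k * f k
      = (∑ i : Fin n, if gnzCount x i < c then f (gnzCount x i) else 0) / n := by
  have h1 : ∀ k : ℕ, gnzMass x k * f k
      = (∑ i : Fin n, if gnzCount x i = k then f k else 0) / n := by
    intro k
    unfold gnzMass
    rw [Nat.card_eq_fintype_card, Fintype.card_subtype, ← Finset.sum_filter, Finset.sum_const,
      nsmul_eq_mul]
    ring
  simp_rw [h1]
  rw [Fin.sum_univ_eq_sum_range (fun k => (∑ i : Fin n, if gnzCount x i = k then f k else 0) / n) c,
    ← Finset.sum_div, Finset.sum_comm]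
  congr 1
  refine Finset.sum_congr rfl fun i _ => ?_
  rw [Finset.sum_ite_eq]
  simp

theorem gnzRadius_zero {n d : ℕ} (x : Fin n → Fin d → ℝ) : gnzRadius x 0 = 1 := by
  rw [gnzRadius]

theorem gnzRadius_succ {n d : ℕ} (x : Fin n → Fin d → ℝ) (c : ℕ) :
    gnzRadius x (c + 1) = sInf {r : ℝ | 0 < r ∧
      gnzPartial x (c + 1) r = ((c : ℝ) + 1) / ((n : ℝ) + 1)} := by
  rw [gnzRadius]
  congr 1
  ext r
  rw [mem_ofPred_eq, mem_ofPred_eq, gnzPartial,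
    sum_gnzMass_mul x (c + 1) (fun k => (max 0 (1 - r / gnzRadius x k)) ^ (d - 1))]

/-- The recursion is solvable at the counts which occur: the partial sum over the smaller counts
exceeds `c / (n + 1)` at `0` by `gnzCount_le_card`, and reaches `0` continuously.  At the radius of
a smaller count `c'` it has the smaller value `c' / (n + 1)`, so that the radii decrease as the
counts increase. -/
theorem gnzRadius_spec {n d : ℕ} (hd : 2 ≤ d) (x : Fin n → Fin d → ℝ) (c : ℕ) :
    (∃ i, gnzCount x i = c) → 0 < gnzRadius x c ∧
      (∀ i, gnzCount x i < c → gnzRadius x c < gnzRadius x (gnzCount x i)) ∧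
      (0 < c → gnzPartial x c (gnzRadius x c) = (c : ℝ) / ((n : ℝ) + 1)) := by
  have hq : d - 1 ≠ 0 := by omega
  induction c using Nat.strong_induction_on with
  | _ c ih =>
    rintro ⟨i, hi⟩
    rcases c with - | c
    · exact ⟨by rw [gnzRadius_zero]; exact one_pos, by simp, by simp⟩
    have hn : 0 < (n : ℝ) := by
      have := i.pos
      exact_mod_cast this
    have hpos : ∀ j, gnzCount x j < c + 1 → 0 < gnzRadius x (gnzCount x j) :=
      fun j hj => (ih _ hj ⟨j, rfl⟩).1
    have hcont : Continuous (gnzPartial x (c + 1)) := by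
      unfold gnzPartial
      refine Continuous.div_const (continuous_finsetSum _ fun j _ => ?_) _
      split_ifs
      · fun_prop
      · exact continuous_const
    have h0 : ((c : ℝ) + 1) / ((n : ℝ) + 1) < gnzPartial x (c + 1) 0 := by
      have h1 := gnzCount_le_card (by omega) x i
      rw [hi] at h1
      have h2 : gnzPartial x (c + 1) 0
          = ((Finset.univ.filter fun k => gnzCount x k < c + 1).card : ℝ) / n := by
        unfold gnzPartial
        simp
      rw [h2, div_lt_div_iff₀ (by linarith) hn]
      have h3 : ((c : ℝ) + 1) ≤ ((Finset.univ.filter fun k => gnzCount x k < c + 1).card : ℝ) := by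
        exact_mod_cast h1
      have : (0 : ℝ) ≤ c := by positivity
      nlinarith
    set B := ∑ j, |gnzRadius x (gnzCount x j)| with hB
    have hBj : ∀ j, |gnzRadius x (gnzCount x j)| ≤ B := fun j =>
      Finset.single_le_sum (f := fun j => |gnzRadius x (gnzCount x j)|)
        (fun _ _ => abs_nonneg _) (Finset.mem_univ j)
    have hB0 : 0 ≤ B := Finset.sum_nonneg fun _ _ => abs_nonneg _
    have h1 : gnzPartial x (c + 1) B = 0 := by
      unfold gnzPartial
      rw [Finset.sum_eq_zero, zero_div]
      intro j _
      split_ifs with hj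
      · rw [max_eq_left, zero_pow hq]
        rw [sub_nonpos, one_le_div (hpos j hj)]
        exact (le_abs_self _).trans (hBj j)
      · rfl
    have hset : {r : ℝ | 0 < r ∧ gnzPartial x (c + 1) r = ((c : ℝ) + 1) / ((n : ℝ) + 1)}
        = Ici 0 ∩ gnzPartial x (c + 1) ⁻¹' {((c : ℝ) + 1) / ((n : ℝ) + 1)} := by
      ext r
      refine ⟨fun h => ⟨h.1.le, h.2⟩, fun h => ⟨lt_of_le_of_ne h.1 ?_, h.2⟩⟩
      rintro rfl
      have h2 : gnzPartial x (c + 1) 0 = ((c : ℝ) + 1) / ((n : ℝ) + 1) := h.2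
      linarith
    have hne : {r : ℝ | 0 < r ∧
        gnzPartial x (c + 1) r = ((c : ℝ) + 1) / ((n : ℝ) + 1)}.Nonempty := by
      obtain ⟨r, hr, hr2⟩ := intermediate_value_Icc' hB0 hcont.continuousOn
        (show ((c : ℝ) + 1) / ((n : ℝ) + 1) ∈ Icc _ _ from ⟨by rw [h1]; positivity, h0.le⟩)
      rw [hset]
      exact ⟨r, hr.1, hr2⟩
    have hmem : gnzRadius x (c + 1) ∈ {r : ℝ | 0 < r ∧
        gnzPartial x (c + 1) r = ((c : ℝ) + 1) / ((n : ℝ) + 1)} := by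
      rw [gnzRadius_succ]
      refine IsClosed.csInf_mem ?_ hne ⟨0, fun r hr => hr.1.le⟩
      rw [hset]
      exact isClosed_Ici.inter (isClosed_singleton.preimage hcont)
    refine ⟨hmem.1, fun j hj => ?_, fun _ => by rw [hmem.2]; push_cast; rfl⟩
    -- at `r` of a smaller count the partial sum is too small
    by_contra! hcon
    have h2 : gnzPartial x (c + 1) (gnzRadius x (c + 1))
        ≤ gnzPartial x (c + 1) (gnzRadius x (gnzCount x j)) := by
      unfold gnzPartial
      refine div_le_div_of_nonneg_right (Finset.sum_le_sum fun k _ => ?_) hn.le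
      split_ifs with hk
      · have := hpos k hk
        gcongr
      · exact le_rfl
    have h3 : gnzPartial x (c + 1) (gnzRadius x (gnzCount x j))
        = gnzPartial x (gnzCount x j) (gnzRadius x (gnzCount x j)) := by
      unfold gnzPartial
      congr 1
      refine Finset.sum_congr rfl fun k _ => ?_
      by_cases hk : gnzCount x k < gnzCount x j
      · rw [if_pos hk, if_pos (hk.trans hj)]
      · rw [if_neg hk]
        split_ifs with hk2
        · rw [max_eq_left, zero_pow hq]
          rw [sub_nonpos, one_le_div (hpos k hk2)]
          rcases (not_lt.1 hk).eq_or_lt with h | h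
          · rw [h]
          · exact ((ih _ hk2 ⟨k, rfl⟩).2.1 j h).le
        · rfl
    have h4 : gnzPartial x (gnzCount x j) (gnzRadius x (gnzCount x j))
        = (gnzCount x j : ℝ) / ((n : ℝ) + 1) := by
      rcases Nat.eq_zero_or_pos (gnzCount x j) with h | h
      · rw [h]
        simp [gnzPartial]
      · exact (ih _ hj ⟨j, rfl⟩).2.2 h
    rw [hmem.2, h3, h4, div_le_div_iff_of_pos_right (by positivity)] at h2
    have : (gnzCount x j : ℝ) < (c : ℝ) + 1 := by exact_mod_cast hj
    linarith

theorem gnzRadius_pos {n d : ℕ} (hd : 2 ≤ d) (x : Fin n → Fin d → ℝ) (i : Fin n) :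
    0 < gnzRadius x (gnzCount x i) := (gnzRadius_spec hd x _ ⟨i, rfl⟩).1

theorem gnzRadius_le_of_le {n d : ℕ} (hd : 2 ≤ d) (x : Fin n → Fin d → ℝ) {i j : Fin n}
    (h : gnzCount x j ≤ gnzCount x i) :
    gnzRadius x (gnzCount x i) ≤ gnzRadius x (gnzCount x j) := by
  rcases h.eq_or_lt with h | h
  · rw [h]
  · exact ((gnzRadius_spec hd x _ ⟨i, rfl⟩).2.1 j h).le

theorem gnzRadius_le_one {n d : ℕ} (hd : 2 ≤ d) (x : Fin n → Fin d → ℝ) (i : Fin n) :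
    gnzRadius x (gnzCount x i) ≤ 1 := by
  obtain ⟨j, hj⟩ := exists_gnzCount_eq_zero i.pos (by omega) x
  have := gnzRadius_le_of_le hd x (i := i) (j := j) (by omega)
  rwa [hj, gnzRadius_zero] at this

/-- The summands with a count that is not smaller vanish at the radius, so that the partial sum in
the recursion is the full estimator there. -/
theorem gnzPsi_gnzRadius {n d : ℕ} (hd : 2 ≤ d) (x : Fin n → Fin d → ℝ) (i : Fin n) :
    gnzPsi x (gnzRadius x (gnzCount x i)) = (gnzCount x i : ℝ) / ((n : ℝ) + 1) := by
  have h1 : gnzPsi x (gnzRadius x (gnzCount x i))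
      = gnzPartial x (gnzCount x i) (gnzRadius x (gnzCount x i)) := by
    unfold gnzPsi gnzPartial
    congr 1
    refine Finset.sum_congr rfl fun j _ => ?_
    split_ifs with h
    · rfl
    · rw [max_eq_left, zero_pow (by omega)]
      rw [sub_nonpos, one_le_div (gnzRadius_pos hd x j)]
      exact gnzRadius_le_of_le hd x (not_lt.1 h)
  rw [h1]
  rcases Nat.eq_zero_or_pos (gnzCount x i) with h | h
  · rw [h]
    simp [gnzPartial]
  · exact (gnzRadius_spec hd x _ ⟨i, rfl⟩).2.2 h

/-- The law of `1 / R` for the estimated radial variable `R`. -/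
noncomputable def gnzLaw {n d : ℕ} (x : Fin n → Fin d → ℝ) : Measure ℝ :=
  (n : ℝ≥0∞)⁻¹ • ∑ i : Fin n, Measure.dirac (gnzRadius x (gnzCount x i))⁻¹

theorem isProbabilityMeasure_gnzLaw {n d : ℕ} (hn : 0 < n) (x : Fin n → Fin d → ℝ) :
    IsProbabilityMeasure (gnzLaw x) := by
  refine ⟨?_⟩
  rw [gnzLaw, Measure.smul_apply, Measure.finsetSum_apply]
  simp only [measure_univ, Finset.sum_const, Finset.card_univ, Fintype.card_fin, smul_eq_mul,
    nsmul_eq_mul, mul_one]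
  exact ENNReal.inv_mul_cancel (by exact_mod_cast hn.ne') (ENNReal.natCast_ne_top n)

theorem ae_gnzLaw {n d : ℕ} (x : Fin n → Fin d → ℝ) {p : ℝ → Prop}
    (h : ∀ i, p (gnzRadius x (gnzCount x i))⁻¹) : ∀ᵐ z ∂(gnzLaw x), p z := by
  refine Measure.ae_smul_measure ?_ _
  rw [ae_finsetSum_measure_iff]
  intro i _
  rw [ae_dirac_eq]
  exact h i

theorem integral_gnzLaw {n d : ℕ} (x : Fin n → Fin d → ℝ) (f : ℝ → ℝ) :
    ∫ z, f z ∂(gnzLaw x) = (∑ i : Fin n, f (gnzRadius x (gnzCount x i))⁻¹) / n := by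
  unfold gnzLaw
  rw [integral_smul_measure, integral_finsetSum_measure fun i _ => integrable_dirac (by simp)]
  simp only [integral_dirac, smul_eq_mul]
  rw [ENNReal.toReal_inv, ENNReal.toReal_natCast]
  ring

theorem gnzLaw_real {n d : ℕ} (x : Fin n → Fin d → ℝ) {s : Set ℝ} (hs : MeasurableSet s) :
    (gnzLaw x).real s = (∑ i : Fin n, s.indicator (fun _ => (1 : ℝ))
      (gnzRadius x (gnzCount x i))⁻¹) / n := by
  rw [← integral_gnzLaw, integral_indicator_const _ hs, smul_eq_mul, mul_one]

theorem ae_one_le_gnzLaw {n d : ℕ} (hd : 2 ≤ d) (x : Fin n → Fin d → ℝ) :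
    ∀ᵐ z ∂(gnzLaw x), 1 ≤ z :=
  ae_gnzLaw x fun i => (one_le_inv₀ (gnzRadius_pos hd x i)).2 (gnzRadius_le_one hd x i)

theorem gnzLaw_real_Iic_one_pos {n d : ℕ} (hn : 0 < n) (hd : 2 ≤ d) (x : Fin n → Fin d → ℝ) :
    0 < (gnzLaw x).real (Iic 1) := by
  rw [gnzLaw_real x measurableSet_Iic]
  refine div_pos ?_ (by exact_mod_cast hn)
  obtain ⟨i, hi⟩ := exists_gnzCount_eq_zero hn (by omega) x
  refine lt_of_lt_of_le zero_lt_one ?_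
  have h1 : (Iic (1 : ℝ)).indicator (fun _ => (1 : ℝ)) (gnzRadius x (gnzCount x i))⁻¹ = 1 := by
    rw [hi, gnzRadius_zero]
    simp
  exact h1.ge.trans <| Finset.single_le_sum (f := fun i =>
    (Iic (1 : ℝ)).indicator (fun _ => (1 : ℝ)) (gnzRadius x (gnzCount x i))⁻¹)
    (fun j _ => indicator_nonneg (fun _ _ => zero_le_one) _) (Finset.mem_univ i)

/-- The estimator is the Williamson transform of the estimated radial law. -/
theorem gnzPsi_eq_williamsonCdf {n d : ℕ} (x : Fin n → Fin d → ℝ) {y : ℝ} (hy : 0 < y) :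
    gnzPsi x y = williamsonCdf (d - 1) (gnzLaw x) y⁻¹ := by
  rw [williamsonCdf_eq _ _ (inv_pos.2 hy), integral_gnzLaw, gnzPsi]
  congr 1
  refine Finset.sum_congr rfl fun i _ => ?_
  congr 3
  field_simp

theorem gnzPsi_zero {n d : ℕ} (hn : 0 < n) (x : Fin n → Fin d → ℝ) : gnzPsi x 0 = 1 := by
  have : (n : ℝ) ≠ 0 := by exact_mod_cast hn.ne'
  simp [gnzPsi, this]

/-- The Kendall distribution of the estimated radial law is the empirical distribution of the
pseudo-observations. -/
theorem kendallCdf_gnzLaw {n d : ℕ} (hn : 0 < n) (hd : 2 ≤ d) (x : Fin n → Fin d → ℝ) (t : ℝ) :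
    kendallCdf (d - 1) (gnzLaw x) t
      = ((Finset.univ.filter fun i => (gnzCount x i : ℝ) / ((n : ℝ) + 1) ≤ t).card : ℝ) / n := by
  have := isProbabilityMeasure_gnzLaw hn x
  have hF := isWilliamsonCdf_williamsonCdf (d - 1) (by omega) (gnzLaw x)
    ((ae_one_le_gnzLaw hd x).mono fun z hz => one_pos.trans_le hz)
  unfold kendallCdf
  rw [gnzLaw_real x (measurableSet_le hF.cont.measurable measurable_const), Finset.card_filter,
    Nat.cast_sum]
  congr 1
  refine Finset.sum_congr rfl fun i _ => ?_
  have h1 := gnzPsi_eq_williamsonCdf x (gnzRadius_pos hd x i)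
  rw [gnzPsi_gnzRadius hd x i] at h1
  simp only [indicator_apply, mem_ofPred_eq, ← h1]
  split_ifs <;> simp

/-! ### The quantile function of the estimated diagonal section -/

theorem gnzPhi_eq {n d : ℕ} (hn : 0 < n) (hd : 2 ≤ d) (x : Fin n → Fin d → ℝ) {v : ℝ}
    (hv : v ∈ Ico (0 : ℝ) 1) :
    0 < upperInv (williamsonCdf (d - 1) (gnzLaw x)) v ∧
      gnzPhi x v = (upperInv (williamsonCdf (d - 1) (gnzLaw x)) v)⁻¹ := by
  have := isProbabilityMeasure_gnzLaw hn x
  have hpos : ∀ᵐ z ∂(gnzLaw x), 0 < z :=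
    (ae_one_le_gnzLaw hd x).mono fun z hz => one_pos.trans_le hz
  have hF := isWilliamsonCdf_williamsonCdf (d - 1) (by omega) (gnzLaw x) hpos
  have h1 : williamsonCdf (d - 1) (gnzLaw x) 1 ≤ 0 := by
    have := williamsonCdf_le_of_ae_le (d - 1) (by omega) (gnzLaw x) hpos (ae_one_le_gnzLaw hd x)
      one_pos
    rwa [div_one, sub_self, zero_pow (by omega), zero_mul] at this
  have hG : 0 < upperInv (williamsonCdf (d - 1) (gnzLaw x)) v :=
    one_pos.trans_le ((hF.le_upperInv_iff hv).2 (h1.trans hv.1))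
  refine ⟨hG, ?_⟩
  have hset : {y : ℝ | 0 ≤ y ∧ gnzPsi x y ≤ v}
      = Ici (upperInv (williamsonCdf (d - 1) (gnzLaw x)) v)⁻¹ := by
    ext y
    rw [mem_ofPred_eq, mem_Ici]
    constructor
    · rintro ⟨h2, h3⟩
      rcases h2.eq_or_lt with h0 | h0
      · rw [← h0, gnzPsi_zero hn] at h3
        linarith [hv.2]
      · rw [gnzPsi_eq_williamsonCdf x h0, ← hF.le_upperInv_iff hv] at h3
        exact inv_le_of_inv_le₀ h0 h3
    · intro h2
      have h0 : 0 < y := (inv_pos.2 hG).trans_le h2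
      refine ⟨h0.le, ?_⟩
      rw [gnzPsi_eq_williamsonCdf x h0, ← hF.le_upperInv_iff hv]
      exact inv_le_of_inv_le₀ hG h2
  rw [gnzPhi, hset, csInf_Ici]

theorem gnzPhi_one {n d : ℕ} (hn : 0 < n) (x : Fin n → Fin d → ℝ) : gnzPhi x 1 = 0 := by
  have h0 : (0 : ℝ) ∈ {y : ℝ | 0 ≤ y ∧ gnzPsi x y ≤ 1} := ⟨le_rfl, (gnzPsi_zero hn x).le⟩
  exact le_antisymm (csInf_le ⟨0, fun y hy => hy.1⟩ h0) (le_csInf ⟨0, h0⟩ fun y hy => hy.1)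

theorem gnzPsi_div {n d : ℕ} (hn : 0 < n) (hd : 2 ≤ d) {m : ℕ} (hm : 0 < m)
    (x : Fin n → Fin d → ℝ) {v : ℝ} (hv : v ∈ Ico (0 : ℝ) 1) :
    gnzPsi x (gnzPhi x v / m) = williamsonCdf (d - 1) (gnzLaw x)
      (m * upperInv (williamsonCdf (d - 1) (gnzLaw x)) v) := by
  obtain ⟨h1, h2⟩ := gnzPhi_eq hn hd x hv
  have hm' : (0 : ℝ) < m := by exact_mod_cast hm
  rw [h2, gnzPsi_eq_williamsonCdf x (by positivity)]
  congr 1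
  field_simp

/-- The estimated diagonal section is inverted exactly, because the estimator is strictly decreasing
where it is positive.  Without observations the estimator vanishes and so do both sides. -/
theorem gnzDiagonalQuantile_eq {n d : ℕ} (hd : 2 ≤ d) {m : ℕ} (hm : 0 < m)
    (x : Fin n → Fin d → ℝ) {v : ℝ} (hv : v ∈ Ioc (0 : ℝ) 1) :
    gnzDiagonalQuantile m x v = gnzPsi x (gnzPhi x v / m) := by
  rcases Nat.eq_zero_or_pos n with hn | hn
  · subst hn
    have h1 : ∀ y, gnzPsi x y = 0 := fun y => by simp [gnzPsi]
    have h2 : {u : ℝ | u ∈ Icc (0 : ℝ) 1 ∧ v ≤ gnzDiagonal m x u} = ∅ := by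
      ext u
      simp only [gnzDiagonal, h1, mem_ofPred_eq, mem_empty_iff_false, iff_false, not_and, not_le]
      exact fun _ => hv.1
    rw [h1, gnzDiagonalQuantile, quantile, h2, Real.sInf_empty]
  have := isProbabilityMeasure_gnzLaw hn x
  have hpos : ∀ᵐ z ∂(gnzLaw x), 0 < z :=
    (ae_one_le_gnzLaw hd x).mono fun z hz => one_pos.trans_le hz
  have hF := isWilliamsonCdf_williamsonCdf (d - 1) (by omega) (gnzLaw x) hpos
  have hm' : (0 : ℝ) < m := by exact_mod_cast hm
  have hdiag : ∀ u ∈ Ico (0 : ℝ) 1, gnzDiagonal m x u = williamsonCdf (d - 1) (gnzLaw x)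
      (upperInv (williamsonCdf (d - 1) (gnzLaw x)) u / m) := by
    intro u hu
    obtain ⟨h1, h2⟩ := gnzPhi_eq hn hd x hu
    rw [gnzDiagonal, h2, gnzPsi_eq_williamsonCdf x (by positivity)]
    congr 1
    field_simp
  have hdiag1 : gnzDiagonal m x 1 = 1 := by
    rw [gnzDiagonal, gnzPhi_one hn, mul_zero, gnzPsi_zero hn]
  rw [gnzDiagonalQuantile, quantile]
  rcases hv.2.eq_or_lt with h1 | h1
  · subst h1
    rw [gnzPhi_one hn, zero_div, gnzPsi_zero hn]
    have : {u : ℝ | u ∈ Icc (0 : ℝ) 1 ∧ 1 ≤ gnzDiagonal m x u} = {1} := by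
      ext u
      rw [mem_ofPred_eq, mem_singleton_iff]
      constructor
      · rintro ⟨hu, hu2⟩
        by_contra hne
        rw [hdiag u ⟨hu.1, lt_of_le_of_ne hu.2 hne⟩] at hu2
        exact absurd hu2 (not_le.2 (hF.lt_one _))
      · rintro rfl
        exact ⟨by simp, hdiag1.ge⟩
    rw [this, csInf_singleton]
  · have hvo : v ∈ Ioo (0 : ℝ) 1 := ⟨hv.1, h1⟩
    have hvc : v ∈ Ico (0 : ℝ) 1 := ⟨hv.1.le, h1⟩
    rw [gnzPsi_div hn hd hm x hvc]
    have : {u : ℝ | u ∈ Icc (0 : ℝ) 1 ∧ v ≤ gnzDiagonal m x u}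
        = Icc (williamsonCdf (d - 1) (gnzLaw x)
          (m * upperInv (williamsonCdf (d - 1) (gnzLaw x)) v)) 1 := by
      ext u
      rw [mem_ofPred_eq, mem_Icc]
      constructor
      · rintro ⟨hu, hu2⟩
        refine ⟨?_, hu.2⟩
        rcases hu.2.eq_or_lt with h2 | h2
        · rw [h2]
          exact hF.le_one _
        · rw [hdiag u ⟨hu.1, h2⟩, ← hF.upperInv_le_iff hvo, le_div_iff₀ hm'] at hu2
          rw [← hF.le_upperInv_iff ⟨hu.1, h2⟩]
          linarith
      · rintro ⟨hu, hu2⟩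
        have hu0 := (hF.nonneg _).trans hu
        refine ⟨⟨hu0, hu2⟩, ?_⟩
        rcases hu2.eq_or_lt with h2 | h2
        · rw [h2, hdiag1]
          exact hv.2
        · rw [hdiag u ⟨hu0, h2⟩, ← hF.upperInv_le_iff hvo, le_div_iff₀ hm']
          rw [← hF.le_upperInv_iff ⟨hu0, h2⟩] at hu
          linarith
    rw [this, csInf_Icc (hF.le_one _)]

/-! ### Archimedean generators and their inverses -/

namespace IsArchimedeanGenerator

variable {φ : ℝ → ℝ≥0∞}

theorem setOf_le_eq (hφ : IsArchimedeanGenerator φ) (x : ℝ≥0∞) :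
    ∃ a ∈ Icc (0 : ℝ) 1, {u : ℝ | u ∈ Icc (0 : ℝ) 1 ∧ φ u ≤ x} = Icc a 1 := by
  set s := {u : ℝ | u ∈ Icc (0 : ℝ) 1 ∧ φ u ≤ x} with hs
  have hs' : s = Icc 0 1 ∩ φ ⁻¹' Iic x := rfl
  have hcl : IsClosed s := by
    rw [hs']
    exact hφ.continuousOn.preimage_isClosed_of_isClosed isClosed_Icc isClosed_Iic
  have hne : s.Nonempty := ⟨1, by simp, by rw [hφ.map_one]; exact zero_le⟩
  have hbdd : BddBelow s := ⟨0, fun u hu => hu.1.1⟩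
  have hmem := hcl.csInf_mem hne hbdd
  refine ⟨sInf s, hmem.1, ?_⟩
  ext u
  refine ⟨fun hu => ⟨csInf_le hbdd hu, hu.1.2⟩, fun hu => ?_⟩
  have hu' : u ∈ Icc (0 : ℝ) 1 := ⟨hmem.1.1.trans hu.1, hu.2⟩
  exact ⟨hu', (hφ.strictAntiOn.antitoneOn hmem.1 hu' hu.1).trans hmem.2⟩

theorem generatorInverse_mem (hφ : IsArchimedeanGenerator φ) (x : ℝ≥0∞) :
    generatorInverse φ x ∈ Icc (0 : ℝ) 1 := by
  obtain ⟨a, ha, h⟩ := hφ.setOf_le_eq x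
  rwa [generatorInverse, h, csInf_Icc ha.2]

/-- A generator and its inverse form an antitone Galois connection on `[0,1]`. -/
theorem generatorInverse_le_iff (hφ : IsArchimedeanGenerator φ) {x : ℝ≥0∞} {u : ℝ}
    (hu : u ∈ Icc (0 : ℝ) 1) : generatorInverse φ x ≤ u ↔ φ u ≤ x := by
  obtain ⟨a, ha, h⟩ := hφ.setOf_le_eq x
  rw [generatorInverse, h, csInf_Icc ha.2]
  have : u ∈ {u : ℝ | u ∈ Icc (0 : ℝ) 1 ∧ φ u ≤ x} ↔ u ∈ Icc a 1 := by rw [h]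
  rw [mem_ofPred_eq, and_iff_right hu, mem_Icc, and_iff_left hu.2] at this
  exact this.symm

theorem generatorInverse_apply (hφ : IsArchimedeanGenerator φ) {u : ℝ}
    (hu : u ∈ Icc (0 : ℝ) 1) : generatorInverse φ (φ u) = u := by
  refine le_antisymm ((hφ.generatorInverse_le_iff hu).2 le_rfl) ?_
  rw [← hφ.strictAntiOn.le_iff_ge (hφ.generatorInverse_mem _) hu,
    ← hφ.generatorInverse_le_iff (hφ.generatorInverse_mem _)]

theorem antitone_generatorInverse (hφ : IsArchimedeanGenerator φ) :
    Antitone (generatorInverse φ) := fun x _ h =>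
  (hφ.generatorInverse_le_iff (hφ.generatorInverse_mem x)).2
    (((hφ.generatorInverse_le_iff (hφ.generatorInverse_mem x)).1 le_rfl).trans h)

theorem continuous_generatorInverse (hφ : IsArchimedeanGenerator φ) :
    Continuous (generatorInverse φ) := by
  rw [continuous_iff_continuousAt]
  intro x
  have hx := hφ.generatorInverse_mem x
  refine tendsto_order.2 ⟨fun u hu => ?_, fun u hu => ?_⟩
  · rcases lt_or_ge u 0 with h0 | h0
    · exact Eventually.of_forall fun y => h0.trans_le (hφ.generatorInverse_mem y).1
    · have hu' : u ∈ Icc (0 : ℝ) 1 := ⟨h0, hu.le.trans hx.2⟩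
      have h1 : x < φ u := not_le.1 fun h => not_le.2 hu ((hφ.generatorInverse_le_iff hu').2 h)
      filter_upwards [Iio_mem_nhds h1] with y hy
      exact not_le.1 fun h => not_le.2 hy ((hφ.generatorInverse_le_iff hu').1 h)
  · rcases lt_or_ge 1 u with h0 | h0
    · exact Eventually.of_forall fun y => (hφ.generatorInverse_mem y).2.trans_lt h0
    · obtain ⟨u', h1, h2⟩ := exists_between hu
      have hu' : u' ∈ Icc (0 : ℝ) 1 := ⟨hx.1.trans h1.le, h2.le.trans h0⟩
      have h3 : φ u' < x := (hφ.strictAntiOn hx hu' h1).trans_le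
        ((hφ.generatorInverse_le_iff hx).1 le_rfl)
      filter_upwards [Ioi_mem_nhds h3] with y hy
      exact ((hφ.generatorInverse_le_iff hu').2 (le_of_lt hy)).trans_lt h2

theorem apply_generatorInverse (hφ : IsArchimedeanGenerator φ) {x : ℝ≥0∞} (hx : x ≤ φ 0) :
    φ (generatorInverse φ x) = x := by
  have h0 := hφ.generatorInverse_mem x
  refine le_antisymm ((hφ.generatorInverse_le_iff h0).1 le_rfl) ?_
  by_contra! h
  obtain ⟨u, hu, hux⟩ := intermediate_value_Icc' h0.1
    (hφ.continuousOn.mono (Icc_subset_Icc_right h0.2)) (show x ∈ Icc _ _ from ⟨h.le, hx⟩)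
  have hu' : u ∈ Icc (0 : ℝ) 1 := ⟨hu.1, hu.2.trans h0.2⟩
  have h1 := (hφ.generatorInverse_le_iff hu').2 hux.le
  rw [le_antisymm hu.2 h1] at hux
  exact h.ne hux

theorem generatorInverse_eq_zero_iff (hφ : IsArchimedeanGenerator φ) {x : ℝ≥0∞} :
    generatorInverse φ x = 0 ↔ φ 0 ≤ x := by
  rw [← hφ.generatorInverse_le_iff (by simp)]
  exact ⟨fun h => h.le, fun h => le_antisymm h (hφ.generatorInverse_mem x).1⟩

theorem generatorInverse_zero (hφ : IsArchimedeanGenerator φ) : generatorInverse φ 0 = 1 := by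
  rw [← hφ.map_one, hφ.generatorInverse_apply (by simp)]

theorem le_generatorInverse_iff (hφ : IsArchimedeanGenerator φ) {x : ℝ≥0∞} {v : ℝ}
    (hv : v ∈ Ioc (0 : ℝ) 1) : v ≤ generatorInverse φ x ↔ x ≤ φ v := by
  have hv' : v ∈ Icc (0 : ℝ) 1 := ⟨hv.1.le, hv.2⟩
  constructor
  · intro h
    rcases le_total x (φ 0) with h1 | h1
    · rw [← hφ.apply_generatorInverse h1]
      exact hφ.strictAntiOn.antitoneOn hv' (hφ.generatorInverse_mem x) h
    · rw [hφ.generatorInverse_eq_zero_iff.2 h1] at h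
      exact absurd h (not_le.2 hv.1)
  · intro h
    rw [← hφ.generatorInverse_apply hv']
    exact hφ.antitone_generatorInverse h

theorem pos_of_lt_one (hφ : IsArchimedeanGenerator φ) {u : ℝ} (hu : u ∈ Ico (0 : ℝ) 1) :
    0 < φ u := by
  rw [← hφ.map_one]
  exact hφ.strictAntiOn ⟨hu.1, hu.2.le⟩ (by simp) hu.2

theorem ne_top (hφ : IsArchimedeanGenerator φ) {u : ℝ} (hu : u ∈ Ioc (0 : ℝ) 1) : φ u ≠ ∞ :=
  ((hφ.strictAntiOn (by simp) ⟨hu.1.le, hu.2⟩ hu.1).trans_le le_top).ne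

/-- Truncating the arguments at `φ 0`, the end of the support, does not change the value. -/
theorem generatorInverse_sum_apply {ι : Type*} (hφ : IsArchimedeanGenerator φ) (s : Finset ι)
    (y : ι → ℝ≥0∞) :
    generatorInverse φ (∑ l ∈ s, φ (generatorInverse φ (y l)))
      = generatorInverse φ (∑ l ∈ s, y l) := by
  by_cases h : ∀ l ∈ s, y l ≤ φ 0
  · rw [Finset.sum_congr rfl fun l hl => hφ.apply_generatorInverse (h l hl)]
  · push Not at h
    obtain ⟨l, hl, h⟩ := h
    rw [hφ.generatorInverse_eq_zero_iff.2, hφ.generatorInverse_eq_zero_iff.2]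
    · exact h.le.trans (Finset.single_le_sum (f := y) (fun _ _ => zero_le) hl)
    · rw [← hφ.generatorInverse_eq_zero_iff.2 h.le]
      exact Finset.single_le_sum (f := fun l => φ (generatorInverse φ (y l)))
        (fun _ _ => zero_le) hl

/-- The quantile function of the diagonal section of an Archimedean copula is `ψ (φ v / m)`. -/
theorem diagonalQuantile_eq (hφ : IsArchimedeanGenerator φ) {m : ℕ} (hm : 0 < m)
    {C : (Fin m → ℝ) → ℝ}
    (hC : ∀ u ∈ Icc (0 : Fin m → ℝ) 1, C u = generatorInverse φ (∑ j, φ (u j))) {v : ℝ}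
    (hv : v ∈ Ioc (0 : ℝ) 1) : diagonalQuantile C v = generatorInverse φ (φ v / m) := by
  have : {u : ℝ | u ∈ Icc (0 : ℝ) 1 ∧ v ≤ C (fun _ => u)}
      = Icc (generatorInverse φ (φ v / m)) 1 := by
    ext u
    rw [mem_ofPred_eq, mem_Icc]
    have key : ∀ hu : u ∈ Icc (0 : ℝ) 1, v ≤ C (fun _ => u) ↔ generatorInverse φ (φ v / m) ≤ u := by
      intro hu
      rw [hC _ ⟨fun _ => hu.1, fun _ => hu.2⟩, hφ.le_generatorInverse_iff hv,
        hφ.generatorInverse_le_iff hu, Finset.sum_const, Finset.card_univ, Fintype.card_fin,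
        nsmul_eq_mul, ENNReal.le_div_iff_mul_le (Or.inl (by exact_mod_cast hm.ne'))
          (Or.inl (ENNReal.natCast_ne_top m)), mul_comm]
    constructor
    · rintro ⟨hu, h⟩
      exact ⟨(key hu).1 h, hu.2⟩
    · rintro ⟨h, h1⟩
      have hu : u ∈ Icc (0 : ℝ) 1 := ⟨(hφ.generatorInverse_mem _).1.trans h, h1⟩
      exact ⟨hu, (key hu).2 h⟩
  rw [diagonalQuantile, quantile, this, csInf_Icc (hφ.generatorInverse_mem _).2]

theorem diagonalQuantile_zero (hφ : IsArchimedeanGenerator φ) {m : ℕ}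
    {C : (Fin m → ℝ) → ℝ}
    (hC : ∀ u ∈ Icc (0 : Fin m → ℝ) 1, C u = generatorInverse φ (∑ j, φ (u j))) :
    diagonalQuantile C 0 = 0 := by
  have h0 : (0 : ℝ) ∈ {u : ℝ | u ∈ Icc (0 : ℝ) 1 ∧ 0 ≤ C (fun _ => u)} := by
    refine ⟨by simp, ?_⟩
    rw [hC (fun _ => 0) ⟨fun _ => le_rfl, fun _ => zero_le_one⟩]
    exact (hφ.generatorInverse_mem _).1
  exact le_antisymm (csInf_le ⟨0, fun u hu => hu.1.1⟩ h0) (le_csInf ⟨0, h0⟩ fun u hu => hu.1.1)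

end IsArchimedeanGenerator

/-! ### The radial representation of an Archimedean survival function -/

theorem card_piAntidiag_univ_fin (q s : ℕ) :
    (Finset.piAntidiag (Finset.univ : Finset (Fin (q + 1))) s).card = (s + q).choose q := by
  rw [← Finset.map_sym_eq_piAntidiag, Finset.card_map, Finset.sym_univ, Finset.card_univ,
    Sym.card_sym_eq_choose, Fintype.card_fin, show q + 1 + s - 1 = s + q by omega,
    Nat.choose_symm_add]

theorem card_piAntidiag_filter_le (q s a : ℕ) :
    ((Finset.piAntidiag (Finset.univ : Finset (Fin (q + 1))) s).filter fun k => a ≤ k 0).card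
      = if a ≤ s then (s - a + q).choose q else 0 := by
  split_ifs with h
  · rw [← card_piAntidiag_univ_fin]
    refine Finset.card_nbij' (fun k => Function.update k 0 (k 0 - a))
      (fun k => Function.update k 0 (k 0 + a)) ?_ ?_ ?_ ?_
    · intro k hk
      simp only [Finset.coe_filter, Finset.mem_piAntidiag, Finset.mem_univ, implies_true,
        and_true, mem_ofPred_eq, Fin.sum_univ_succ] at hk
      simp only [Finset.mem_coe, Finset.mem_piAntidiag, Finset.mem_univ, implies_true, and_true,
        Fin.sum_univ_succ, Function.update_self, ne_eq, Fin.succ_ne_zero, not_false_eq_true,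
        Function.update_of_ne]
      omega
    · intro k hk
      simp only [Finset.mem_coe, Finset.mem_piAntidiag, Finset.mem_univ, implies_true, and_true,
        Fin.sum_univ_succ] at hk
      simp only [Finset.coe_filter, Finset.mem_piAntidiag, Finset.mem_univ, implies_true,
        and_true, mem_ofPred_eq, Fin.sum_univ_succ, Function.update_self, ne_eq,
        Fin.succ_ne_zero, not_false_eq_true, Function.update_of_ne]
      omega
    · intro k hk
      simp only [Finset.coe_filter, mem_ofPred_eq] at hk
      simp [Nat.sub_add_cancel hk.2]
    · intro k _
      simp
  · rw [Finset.card_eq_zero, Finset.filter_eq_empty_iff]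
    intro k hk hak
    rw [Finset.mem_piAntidiag] at hk
    have : k 0 ≤ Finset.univ.sum k :=
      Finset.single_le_sum (fun _ _ => Nat.zero_le _) (Finset.mem_univ 0)
    omega

/-- The ratio of binomial coefficients as a product; for `s < a` both sides vanish. -/
theorem choose_div_choose {q : ℕ} (hq : 0 < q) (s a : ℕ) :
    (if a ≤ s then ((s - a + q).choose q : ℝ) else 0) / ((s + q).choose q : ℝ)
      = ∏ i ∈ Finset.range q, max 0 (((s : ℝ) - a + (i + 1)) / ((s : ℝ) + (i + 1))) := by
  have key : ∀ r : ℕ, ((r + q).choose q : ℝ)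
      = (∏ i ∈ Finset.range q, ((r : ℝ) + (i + 1))) / (q.factorial : ℝ) := by
    intro r
    rw [eq_div_iff (by exact_mod_cast q.factorial_ne_zero)]
    have := Nat.ascFactorial_eq_factorial_mul_choose r q
    rw [Nat.ascFactorial_eq_prod_range] at this
    have h2 : ((∏ i ∈ Finset.range q, (r + 1 + i) : ℕ) : ℝ)
        = ∏ i ∈ Finset.range q, ((r : ℝ) + (i + 1)) := by
      push_cast
      exact Finset.prod_congr rfl fun i _ => by ring
    rw [← h2, this]
    push_cast
    ring
  have hf : (q.factorial : ℝ) ≠ 0 := by exact_mod_cast q.factorial_ne_zero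
  split_ifs with h
  · rw [key, key, div_div_div_cancel_right₀ hf, ← Finset.prod_div_distrib]
    refine Finset.prod_congr rfl fun i _ => ?_
    have h1 : (a : ℝ) ≤ s := by exact_mod_cast h
    rw [Nat.cast_sub h, max_eq_right]
    exact div_nonneg (by linarith [(i.cast_nonneg : (0 : ℝ) ≤ i)]) (by positivity)
  · rw [zero_div, eq_comm]
    refine Finset.prod_eq_zero (Finset.mem_range.2 hq) (max_eq_left ?_)
    have h1 : (s : ℝ) + 1 ≤ a := by exact_mod_cast not_le.1 h
    refine div_nonpos_of_nonpos_of_nonneg ?_ (by positivity)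
    push_cast
    linarith

section Survival

variable {Ω : Type*} [MeasurableSpace Ω] {P : Measure Ω} [IsProbabilityMeasure P] {q : ℕ}

/-- If the survival function of a random vector in `ℕ^d` depends only on the sum of the
arguments, then so does its probability mass function. -/
theorem exists_measureReal_eq_sum {N : Ω → Fin (q + 1) → ℕ} (hN : Measurable N) {G : ℕ → ℝ}
    (hG : ∀ k : Fin (q + 1) → ℕ, P.real {ω | ∀ l, k l ≤ N ω l} = G (∑ l, k l)) :
    ∃ w : ℕ → ℝ, ∀ k : Fin (q + 1) → ℕ, P.real {ω | N ω = k} = w (∑ l, k l) := by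
  have hmeas : ∀ s : Set (Fin (q + 1) → ℕ), MeasurableSet (N ⁻¹' s) := fun s =>
    hN (MeasurableSet.of_discrete)
  have key : ∀ J : Finset (Fin (q + 1)), ∃ w : ℕ → ℝ, ∀ k : Fin (q + 1) → ℕ,
      P.real (N ⁻¹' {n | ∀ l, k l ≤ n l ∧ (l ∈ J → n l = k l)}) = w (∑ l, k l) := by
    intro J
    induction J using Finset.induction_on with
    | empty => exact ⟨G, fun k => by simpa using hG k⟩
    | insert j J hj ih =>
      obtain ⟨w, hw⟩ := ih
      refine ⟨fun s => w s - w (s + 1), fun k => ?_⟩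
      have h1 : N ⁻¹' {n | ∀ l, k l ≤ n l ∧ (l ∈ J → n l = k l)}
          = N ⁻¹' {n | ∀ l, k l ≤ n l ∧ (l ∈ insert j J → n l = k l)} ∪
            N ⁻¹' {n | ∀ l, Function.update k j (k j + 1) l ≤ n l ∧
              (l ∈ J → n l = Function.update k j (k j + 1) l)} := by
        rw [← preimage_union]
        congr 1
        ext n
        simp only [mem_ofPred_eq, mem_union]
        constructor
        · intro h
          rcases (h j).1.eq_or_lt with h2 | h2
          · refine Or.inl fun l => ⟨(h l).1, fun hl => ?_⟩
            rcases Finset.mem_insert.1 hl with rfl | hl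
            · exact h2.symm
            · exact (h l).2 hl
          · refine Or.inr fun l => ?_
            rcases eq_or_ne l j with rfl | hl
            · rw [Function.update_self]
              exact ⟨h2, fun h3 => absurd h3 hj⟩
            · rw [Function.update_of_ne hl]
              exact h l
        · rintro (h | h) l
          · exact ⟨(h l).1, fun hl => (h l).2 (Finset.mem_insert_of_mem hl)⟩
          · have := h l
            rcases eq_or_ne l j with rfl | hl
            · rw [Function.update_self] at this
              exact ⟨by omega, fun h3 => absurd h3 hj⟩
            · rwa [Function.update_of_ne hl] at this
      have h2 : Disjoint (N ⁻¹' {n | ∀ l, k l ≤ n l ∧ (l ∈ insert j J → n l = k l)})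
            (N ⁻¹' {n | ∀ l, Function.update k j (k j + 1) l ≤ n l ∧
              (l ∈ J → n l = Function.update k j (k j + 1) l)}) := by
        refine Disjoint.preimage _ (Set.disjoint_left.2 fun n h h' => ?_)
        have h3 := (h j).2 (Finset.mem_insert_self j J)
        have h4 := (h' j).1
        rw [Function.update_self] at h4
        omega
      have h3 := measureReal_union (μ := P) h2 (hmeas _)
      rw [← h1, hw, hw] at h3
      have h4 : ∑ l, Function.update k j (k j + 1) l = ∑ l, k l + 1 := by
        rw [Finset.sum_update_of_mem (Finset.mem_univ j),
          ← Finset.add_sum_erase _ _ (Finset.mem_univ j), Finset.sdiff_singleton_eq_erase]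
        ring
      rw [h4] at h3
      linarith
  obtain ⟨w, hw⟩ := key Finset.univ
  refine ⟨w, fun k => ?_⟩
  rw [← hw k]
  congr 1
  ext ω
  simp only [mem_ofPred_eq, mem_preimage, Finset.mem_univ, true_implies]
  exact ⟨fun h l => by simp [h], fun h => funext fun l => (h l).2⟩

/-- Conditionally on the sum, a vector whose survival function depends only on the sum of the
arguments is uniformly distributed on the simplex. -/
theorem measureReal_le_eq_integral_choose {N : Ω → Fin (q + 1) → ℕ} (hN : Measurable N)
    {G : ℕ → ℝ}
    (hG : ∀ k : Fin (q + 1) → ℕ, P.real {ω | ∀ l, k l ≤ N ω l} = G (∑ l, k l)) (a : ℕ) :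
    P.real {ω | a ≤ N ω 0} = ∫ ω, (if a ≤ ∑ l, N ω l then
      ((∑ l, N ω l - a + q).choose q : ℝ) else 0) / ((∑ l, N ω l + q).choose q : ℝ) ∂P := by
  obtain ⟨w, hw⟩ := exists_measureReal_eq_sum hN hG
  have hmeas : ∀ s : Set (Fin (q + 1) → ℕ), MeasurableSet (N ⁻¹' s) := fun s =>
    hN (MeasurableSet.of_discrete)
  set c : ℕ → ℝ := fun s => (if a ≤ s then ((s - a + q).choose q : ℝ) else 0) /
    ((s + q).choose q : ℝ) with hc
  have hcbd : ∀ s, 0 ≤ c s ∧ c s ≤ 1 := by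
    intro s
    have h0 : (0 : ℝ) < ((s + q).choose q : ℝ) := by
      exact_mod_cast Nat.choose_pos (Nat.le_add_left _ _)
    rw [hc]
    refine ⟨by positivity, (div_le_one h0).2 ?_⟩
    split_ifs
    · exact_mod_cast Nat.choose_le_choose q (by omega)
    · exact h0.le
  set S : ℕ → Set Ω := fun s => N ⁻¹' {n | ∑ l, n l = s} with hS
  have hcard : ∀ (s : ℕ) (p : (Fin (q + 1) → ℕ) → Prop) [DecidablePred p],
      P.real (N ⁻¹' {n | ∑ l, n l = s ∧ p n})
        = ((Finset.piAntidiag (Finset.univ : Finset (Fin (q + 1))) s).filter p).card * w s := by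
    intro s p _
    have h1 : N ⁻¹' {n | ∑ l, n l = s ∧ p n} = ⋃ k ∈ (Finset.piAntidiag
        (Finset.univ : Finset (Fin (q + 1))) s).filter p, N ⁻¹' {k} := by
      ext ω
      simp
    rw [h1, measureReal_biUnion_finset]
    · rw [Finset.sum_congr rfl (g := fun _ => w s), Finset.sum_const, nsmul_eq_mul]
      intro k hk
      simp only [Finset.mem_filter, Finset.mem_piAntidiag] at hk
      rw [← hk.1.1]
      exact hw k
    · intro k _ k' _ hkk
      exact Disjoint.preimage _ (by simpa using hkk)
    · exact fun k _ => hmeas _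
  have hU : ⋃ s, S s = univ := by
    ext ω
    simp [hS]
  have hdis : Pairwise (Function.onFun Disjoint S) := fun s s' h =>
    Disjoint.preimage _ (Set.disjoint_left.2 fun n h1 h2 => h (h1.symm.trans h2))
  have hSm : ∀ s, MeasurableSet (S s) := fun s => hmeas _
  have hi1 : Integrable (fun ω => c (∑ l, N ω l)) P := by
    refine Integrable.of_bound (C := 1) ?_ (Eventually.of_forall fun ω => ?_)
    · exact (Measurable.of_discrete (f := fun n : Fin (q + 1) → ℕ => c (∑ l, n l)) |>.comp
        hN).aestronglyMeasurable
    · rw [Real.norm_eq_abs, abs_of_nonneg (hcbd _).1]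
      exact (hcbd _).2
  have hA : MeasurableSet (N ⁻¹' {n | a ≤ n 0}) := hmeas _
  have hi2 : Integrable ((N ⁻¹' {n | a ≤ n 0}).indicator fun _ => (1 : ℝ)) P :=
    (integrable_const 1).indicator hA
  have h1 : P.real {ω | a ≤ N ω 0} = ∫ ω, (N ⁻¹' {n | a ≤ n 0}).indicator (fun _ => (1 : ℝ)) ω ∂P
      := by
    rw [integral_indicator_const _ hA, smul_eq_mul, mul_one]
    rfl
  rw [h1]
  change _ = ∫ ω, c (∑ l, N ω l) ∂P
  rw [← setIntegral_univ, ← setIntegral_univ (f := fun ω => c (∑ l, N ω l)), ← hU,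
    integral_iUnion hSm hdis hi2.integrableOn, integral_iUnion hSm hdis hi1.integrableOn]
  congr 1
  ext s
  have h2 : ∫ ω in S s, c (∑ l, N ω l) ∂P = ∫ ω in S s, c s ∂P :=
    setIntegral_congr_fun (hSm s) fun ω hω => by
      have : ∑ l, N ω l = s := hω
      simp only [this]
  have h3 := hcard s (fun _ => True)
  have h4 := hcard s (fun n => a ≤ n 0)
  simp only [and_true, Finset.filter_true, card_piAntidiag_univ_fin] at h3
  rw [card_piAntidiag_filter_le] at h4
  rw [h2, setIntegral_const, integral_indicator_const _ hA, smul_eq_mul, smul_eq_mul, mul_one,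
    measureReal_restrict_apply hA]
  change _ = P.real (N ⁻¹' {n | ∑ l, n l = s}) * _
  have h5 : N ⁻¹' {n | a ≤ n 0} ∩ S s = N ⁻¹' {n | ∑ l, n l = s ∧ a ≤ n 0} := by
    ext ω
    exact and_comm
  have h0 : ((s + q).choose q : ℝ) ≠ 0 := by
    exact_mod_cast (Nat.choose_pos (Nat.le_add_left _ _)).ne'
  rw [h5, h3, h4, hc]
  field_simp
  push_cast
  ring

/-- **Williamson representation.** A nonnegative random vector whose survival function is
`y ↦ g (∑ y)` is `R` times a uniform vector on the simplex, in the sense of its margins: `g` is the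
Williamson transform of the law of the sum `R` of the coordinates. -/
theorem survival_eq_integral (hq : 0 < q) {Y : Ω → Fin (q + 1) → ℝ} (hY : Measurable Y)
    (hY0 : ∀ ω l, 0 ≤ Y ω l) {g : ℝ → ℝ}
    (hg : ∀ y : Fin (q + 1) → ℝ, (∀ l, 0 ≤ y l) → P.real {ω | ∀ l, y l ≤ Y ω l} = g (∑ l, y l))
    (hpos : ∀ᵐ ω ∂P, 0 < ∑ l, Y ω l) {x : ℝ} (hx : 0 < x) :
    g x = ∫ ω, (max 0 (1 - x / ∑ l, Y ω l)) ^ q ∂P := by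
  -- discretize with mesh `x / (n + 1)`
  set N : ℕ → Ω → Fin (q + 1) → ℕ := fun n ω l => ⌊Y ω l * (n + 1) / x⌋₊ with hNdef
  have hN : ∀ n, Measurable (N n) := fun n => measurable_pi_lambda _ fun l =>
    Nat.measurable_floor.comp ((((measurable_pi_apply l).comp hY).mul_const _).div_const _)
  have hNle : ∀ n (k : ℕ) ω l, k ≤ N n ω l ↔ (k : ℝ) * x / (n + 1) ≤ Y ω l := by
    intro n k ω l
    have : (0 : ℝ) < n + 1 := by positivity
    rw [hNdef]
    simp only
    rw [Nat.le_floor_iff (div_nonneg (mul_nonneg (hY0 ω l) this.le) hx.le), le_div_iff₀ hx,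
      div_le_iff₀ this]
  have hG : ∀ n (k : Fin (q + 1) → ℕ), P.real {ω | ∀ l, k l ≤ N n ω l}
      = (fun s : ℕ => g (s * x / (n + 1))) (∑ l, k l) := by
    intro n k
    simp only [hNle]
    rw [hg _ fun l => by positivity]
    congr 1
    rw [← Finset.sum_div, ← Finset.sum_mul]
    push_cast
    rfl
  have hx1 : ∀ n, g x = ∫ ω, ∏ i ∈ Finset.range q,
      max 0 ((((∑ l, N n ω l : ℕ) : ℝ) - (n + 1 : ℕ) + (i + 1)) /
        (((∑ l, N n ω l : ℕ) : ℝ) + (i + 1))) ∂P := by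
    intro n
    have h1 := measureReal_le_eq_integral_choose (G := fun s : ℕ => g (s * x / (n + 1)))
      (hN n) (hG n) (n + 1)
    simp_rw [choose_div_choose hq] at h1
    rw [← h1]
    have h2 := hG n (Pi.single 0 (n + 1))
    simp only [Finset.sum_pi_single', Finset.mem_univ, if_true] at h2
    have h3 : {ω | ∀ l, (Pi.single 0 (n + 1) : Fin (q + 1) → ℕ) l ≤ N n ω l}
        = {ω | n + 1 ≤ N n ω 0} := by
      ext ω
      refine ⟨fun h => by simpa using h 0, fun h l => ?_⟩
      rcases eq_or_ne l 0 with rfl | hl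
      · simpa using h
      · simp [Pi.single_eq_of_ne hl]
    rw [← h3, h2]
    congr 1
    push_cast
    have : (n : ℝ) + 1 ≠ 0 := by positivity
    field_simp
  have hlim : Tendsto (fun n : ℕ => ∫ ω, ∏ i ∈ Finset.range q,
      max 0 ((((∑ l, N n ω l : ℕ) : ℝ) - (n + 1 : ℕ) + (i + 1)) /
        (((∑ l, N n ω l : ℕ) : ℝ) + (i + 1))) ∂P) atTop
      (𝓝 (∫ ω, (max 0 (1 - x / ∑ l, Y ω l)) ^ q ∂P)) := by
    refine tendsto_integral_of_dominated_convergence (fun _ => 1) (fun n => ?_)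
      (integrable_const 1) (fun n => ?_) ?_
    · exact (Measurable.of_discrete (f := fun k : Fin (q + 1) → ℕ => ∏ i ∈ Finset.range q,
        max 0 ((((∑ l, k l : ℕ) : ℝ) - (n + 1 : ℕ) + (i + 1)) /
        (((∑ l, k l : ℕ) : ℝ) + (i + 1)))) |>.comp (hN n)).aestronglyMeasurable
    · refine Eventually.of_forall fun ω => ?_
      rw [Real.norm_eq_abs, abs_of_nonneg (Finset.prod_nonneg fun _ _ => le_max_left _ _)]
      refine Finset.prod_le_one (fun _ _ => le_max_left _ _) fun i _ => max_le zero_le_one ?_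
      rw [div_le_one (by positivity)]
      push_cast
      linarith [(n.cast_nonneg : (0 : ℝ) ≤ n)]
    · filter_upwards [hpos] with ω hω
      set R := ∑ l, Y ω l with hR
      have hn1 : Tendsto (fun n : ℕ => (n : ℝ) + 1) atTop atTop :=
        tendsto_atTop_add_const_right _ _ tendsto_natCast_atTop_atTop
      -- the rescaled discretized sum converges to the sum
      have hS : Tendsto (fun n : ℕ => ((∑ l, N n ω l : ℕ) : ℝ) / (n + 1)) atTop (𝓝 (R / x)) := by
        have h1 : ∀ l, Tendsto (fun n : ℕ => (N n ω l : ℝ) / (n + 1)) atTop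
            (𝓝 (Y ω l / x)) := by
          intro l
          have h2 := (tendsto_nat_floor_mul_div_atTop (div_nonneg (hY0 ω l) hx.le)).comp hn1
          refine h2.congr fun n => ?_
          simp only [Function.comp, hNdef]
          congr 3
          ring
        have h3 := tendsto_finsetSum (Finset.univ : Finset (Fin (q + 1))) fun l _ => h1 l
        rw [← Finset.sum_div] at h3
        refine h3.congr fun n => ?_
        rw [← Finset.sum_div]
        push_cast
        rfl
      have hpow : ∀ c : ℝ, c ^ q = ∏ _i ∈ Finset.range q, c := fun c => by simp
      rw [hpow]
      refine tendsto_finsetProd _ fun i _ => ?_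
      have hi : Tendsto (fun n : ℕ => ((i : ℝ) + 1) / (n + 1)) atTop (𝓝 0) :=
        tendsto_const_nhds.div_atTop hn1
      have h4 : Tendsto (fun n : ℕ => max 0 ((((∑ l, N n ω l : ℕ) : ℝ) / (n + 1) - 1 +
          ((i : ℝ) + 1) / (n + 1)) / (((∑ l, N n ω l : ℕ) : ℝ) / (n + 1) +
          ((i : ℝ) + 1) / (n + 1)))) atTop (𝓝 (max 0 ((R / x - 1 + 0) / (R / x + 0)))) :=
        tendsto_const_nhds.max (((hS.sub tendsto_const_nhds).add hi).div (hS.add hi)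
          (by rw [add_zero]; positivity))
      have h5 : (R / x - 1 + 0) / (R / x + 0) = 1 - x / R := by
        field_simp
        ring
      rw [h5] at h4
      refine h4.congr fun n => ?_
      congr 1
      have : (n : ℝ) + 1 ≠ 0 := by positivity
      push_cast
      field_simp
  exact tendsto_nhds_unique ((tendsto_const_nhds (x := g x)).congr fun n => hx1 n) hlim

end Survival

/-! ### Laws with an Archimedean copula -/

section Marginal

variable {m : ℕ} {μ : Measure (Fin m → ℝ)} [IsProbabilityMeasure μ]

theorem marginalCdf_eq (j : Fin m) (x : ℝ) : marginalCdf μ j x = μ.real {t | t j ≤ x} := by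
  have := Measure.isProbabilityMeasure_map (μ := μ) (measurable_pi_apply j).aemeasurable
  rw [marginalCdf, cdf_eq_real, map_measureReal_apply (measurable_pi_apply j) measurableSet_Iic]
  rfl

omit [IsProbabilityMeasure μ] in
theorem marginalCdf_mem (j : Fin m) (x : ℝ) : marginalCdf μ j x ∈ Icc (0 : ℝ) 1 :=
  ⟨cdf_nonneg _ _, cdf_le_one _ _⟩

omit [IsProbabilityMeasure μ] in
theorem monotone_marginalCdf (j : Fin m) : Monotone (marginalCdf μ j) := monotone_cdf _

variable (hcont : ∀ j, Continuous (marginalCdf μ j))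
include hcont

omit [IsProbabilityMeasure μ] in
theorem exists_marginalCdf_le_iff (j : Fin m) {u : ℝ} (hu : u ∈ Ioo (0 : ℝ) 1) :
    ∃ x, marginalCdf μ j x = u ∧ ∀ y, marginalCdf μ j y ≤ u ↔ y ≤ x := by
  have hbot : Tendsto (marginalCdf μ j) atBot (𝓝 0) := tendsto_cdf_atBot _
  have htop : Tendsto (marginalCdf μ j) atTop (𝓝 1) := tendsto_cdf_atTop _
  have hmono : Monotone (marginalCdf μ j) := monotone_cdf _
  obtain ⟨b, hb⟩ := (htop.eventually (lt_mem_nhds hu.2)).exists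
  obtain ⟨a, ha⟩ := (hbot.eventually (gt_mem_nhds hu.1)).exists
  have hcl : IsClosed {y | marginalCdf μ j y ≤ u} := isClosed_le (hcont j) continuous_const
  have hbdd : BddAbove {y | marginalCdf μ j y ≤ u} := by
    refine ⟨b, fun y hy => ?_⟩
    by_contra! h
    exact absurd (hmono h.le) (not_le.2 (lt_of_le_of_lt hy hb))
  have hmem := hcl.csSup_mem ⟨a, ha.le⟩ hbdd
  set x := sSup {y | marginalCdf μ j y ≤ u}
  have hiff : ∀ y, marginalCdf μ j y ≤ u ↔ y ≤ x :=
    fun y => ⟨fun h => le_csSup hbdd h, fun h => (hmono h).trans hmem⟩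
  refine ⟨x, le_antisymm hmem ?_, hiff⟩
  refine ge_of_tendsto ((hcont j).continuousWithinAt (s := Ioi x) (x := x)).tendsto ?_
  filter_upwards [self_mem_nhdsWithin] with y hy
  exact (not_le.1 fun h => not_lt.2 ((hiff y).1 h) hy).le

/-- The probability integral transform: `F_j (t j)` is uniformly distributed. -/
theorem measureReal_marginalCdf_le (j : Fin m) {u : ℝ} (hu : u ∈ Ioo (0 : ℝ) 1) :
    μ.real {t | marginalCdf μ j (t j) ≤ u} = u := by
  obtain ⟨x, hx, hiff⟩ := exists_marginalCdf_le_iff hcont j hu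
  simp only [hiff]
  rw [← marginalCdf_eq, hx]

theorem ae_marginalCdf_mem (j : Fin m) : ∀ᵐ t ∂μ, marginalCdf μ j (t j) ∈ Ioo (0 : ℝ) 1 := by
  have h1 : μ.real {t | marginalCdf μ j (t j) ≤ 0} = 0 := by
    refine le_antisymm (le_of_forall_gt_imp_ge_of_dense fun u hu => ?_) measureReal_nonneg
    have hu' : min u (1 / 2) ∈ Ioo (0 : ℝ) 1 :=
      ⟨lt_min hu (by norm_num), (min_le_right _ _).trans_lt (by norm_num)⟩
    calc μ.real {t | marginalCdf μ j (t j) ≤ 0}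
        ≤ μ.real {t | marginalCdf μ j (t j) ≤ min u (1 / 2)} :=
          measureReal_mono fun t ht => le_trans ht hu'.1.le
      _ = min u (1 / 2) := measureReal_marginalCdf_le hcont j hu'
      _ ≤ u := min_le_left _ _
  have h2 : μ.real {t | marginalCdf μ j (t j) < 1} = 1 := by
    refine le_antisymm measureReal_le_one (le_of_forall_lt_imp_le_of_dense fun u hu => ?_)
    have hu' : max u (1 / 2) ∈ Ioo (0 : ℝ) 1 :=
      ⟨lt_of_lt_of_le (by norm_num) (le_max_right _ _), max_lt hu (by norm_num)⟩
    calc u ≤ max u (1 / 2) := le_max_left _ _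
      _ = μ.real {t | marginalCdf μ j (t j) ≤ max u (1 / 2)} :=
          (measureReal_marginalCdf_le hcont j hu').symm
      _ ≤ μ.real {t | marginalCdf μ j (t j) < 1} :=
          measureReal_mono fun t ht => lt_of_le_of_lt ht hu'.2
  have hm : Measurable fun t : Fin m → ℝ => marginalCdf μ j (t j) :=
    ((hcont j).comp (continuous_apply j)).measurable
  have h3 : ∀ᵐ t ∂μ, 0 < marginalCdf μ j (t j) := by
    rw [measureReal_eq_zero_iff] at h1
    rw [ae_iff]
    simpa only [not_lt] using h1
  have h4 : ∀ᵐ t ∂μ, marginalCdf μ j (t j) < 1 := by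
    rw [measureReal_def, ENNReal.toReal_eq_one_iff] at h2
    exact (mem_ae_iff_prob_eq_one (measurableSet_lt hm measurable_const)).2 h2
  filter_upwards [h3, h4] with t ht1 ht2 using ⟨ht1, ht2⟩

/-- Up to null sets, `t j < x` is the same as `F_j (t j) ≤ F_j x`. -/
theorem ae_lt_iff_marginalCdf_le (j : Fin m) {x : ℝ} (hx : marginalCdf μ j x ∈ Ioo (0 : ℝ) 1) :
    ∀ᵐ t ∂μ, t j < x ↔ marginalCdf μ j (t j) ≤ marginalCdf μ j x := by
  have hm : Measurable fun t : Fin m → ℝ => marginalCdf μ j (t j) :=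
    ((hcont j).comp (continuous_apply j)).measurable
  have hsub : {t : Fin m → ℝ | t j < x} ⊆ {t | marginalCdf μ j (t j) ≤ marginalCdf μ j x} :=
    fun t ht => monotone_marginalCdf j (le_of_lt ht)
  have hlt : marginalCdf μ j x ≤ μ.real {t | t j < x} := by
    refine le_of_tendsto ((hcont j).continuousWithinAt (s := Iio x) (x := x)).tendsto ?_
    filter_upwards [self_mem_nhdsWithin] with y hy
    rw [marginalCdf_eq]
    exact measureReal_mono fun t (ht : t j ≤ y) => lt_of_le_of_lt ht hy
  have hmx : MeasurableSet {t : Fin m → ℝ | t j < x} :=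
    measurableSet_lt (measurable_pi_apply j) measurable_const
  have h1 : μ.real ({t | marginalCdf μ j (t j) ≤ marginalCdf μ j x} \ {t | t j < x}) = 0 := by
    have h2 := measureReal_sdiff (μ := μ) hsub hmx
    rw [measureReal_marginalCdf_le hcont j hx] at h2
    exact le_antisymm (by linarith) measureReal_nonneg
  rw [measureReal_eq_zero_iff] at h1
  filter_upwards [measure_eq_zero_iff_ae_notMem.1 h1] with t ht
  refine ⟨fun h => hsub h, fun h => ?_⟩
  by_contra h2
  exact ht ⟨h, h2⟩

end Marginal

section Archimedean

variable {m : ℕ} {μ : Measure (Fin m → ℝ)} [IsProbabilityMeasure μ]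
  (hcont : ∀ j, Continuous (marginalCdf μ j))
  {C : (Fin m → ℝ) → ℝ} (hC : IsCopulaOf C μ) {φ : ℝ → ℝ≥0∞} (hφ : IsArchimedeanGenerator φ)
  (hCφ : ∀ u ∈ Icc (0 : Fin m → ℝ) 1, C u = generatorInverse φ (∑ j, φ (u j)))
include hcont hC hφ hCφ

theorem measureReal_forall_marginalCdf_le {u : Fin m → ℝ} (hu : ∀ j, u j ∈ Ioc (0 : ℝ) 1) :
    μ.real {t | ∀ j, marginalCdf μ j (t j) ≤ u j} = generatorInverse φ (∑ j, φ (u j)) := by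
  -- thresholds below `1` are values of the marginal distribution functions
  have h1 : ∀ u : Fin m → ℝ, (∀ j, u j ∈ Ioo (0 : ℝ) 1) →
      μ.real {t | ∀ j, marginalCdf μ j (t j) ≤ u j} = generatorInverse φ (∑ j, φ (u j)) := by
    intro u hu
    choose x hx hiff using fun j => exists_marginalCdf_le_iff hcont j (hu j)
    simp only [hiff]
    rw [← hCφ u ⟨fun j => (hu j).1.le, fun j => (hu j).2.le⟩, ← funext hx, ← hC.2 x]
    rfl
  set c : ℕ → ℝ := fun n => 1 - 1 / ((n : ℝ) + 2) with hc
  have hc0 : ∀ n, c n ∈ Ioo (0 : ℝ) 1 := by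
    intro n
    have h2 : (0 : ℝ) < (n : ℝ) + 2 := by positivity
    have h3 : 1 / ((n : ℝ) + 2) < 1 := by
      rw [div_lt_one h2]
      linarith [(n.cast_nonneg : (0 : ℝ) ≤ n)]
    have h4 : 0 < 1 / ((n : ℝ) + 2) := by positivity
    exact ⟨by simp only [hc]; linarith, by simp only [hc]; linarith⟩
  have hcmono : Monotone c := by
    intro a b hab
    have : (a : ℝ) ≤ b := by exact_mod_cast hab
    simp only [hc]
    gcongr
  have hclim : Tendsto c atTop (𝓝 1) := by
    have h2 : Tendsto (fun n : ℕ => 1 / ((n : ℝ) + 2)) atTop (𝓝 0) :=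
      tendsto_const_nhds.div_atTop
        (tendsto_atTop_add_const_right _ _ tendsto_natCast_atTop_atTop)
    simpa [hc] using tendsto_const_nhds.sub h2
  have hun : ∀ n j, min (u j) (c n) ∈ Ioo (0 : ℝ) 1 := fun n j =>
    ⟨lt_min (hu j).1 (hc0 n).1, (min_le_right _ _).trans_lt (hc0 n).2⟩
  have hA : Tendsto (fun n => μ.real {t | ∀ j, marginalCdf μ j (t j) ≤ min (u j) (c n)}) atTop
      (𝓝 (μ.real {t | ∀ j, marginalCdf μ j (t j) ≤ u j})) := by
    have h2 : Monotone fun n => {t : Fin m → ℝ | ∀ j, marginalCdf μ j (t j) ≤ min (u j) (c n)} :=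
      fun a b hab t ht j => (ht j).trans (min_le_min_left _ (hcmono hab))
    have h3 := tendsto_measure_iUnion_atTop (μ := μ) h2
    have h4 : (⋃ n, {t : Fin m → ℝ | ∀ j, marginalCdf μ j (t j) ≤ min (u j) (c n)})
        =ᵐ[μ] {t | ∀ j, marginalCdf μ j (t j) ≤ u j} := by
      filter_upwards [ae_all_iff.2 fun j => ae_marginalCdf_mem hcont j] with t ht
      refine propext ⟨fun h => ?_, fun h => ?_⟩
      · obtain ⟨n, hn⟩ := mem_iUnion.1 h
        exact fun j => (hn j).trans (min_le_left _ _)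
      · have h5 : ∀ᶠ n in atTop, ∀ j, marginalCdf μ j (t j) < c n :=
          eventually_all.2 fun j => hclim.eventually (lt_mem_nhds (ht j).2)
        obtain ⟨n, hn⟩ := h5.exists
        exact mem_iUnion.2 ⟨n, fun j => le_min (h j) (hn j).le⟩
    rw [measure_congr h4] at h3
    exact (ENNReal.tendsto_toReal (measure_ne_top _ _)).comp h3
  have hB : Tendsto (fun n => generatorInverse φ (∑ j, φ (min (u j) (c n)))) atTop
      (𝓝 (generatorInverse φ (∑ j, φ (u j)))) := by
    refine (hφ.continuous_generatorInverse.tendsto _).comp (tendsto_finsetSum _ fun j _ => ?_)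
    have h2 : Tendsto (fun n => min (u j) (c n)) atTop (𝓝[Icc 0 1] (u j)) := by
      refine tendsto_nhdsWithin_iff.2 ⟨?_, Eventually.of_forall fun n =>
        ⟨(hun n j).1.le, (hun n j).2.le⟩⟩
      have := (tendsto_const_nhds (x := u j)).min hclim
      rwa [min_eq_left (hu j).2] at this
    exact (hφ.continuousOn (u j) ⟨(hu j).1.le, (hu j).2⟩).tendsto.comp h2
  exact tendsto_nhds_unique (hA.congr fun n => h1 _ (hun n)) hB

/-- Marginalization: the coordinates outside of the range of `e` receive the argument `1`, where the
generator vanishes. -/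
theorem measureReal_forall_marginalCdf_le_comp {d : ℕ} (e : Fin d ↪ Fin m) {u : Fin d → ℝ}
    (hu : ∀ l, u l ∈ Ioc (0 : ℝ) 1) :
    μ.real {t | ∀ l, marginalCdf μ (e l) (t (e l)) ≤ u l}
      = generatorInverse φ (∑ l, φ (u l)) := by
  have h1 : ∀ l, Function.extend e u 1 (e l) = u l := fun l => e.injective.extend_apply u 1 l
  have h2 : ∀ j, j ∉ Set.range e → Function.extend e u 1 j = 1 := fun j hj =>
    Function.extend_apply' u (1 : Fin m → ℝ) j hj
  have h3 := measureReal_forall_marginalCdf_le hcont hC hφ hCφ (u := Function.extend e u 1)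
    fun j => by
      by_cases hj : j ∈ Set.range e
      · obtain ⟨l, rfl⟩ := hj
        rw [h1]
        exact hu l
      · rw [h2 j hj]
        simp
  have h4 : ∑ j, φ (Function.extend e u 1 j) = ∑ l, φ (u l) := by
    rw [← Finset.sum_subset (Finset.subset_univ (Finset.univ.map e)), Finset.sum_map]
    · simp only [h1]
    · intro j _ hj
      rw [h2 j, hφ.map_one]
      rintro ⟨l, rfl⟩
      exact hj (Finset.mem_map_of_mem e (Finset.mem_univ l))
  rw [h4] at h3
  rw [← h3]
  congr 1
  ext t
  refine ⟨fun h j => ?_, fun h l => ?_⟩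
  · by_cases hj : j ∈ Set.range e
    · obtain ⟨l, rfl⟩ := hj
      rw [h1]
      exact h l
    · rw [h2 j hj]
      exact (marginalCdf_mem j _).2
  · have := h (e l)
    rwa [h1] at this

/-- The transformed coordinates `φ (F_j (t j))` have survival function `y ↦ ψ (∑ y)`. -/
theorem measureReal_forall_le_toReal {d : ℕ} (e : Fin d ↪ Fin m) {y : Fin d → ℝ}
    (hy : ∀ l, 0 ≤ y l) :
    μ.real {t | ∀ l, y l ≤ (φ (marginalCdf μ (e l) (t (e l)))).toReal}
      = generatorInverse φ (ENNReal.ofReal (∑ l, y l)) := by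
  rw [ENNReal.ofReal_sum_of_nonneg fun l _ => hy l]
  have h1 : {t | ∀ l, y l ≤ (φ (marginalCdf μ (e l) (t (e l)))).toReal}
      =ᵐ[μ] {t | ∀ l, marginalCdf μ (e l) (t (e l))
        ≤ generatorInverse φ (ENNReal.ofReal (y l))} := by
    filter_upwards [ae_all_iff.2 fun j => ae_marginalCdf_mem hcont j] with t ht
    refine propext (forall_congr' fun l => ?_)
    have h2 : marginalCdf μ (e l) (t (e l)) ∈ Ioc (0 : ℝ) 1 := ⟨(ht _).1, (ht _).2.le⟩
    rw [hφ.le_generatorInverse_iff h2, ENNReal.ofReal_le_iff_le_toReal (hφ.ne_top h2)]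
  rw [measureReal_congr h1]
  by_cases h : ∀ l, 0 < generatorInverse φ (ENNReal.ofReal (y l))
  · rw [measureReal_forall_marginalCdf_le_comp hcont hC hφ hCφ e
      fun l => ⟨h l, (hφ.generatorInverse_mem _).2⟩, hφ.generatorInverse_sum_apply]
  · push Not at h
    obtain ⟨l, hl⟩ := h
    have h2 := hφ.generatorInverse_eq_zero_iff.1 (le_antisymm hl (hφ.generatorInverse_mem _).1)
    rw [hφ.generatorInverse_eq_zero_iff.2 (h2.trans (Finset.single_le_sum
      (f := fun l => ENNReal.ofReal (y l)) (fun _ _ => zero_le) (Finset.mem_univ l))),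
      measureReal_eq_zero_iff, measure_eq_zero_iff_ae_notMem]
    filter_upwards [ae_marginalCdf_mem hcont (e l)] with t ht h3
    exact absurd ((h3 l).trans hl) (not_le.2 ht.1)

/-- The joint distribution function at a sample point. -/
theorem measureReal_forall_lt {d : ℕ} (e : Fin d ↪ Fin m) {x : Fin m → ℝ}
    (hx : ∀ l, marginalCdf μ (e l) (x (e l)) ∈ Ioo (0 : ℝ) 1) :
    μ.real {t | ∀ l, t (e l) < x (e l)}
      = generatorInverse φ (∑ l, φ (marginalCdf μ (e l) (x (e l)))) := by
  rw [← measureReal_forall_marginalCdf_le_comp hcont hC hφ hCφ e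
    fun l => ⟨(hx l).1, (hx l).2.le⟩]
  refine measureReal_congr ?_
  filter_upwards [ae_all_iff.2 fun l => ae_lt_iff_marginalCdf_le hcont (e l) (hx l)] with t ht
  exact propext (forall_congr' ht)

/-- The law of the inverse radius of an Archimedean vector: its Williamson transform is the
generator inverse, and its Kendall distribution is the distribution of the joint distribution
function at a random point. -/
theorem exists_radial_law {q : ℕ} (hq : 0 < q) (e : Fin (q + 1) ↪ Fin m) :
    ∃ π : Measure ℝ, IsProbabilityMeasure π ∧ (∀ᵐ z ∂π, 0 < z) ∧
      (∀ y, 0 < y → williamsonCdf q π y = generatorInverse φ (ENNReal.ofReal y⁻¹)) ∧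
      ∀ s, kendallCdf q π s = μ.real {x | μ.real {t | ∀ l, t (e l) < x (e l)} ≤ s} := by
  set Y : (Fin m → ℝ) → Fin (q + 1) → ℝ :=
    fun t l => (φ (marginalCdf μ (e l) (t (e l)))).toReal with hYdef
  have hY : Measurable Y := by
    refine measurable_pi_lambda _ fun l => ENNReal.measurable_toReal.comp ?_
    exact (hφ.continuousOn.comp_continuous ((hcont (e l)).comp (continuous_apply (e l)))
      fun t => marginalCdf_mem _ _).measurable
  have hUmem := ae_all_iff.2 fun j => ae_marginalCdf_mem hcont j
  have hYpos : ∀ᵐ t ∂μ, 0 < ∑ l, Y t l := by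
    filter_upwards [hUmem] with t ht
    refine Finset.sum_pos (fun l _ => ENNReal.toReal_pos ?_ ?_) Finset.univ_nonempty
    · exact (hφ.pos_of_lt_one ⟨(ht _).1.le, (ht _).2⟩).ne'
    · exact hφ.ne_top ⟨(ht _).1, (ht _).2.le⟩
  have hZ : Measurable fun t => (∑ l, Y t l)⁻¹ :=
    (Finset.measurable_fun_sum _ fun l _ => (measurable_pi_apply l).comp hY).inv
  have hZpos : ∀ᵐ z ∂(μ.map fun t => (∑ l, Y t l)⁻¹), 0 < z :=
    (ae_map_iff hZ.aemeasurable measurableSet_Ioi).2 (hYpos.mono fun t ht => inv_pos.2 ht)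
  have hprob := Measure.isProbabilityMeasure_map (μ := μ) hZ.aemeasurable
  have hW : ∀ y, 0 < y → williamsonCdf q (μ.map fun t => (∑ l, Y t l)⁻¹) y
      = generatorInverse φ (ENNReal.ofReal y⁻¹) := by
    intro y hy
    rw [williamsonCdf_eq _ _ hy, integral_map hZ.aemeasurable
      (by fun_prop : Continuous fun z : ℝ => max 0 (1 - z / y) ^ q).aestronglyMeasurable,
      survival_eq_integral hq hY (fun t l => ENNReal.toReal_nonneg)
        (g := fun s => generatorInverse φ (ENNReal.ofReal s))
        (fun y hy => measureReal_forall_le_toReal hcont hC hφ hCφ e hy) hYpos (inv_pos.2 hy)]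
    congr 1
    ext t
    congr 3
    rw [div_eq_mul_inv, div_eq_mul_inv, mul_comm]
  refine ⟨_, hprob, hZpos, hW, fun s => ?_⟩
  have hF := isWilliamsonCdf_williamsonCdf q hq _ hZpos
  rw [kendallCdf, map_measureReal_apply hZ (measurableSet_le hF.cont.measurable measurable_const)]
  refine measureReal_congr ?_
  filter_upwards [hUmem, hYpos] with t ht htY
  have h1 : williamsonCdf q (μ.map fun t => (∑ l, Y t l)⁻¹) (∑ l, Y t l)⁻¹
      = μ.real {t' | ∀ l, t' (e l) < t (e l)} := by
    rw [hW _ (inv_pos.2 htY), inv_inv, measureReal_forall_lt hcont hC hφ hCφ e fun l => ht _,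
      ENNReal.ofReal_sum_of_nonneg fun l _ => ENNReal.toReal_nonneg]
    congr 1
    refine Finset.sum_congr rfl fun l _ => ENNReal.ofReal_toReal ?_
    exact hφ.ne_top ⟨(ht _).1, (ht _).2.le⟩
  change (williamsonCdf q _ (∑ l, Y t l)⁻¹ ≤ s) = (_ ≤ s)
  rw [h1]

end Archimedean

/-- The diagonal quantile function in terms of the Williamson transform of the inverse radius,
written in the scale-invariant form that the estimator shares. -/
theorem IsArchimedeanGenerator.diagonalQuantile_eq_williamsonCdf {φ : ℝ → ℝ≥0∞}
    (hφ : IsArchimedeanGenerator φ) {m : ℕ} (hm : 0 < m) {C : (Fin m → ℝ) → ℝ}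
    (hC : ∀ u ∈ Icc (0 : Fin m → ℝ) 1, C u = generatorInverse φ (∑ j, φ (u j)))
    {F : ℝ → ℝ} (hF : IsWilliamsonCdf F)
    (hFφ : ∀ y, 0 < y → F y = generatorInverse φ (ENNReal.ofReal y⁻¹))
    {v : ℝ} (hv : v ∈ Ioo (0 : ℝ) 1) :
    diagonalQuantile C v = F (m * upperInv F v) := by
  have hv' : v ∈ Icc (0 : ℝ) 1 := ⟨hv.1.le, hv.2.le⟩
  have h0 : 0 < (φ v).toReal := ENNReal.toReal_pos (hφ.pos_of_lt_one ⟨hv.1.le, hv.2⟩).ne'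
    (hφ.ne_top ⟨hv.1, hv.2.le⟩)
  have hm' : (0 : ℝ) < m := by exact_mod_cast hm
  have h1 : upperInv F v = (φ v).toReal⁻¹ := by
    have hset : {y | F y ≤ v} = Iic (φ v).toReal⁻¹ := by
      ext y
      rw [mem_ofPred_eq, mem_Iic]
      rcases le_or_gt y 0 with hy | hy
      · rw [hF.zero_of_nonpos y hy]
        exact ⟨fun _ => hy.trans (inv_pos.2 h0).le, fun _ => hv.1.le⟩
      · rw [hFφ y hy, hφ.generatorInverse_le_iff hv',
          ENNReal.le_ofReal_iff_toReal_le (hφ.ne_top ⟨hv.1, hv.2.le⟩) (inv_pos.2 hy).le,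
          le_inv_comm₀ h0 hy]
    rw [upperInv, hset, csSup_Iic]
  rw [hφ.diagonalQuantile_eq hm hC ⟨hv.1, hv.2.le⟩, h1, hFφ _ (by positivity)]
  congr 1
  rw [mul_inv, inv_inv, mul_comm, ← div_eq_mul_inv, ENNReal.ofReal_div_of_pos hm',
    ENNReal.ofReal_toReal (hφ.ne_top ⟨hv.1, hv.2.le⟩), ENNReal.ofReal_natCast]

/-! ### Second moments of the counts -/

section SecondMoment

variable {Ω E : Type*} [MeasurableSpace Ω] [MeasurableSpace E] {P : Measure Ω}
  [IsProbabilityMeasure P] {μ : Measure E} [IsProbabilityMeasure μ] {ι : Type*}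
  {X : ι → Ω → E} (hX : ∀ i, Measurable (X i)) (hindep : iIndepFun X P)
  (hlaw : ∀ i, P.map (X i) = μ)
include hX hindep hlaw

omit [IsProbabilityMeasure μ] in
/-- The variance of a sum of independent `[0, 1]`-valued variables is at most the sum of the means.
-/
theorem integral_sum_sub_sq_le {b : E → ℝ} (hb : Measurable b) (h0 : ∀ t, 0 ≤ b t)
    (h1 : ∀ t, b t ≤ 1) (S : Finset ι) :
    Integrable (fun ω => (∑ k ∈ S, (b (X k ω) - ∫ t, b t ∂μ)) ^ 2) P ∧
      ∫ ω, (∑ k ∈ S, (b (X k ω) - ∫ t, b t ∂μ)) ^ 2 ∂P ≤ S.card * ∫ t, b t ∂μ := by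
  have hbd : ∀ t, ‖b t‖ ≤ 1 := fun t => by
    rw [Real.norm_eq_abs, abs_of_nonneg (h0 t)]
    exact h1 t
  have hmem : ∀ k, MemLp (fun ω => b (X k ω)) 2 P := fun k =>
    MemLp.of_bound (hb.comp (hX k)).aestronglyMeasurable 1 (Eventually.of_forall fun ω => hbd _)
  have hint : ∀ k, ∫ ω, b (X k ω) ∂P = ∫ t, b t ∂μ := fun k => by
    rw [← hlaw k, integral_map (hX k).aemeasurable hb.aestronglyMeasurable]
  refine ⟨(memLp_finsetSum S fun k _ => (hmem k).sub (memLp_const _)).integrable_sq, ?_⟩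
  have hvar := IndepFun.variance_sum (s := S) (X := fun k ω => b (X k ω)) (μ := P)
    (fun k _ => hmem k) fun k _ l _ hkl => (hindep.indepFun hkl).comp hb hb
  have hae : AEMeasurable (∑ k ∈ S, fun ω => b (X k ω)) P :=
    Finset.aemeasurable_sum _ fun k _ => (hb.comp (hX k)).aemeasurable
  rw [variance_eq_integral hae] at hvar
  have h2 : ∫ ω, (∑ k ∈ S, fun ω => b (X k ω)) ω ∂P = ∑ k ∈ S, ∫ t, b t ∂μ := by
    simp only [Finset.sum_apply]
    rw [integral_finsetSum _ fun k _ => (hmem k).integrable (by norm_num)]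
    exact Finset.sum_congr rfl fun k _ => hint k
  rw [h2] at hvar
  simp only [Finset.sum_apply, ← Finset.sum_sub_distrib] at hvar
  rw [hvar, ← nsmul_eq_mul]
  refine Finset.sum_le_card_nsmul _ _ _ fun k _ => ?_
  refine (variance_le_expectation_sq (hmem k).aestronglyMeasurable).trans ?_
  rw [← hint k]
  refine integral_mono_of_nonneg (Eventually.of_forall fun ω => sq_nonneg _)
    ((hmem k).integrable (by norm_num)) (Eventually.of_forall fun ω => ?_)
  simp only [Pi.pow_apply]
  nlinarith [h0 (X k ω), h1 (X k ω)]

/-- Given `X i`, the summands `a (X k) (X i)`, `k ≠ i`, are independent with mean `H (X i)`, so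
that the conditional variance of their sum is at most `n H (X i)`. -/
theorem integral_indicator_mul_sq_le {a : E → E → ℝ} (ha : Measurable (Function.uncurry a))
    (h0 : ∀ t x, 0 ≤ a t x) (h1 : ∀ t x, a t x ≤ 1) {H : E → ℝ}
    (hH : ∀ x, H x = ∫ t, a t x ∂μ) (s : ℝ) (S : Finset ι) {i : ι} (hi : i ∉ S) :
    Integrable (fun ω => {x | H x ≤ s}.indicator 1 (X i ω) *
        (∑ k ∈ S, (a (X k ω) (X i ω) - H (X i ω))) ^ 2) P ∧
      ∫ ω, {x | H x ≤ s}.indicator 1 (X i ω) *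
        (∑ k ∈ S, (a (X k ω) (X i ω) - H (X i ω))) ^ 2 ∂P
      ≤ S.card * (s * μ.real {x | H x ≤ s}) := by
  classical
  have hHm : Measurable H := by
    have : H = fun x => ∫ t, a t x ∂μ := funext hH
    rw [this]
    exact (ha.stronglyMeasurable.comp_measurable measurable_swap).integral_prod_right'.measurable
  have hH0 : ∀ x, 0 ≤ H x := fun x => by
    rw [hH]
    exact integral_nonneg fun t => h0 t x
  have hax : ∀ x, Measurable fun t => a t x := fun x => ha.comp measurable_prodMk_right
  have hH1 : ∀ x, H x ≤ 1 := fun x => by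
    rw [hH]
    refine (integral_mono_of_nonneg (Eventually.of_forall fun t => h0 t x)
      (integrable_const 1) (Eventually.of_forall fun t => h1 t x)).trans ?_
    simp
  have hset : MeasurableSet {x | H x ≤ s} := measurableSet_le hHm measurable_const
  set V : Ω → (S → E) := fun ω k => X k ω with hVdef
  have hV : Measurable V := measurable_pi_lambda _ fun k => hX k
  have hindep2 : IndepFun (X i) V P := by
    have := hindep.indepFun_finset {i} S (Finset.disjoint_singleton_left.2 hi) fun k => hX k
    exact this.comp (φ := fun w : ({i} : Finset ι) → E => w ⟨i, Finset.mem_singleton_self i⟩)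
      (ψ := id) (measurable_pi_apply _) measurable_id
  have hprobV := Measure.isProbabilityMeasure_map (μ := P) hV.aemeasurable
  have hmap : P.map (fun ω => (X i ω, V ω)) = μ.prod (P.map V) := by
    rw [(indepFun_iff_map_prod_eq_prod_map_map (hX i).aemeasurable hV.aemeasurable).1 hindep2,
      hlaw i]
  set f : E × (S → E) → ℝ := fun p => {x | H x ≤ s}.indicator 1 p.1 *
    (∑ k : S, (a (p.2 k) p.1 - H p.1)) ^ 2 with hf
  have hfm : Measurable f := by
    refine ((measurable_one.indicator hset).comp measurable_fst).mul
      (Measurable.pow_const (Finset.measurable_fun_sum _ fun k _ => ?_) 2)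
    have hk : Measurable fun p : E × (S → E) => (p.2 k, p.1) :=
      ((measurable_pi_apply k).comp measurable_snd).prodMk measurable_fst
    exact (ha.comp hk).sub (hHm.comp measurable_fst)
  have hfbd : ∀ p, ‖f p‖ ≤ (S.card : ℝ) ^ 2 := by
    intro p
    have h3 : |∑ k : S, (a (p.2 k) p.1 - H p.1)| ≤ S.card := by
      refine (Finset.abs_sum_le_sum_abs _ _).trans ?_
      refine (Finset.sum_le_card_nsmul _ _ 1 fun k _ => ?_).trans (by simp)
      rw [abs_le]
      constructor <;> linarith [h0 (p.2 k) p.1, h1 (p.2 k) p.1, hH0 p.1, hH1 p.1]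
    have h4 : {x | H x ≤ s}.indicator (1 : E → ℝ) p.1 ≤ 1 :=
      indicator_le_self' (fun _ _ => zero_le_one) p.1
    have h5 : 0 ≤ {x | H x ≤ s}.indicator (1 : E → ℝ) p.1 :=
      indicator_nonneg (fun _ _ => zero_le_one) p.1
    rw [hf, Real.norm_eq_abs, abs_mul, abs_of_nonneg h5, abs_pow]
    calc _ ≤ 1 * |∑ k : S, (a (p.2 k) p.1 - H p.1)| ^ 2 := by gcongr
      _ ≤ 1 * (S.card : ℝ) ^ 2 := by gcongr
      _ = _ := one_mul _
  have hL : ∫ ω, {x | H x ≤ s}.indicator 1 (X i ω) *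
      (∑ k ∈ S, (a (X k ω) (X i ω) - H (X i ω))) ^ 2 ∂P = ∫ p, f p ∂(μ.prod (P.map V)) := by
    rw [← hmap, integral_map ((hX i).prodMk hV).aemeasurable hfm.aestronglyMeasurable]
    congr 1
    ext ω
    simp only [hf, hVdef]
    rw [Finset.sum_coe_sort S fun k => a (X k ω) (X i ω) - H (X i ω)]
  have hfint : Integrable f (μ.prod (P.map V)) :=
    Integrable.of_bound hfm.aestronglyMeasurable _ (Eventually.of_forall hfbd)
  refine ⟨?_, ?_⟩
  · have h3 := hfint
    rw [← hmap] at h3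
    refine (h3.comp_measurable ((hX i).prodMk hV)).congr (Eventually.of_forall fun ω => ?_)
    simp only [Function.comp, hf, hVdef]
    rw [Finset.sum_coe_sort S fun k => a (X k ω) (X i ω) - H (X i ω)]
  rw [hL, integral_prod _ hfint]
  have hinner : ∀ x, ∫ z, f (x, z) ∂(P.map V)
      ≤ {x | H x ≤ s}.indicator (fun _ => S.card * s) x := by
    intro x
    by_cases hx : x ∈ {x | H x ≤ s}
    · have hxs : H x ≤ s := hx
      have hfx : Measurable fun z => f (x, z) := hfm.comp measurable_prodMk_left
      rw [indicator_of_mem hx, integral_map hV.aemeasurable hfx.aestronglyMeasurable]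
      have h3 := integral_sum_sub_sq_le hX hindep hlaw (hax x) (fun t => h0 t x)
        (fun t => h1 t x) S |>.2
      rw [← hH x] at h3
      have h4 : ∀ ω, f (x, V ω) = (∑ k ∈ S, (a (X k ω) x - H x)) ^ 2 := by
        intro ω
        simp only [hf, hVdef]
        rw [indicator_of_mem hx, Pi.one_apply, one_mul,
          Finset.sum_coe_sort S fun k => a (X k ω) x - H x]
      simp only [h4]
      exact h3.trans (by gcongr)
    · rw [indicator_of_notMem hx]
      refine le_of_eq ?_
      simp only [hf]
      rw [indicator_of_notMem hx]
      simp
  calc ∫ x, ∫ z, f (x, z) ∂(P.map V) ∂μ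
      ≤ ∫ x, {x | H x ≤ s}.indicator (fun _ => S.card * s) x ∂μ :=
        integral_mono hfint.integral_prod_left ((integrable_const _).indicator hset) hinner
    _ = S.card * (s * μ.real {x | H x ≤ s}) := by
        rw [integral_indicator_const _ hset, smul_eq_mul]
        ring

end SecondMoment

/-! ### Deterministic comparison of empirical distributions -/

theorem card_filter_le_one_mul {n : ℕ} (p : Fin n → Prop) [DecidablePred p] :
    ((Finset.univ.filter p).card : ℝ) ≤ n := by
  have := (Finset.card_filter_le (Finset.univ : Finset (Fin n)) p)
  rw [Finset.card_univ, Fintype.card_fin] at this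
  exact_mod_cast this

/-- Pseudo-observations `W` that are close to variables `V` for most indices, whose empirical
distribution is close to `K` on a grid, have empirical distribution close to `K`. -/
theorem levyClose_of_grid {n : ℕ} (hn : 0 < n) {V W : Fin n → ℝ} {K : ℝ → ℝ} (hK : Monotone K)
    (hK0 : ∀ t, 0 ≤ K t) (hKneg : ∀ t < 0, K t = 0) (hK1 : ∀ t, 1 ≤ t → K t = 1)
    (hW0 : ∀ i, 0 ≤ W i) (hW1 : ∀ i, W i ≤ 1) {η : ℝ} (hη : 0 < η) {N : ℕ} (hN : 1 / η + 2 ≤ N)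
    (hbad : ((Finset.univ.filter fun i => η < |W i - V i|).card : ℝ) ≤ n * η)
    (hgrid : ∀ j ∈ Finset.range N,
      |((Finset.univ.filter fun i => V i ≤ j * η).card : ℝ) - n * K (j * η)| ≤ n * η) :
    LevyClose (3 * η) (fun t => ((Finset.univ.filter fun i => W i ≤ t).card : ℝ) / n) K := by
  have hn' : (0 : ℝ) < n := by exact_mod_cast hn
  have hK1' : ∀ t, K t ≤ 1 := fun t => by
    rcases le_total 1 t with h | h
    · exact (hK1 t h).le
    · exact (hK h).trans (hK1 1 le_rfl).le
  intro t
  simp only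
  rcases lt_or_ge t 0 with ht0 | ht0
  · have h1 : (Finset.univ.filter fun i => W i ≤ t) = ∅ := by
      rw [Finset.filter_eq_empty_iff]
      exact fun i _ => not_le.2 (ht0.trans_le (hW0 i))
    rw [h1, hKneg t ht0]
    constructor
    · simp only [Finset.card_empty, Nat.cast_zero, zero_div]
      linarith [hK0 (t + 3 * η)]
    · positivity
  rcases le_or_gt 1 t with ht1 | ht1
  · constructor
    · rw [hK1 _ (by linarith)]
      have := (div_le_one hn').2 (card_filter_le_one_mul fun i => W i ≤ t)
      linarith
    · have h1 : (Finset.univ.filter fun i => W i ≤ t + 3 * η) = Finset.univ := by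
        rw [Finset.filter_eq_self]
        exact fun i _ => (hW1 i).trans (by linarith)
      rw [h1, Finset.card_univ, Fintype.card_fin, div_self hn'.ne']
      linarith [hK1' t]
  -- grid points in `[t, t + η]` and `[t + η, t + 2 η]`
  set j := ⌈t / η⌉₊ with hj
  have hj1 : t ≤ j * η := by
    rw [← div_le_iff₀ hη]
    exact Nat.le_ceil _
  have hj2 : j * η < t + η := by
    have := Nat.ceil_lt_add_one (div_nonneg ht0 hη.le)
    rw [← hj] at this
    calc (j : ℝ) * η < (t / η + 1) * η := by gcongr
      _ = t + η := by field_simp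
  have hjN : ((j + 1 : ℕ) : ℝ) < N := by
    have h1 := Nat.ceil_lt_add_one (div_nonneg ht0 hη.le)
    have h2 : t / η < 1 / η := by gcongr
    push_cast
    linarith
  have hjN' : j + 1 < N := by exact_mod_cast hjN
  have hg1 := abs_le.1 (hgrid j (Finset.mem_range.2 (by omega)))
  have hg2 := abs_le.1 (hgrid (j + 1) (Finset.mem_range.2 hjN'))
  constructor
  · have h1 : (Finset.univ.filter fun i => W i ≤ t)
        ⊆ (Finset.univ.filter fun i => V i ≤ (j + 1 : ℕ) * η) ∪
          (Finset.univ.filter fun i => η < |W i - V i|) := by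
      intro i hi
      simp only [Finset.mem_union, Finset.mem_filter_univ] at hi ⊢
      by_contra! h
      have := (abs_le.1 h.2).1
      push_cast at h
      nlinarith [h.1]
    have h2 : ((Finset.univ.filter fun i => W i ≤ t).card : ℝ)
        ≤ (Finset.univ.filter fun i => V i ≤ (j + 1 : ℕ) * η).card +
          (Finset.univ.filter fun i => η < |W i - V i|).card := by
      exact_mod_cast (Finset.card_le_card h1).trans (Finset.card_union_le _ _)
    have h3 : K ((j + 1 : ℕ) * η) ≤ K (t + 3 * η) := hK (by push_cast; nlinarith)
    rw [div_le_iff₀ hn']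
    nlinarith [hg2.2]
  · have h1 : (Finset.univ.filter fun i => V i ≤ j * η)
        ⊆ (Finset.univ.filter fun i => W i ≤ t + 3 * η) ∪
          (Finset.univ.filter fun i => η < |W i - V i|) := by
      intro i hi
      simp only [Finset.mem_union, Finset.mem_filter_univ] at hi ⊢
      by_contra! h
      have := (abs_le.1 h.2).2
      linarith [h.1]
    have h2 : ((Finset.univ.filter fun i => V i ≤ j * η).card : ℝ)
        ≤ (Finset.univ.filter fun i => W i ≤ t + 3 * η).card +
          (Finset.univ.filter fun i => η < |W i - V i|).card := by
      exact_mod_cast (Finset.card_le_card h1).trans (Finset.card_union_le _ _)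
    have h3 : K t ≤ K (j * η) := hK hj1
    rw [← sub_le_iff_le_add, le_div_iff₀ hn']
    nlinarith [hg1.1]

/-- Lower bounds for the numbers of small counts along a dyadic sequence give a lower bound for the
empirical distribution near `0`. -/
theorem kendall_le_of_dyadic {n : ℕ} (hn : 0 < n) (c : Fin n → ℕ) {K : ℝ → ℝ} (hK : Monotone K)
    {M s₀ : ℝ} (hM : 2 ≤ M) (hs₀ : 1 / (M * n) ≤ s₀)
    (h : ∀ j : ℕ, 2 ^ j / (M * n) ≤ s₀ →
      n * K (2 ^ j / (M * n)) / 2 ≤ (Finset.univ.filter fun i => c i < 2 ^ j).card) :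
    ∀ t ∈ Icc 0 s₀, K (t / (2 * M)) ≤
      2 * (((Finset.univ.filter fun i => (c i : ℝ) / ((n : ℝ) + 1) ≤ t).card : ℝ) / n) := by
  have hn' : (0 : ℝ) < n := by exact_mod_cast hn
  have hn1 : (1 : ℝ) ≤ n := by exact_mod_cast hn
  have hM0 : 0 < M := by linarith
  rintro t ⟨ht0, ht⟩
  suffices ∃ j : ℕ, 2 ^ j / (M * n) ≤ s₀ ∧ t / (2 * M) ≤ 2 ^ j / (M * n) ∧
      ∀ i, c i < 2 ^ j → (c i : ℝ) / ((n : ℝ) + 1) ≤ t by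
    obtain ⟨j, h1, h2, h3⟩ := this
    have h4 : ((Finset.univ.filter fun i => c i < 2 ^ j).card : ℝ)
        ≤ (Finset.univ.filter fun i => (c i : ℝ) / ((n : ℝ) + 1) ≤ t).card := by
      refine Nat.cast_le.2 (Finset.card_le_card fun i hi => ?_)
      simp only [Finset.mem_filter_univ] at hi ⊢
      exact h3 i hi
    have h5 := (h j h1).trans h4
    have h6 := hK h2
    rw [← mul_div_assoc, le_div_iff₀ hn']
    nlinarith
  rcases lt_or_ge (t * (n + 1)) 1 with h1 | h1
  · refine ⟨0, by rwa [pow_zero], ?_, fun i hi => ?_⟩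
    · rw [pow_zero, div_le_div_iff₀ (by positivity) (by positivity)]
      nlinarith
    · rw [pow_zero, Nat.lt_one_iff] at hi
      rw [hi, Nat.cast_zero, zero_div]
      exact ht0
  · obtain ⟨j, hj1, hj2⟩ := exists_nat_pow_near h1 (one_lt_two : (1 : ℝ) < 2)
    refine ⟨j, ?_, ?_, fun i hi => ?_⟩
    · refine le_trans ?_ ht
      rw [div_le_iff₀ (by positivity)]
      nlinarith [mul_nonneg ht0 hn'.le]
    · rw [div_le_div_iff₀ (by positivity) (by positivity)]
      rw [pow_succ] at hj2
      nlinarith [mul_nonneg ht0 hn'.le]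
    · rw [div_le_iff₀ (by positivity)]
      have : (c i : ℝ) ≤ 2 ^ j := by exact_mod_cast hi.le
      exact this.trans hj1

/-- At least half of the expected number of indices have a count below `2 ^ j`, if few of the
indices with `V i ≤ 2 ^ j / (M n)` have a count far from `(n - 1) V i`. -/
theorem half_le_card_lt_two_pow {n : ℕ} (hn : 0 < n) (c : Fin n → ℕ) {V : Fin n → ℝ}
    {M k : ℝ} (hM : 2 ≤ M) (j : ℕ) (hV : ∀ i, 0 ≤ V i)
    (h1 : ((Finset.univ.filter fun i => V i ≤ 2 ^ j / (M * n) ∧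
      2 ^ j / 2 ≤ |(c i : ℝ) - (n - 1) * V i|).card : ℝ) ≤ n * k / 4)
    (h2 : |((Finset.univ.filter fun i => V i ≤ 2 ^ j / (M * n)).card : ℝ) - n * k| ≤ n * k / 4) :
    n * k / 2 ≤ (Finset.univ.filter fun i => c i < 2 ^ j).card := by
  have hn' : (0 : ℝ) < n := by exact_mod_cast hn
  have hn1 : (1 : ℝ) ≤ n := by exact_mod_cast hn
  have h3 : (Finset.univ.filter fun i => V i ≤ 2 ^ j / (M * n))
      ⊆ (Finset.univ.filter fun i => V i ≤ 2 ^ j / (M * n) ∧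
        2 ^ j / 2 ≤ |(c i : ℝ) - (n - 1) * V i|) ∪
        (Finset.univ.filter fun i => c i < 2 ^ j) := by
    intro i hi
    simp only [Finset.mem_union, Finset.mem_filter_univ] at hi ⊢
    by_contra! h
    have h4 := h.1 hi
    have h5 : (2 : ℝ) ^ j ≤ c i := by exact_mod_cast h.2
    have h6 := (abs_lt.1 h4).2
    rw [le_div_iff₀ (by positivity)] at hi
    have h7 : 0 ≤ V i * n := mul_nonneg (hV i) hn'.le
    nlinarith [hV i]
  have h4 : ((Finset.univ.filter fun i => V i ≤ 2 ^ j / (M * n)).card : ℝ)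
      ≤ (Finset.univ.filter fun i => V i ≤ 2 ^ j / (M * n) ∧
        2 ^ j / 2 ≤ |(c i : ℝ) - (n - 1) * V i|).card +
        (Finset.univ.filter fun i => c i < 2 ^ j).card := by
    exact_mod_cast (Finset.card_le_card h3).trans (Finset.card_union_le _ _)
  linarith [(abs_le.1 h2).1]

/-! ### Concentration of the empirical Kendall distribution -/

section Concentration

variable {Ω E : Type*} [MeasurableSpace Ω] [MeasurableSpace E] {P : Measure Ω}
  [IsProbabilityMeasure P] {μ : Measure E} [IsProbabilityMeasure μ] {n : ℕ}
  {X : Fin n → Ω → E} (hX : ∀ i, Measurable (X i)) (hindep : iIndepFun X P)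
  (hlaw : ∀ i, P.map (X i) = μ)
include hX hindep hlaw

omit [IsProbabilityMeasure μ] in
/-- Chebyshev bound for the empirical distribution function of `H (X i)`. -/
theorem measureReal_card_sub_ge {H : E → ℝ} (hH : Measurable H) (s : ℝ) {γ : ℝ} (hγ : 0 < γ) :
    P.real {ω | γ ≤ |((Finset.univ.filter fun i => H (X i ω) ≤ s).card : ℝ)
      - n * μ.real {x | H x ≤ s}|} ≤ n * μ.real {x | H x ≤ s} / γ ^ 2 := by
  have hset : MeasurableSet {x | H x ≤ s} := measurableSet_le hH measurable_const
  obtain ⟨h1, h2⟩ := integral_sum_sub_sq_le hX hindep hlaw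
    (b := {x | H x ≤ s}.indicator fun _ => 1) (measurable_const.indicator hset)
    (fun t => indicator_nonneg (fun _ _ => zero_le_one) t)
    (fun t => indicator_le_self' (fun _ _ => zero_le_one) t) Finset.univ
  rw [integral_indicator_const _ hset, smul_eq_mul, mul_one] at h1 h2
  rw [Finset.card_univ, Fintype.card_fin] at h2
  have h3 : ∀ ω, ∑ k, ({x | H x ≤ s}.indicator (fun _ => (1 : ℝ)) (X k ω) - μ.real {x | H x ≤ s})
      = ((Finset.univ.filter fun i => H (X i ω) ≤ s).card : ℝ) - n * μ.real {x | H x ≤ s} := by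
    intro ω
    rw [Finset.sum_sub_distrib, Finset.sum_const, Finset.card_univ, Fintype.card_fin,
      nsmul_eq_mul, Finset.card_filter, Nat.cast_sum]
    congr 1
    refine Finset.sum_congr rfl fun i _ => ?_
    by_cases h : H (X i ω) ≤ s
    · rw [indicator_of_mem (show X i ω ∈ {x | H x ≤ s} from h), if_pos h, Nat.cast_one]
    · rw [indicator_of_notMem (show X i ω ∉ {x | H x ≤ s} from h), if_neg h, Nat.cast_zero]
  simp only [h3] at h1 h2
  have h4 := mul_meas_ge_le_integral_of_nonneg (Eventually.of_forall fun ω => sq_nonneg _) h1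
    (γ ^ 2)
  rw [le_div_iff₀ (by positivity), mul_comm]
  refine le_trans ?_ (h4.trans h2)
  refine mul_le_mul_of_nonneg_left (measureReal_mono fun ω hω => ?_) (by positivity)
  have h5 : γ ≤ |((Finset.univ.filter fun i => H (X i ω) ≤ s).card : ℝ)
      - n * μ.real {x | H x ≤ s}| := hω
  rw [mem_ofPred_eq, ← sq_abs (_ - _)]
  gcongr

variable {A : Set (E × E)} (hA : MeasurableSet A) (hirr : ∀ x, (x, x) ∉ A)
  {H : E → ℝ} (hH : ∀ x, H x = μ.real {t | (t, x) ∈ A})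
  {c : Ω → Fin n → ℕ} (hc : ∀ ω i, (c ω i : ℝ) = ∑ k, A.indicator (fun _ => 1) (X k ω, X i ω))

include hA hH in
omit [IsProbabilityMeasure P] [IsProbabilityMeasure μ] hX hindep hlaw in
theorem measurable_of_eq_measureReal [SFinite μ] : Measurable H := by
  have : H = fun x => μ.real {t | (t, x) ∈ A} := funext hH
  rw [this]
  exact (measurable_measure_prodMk_right hA).ennreal_toReal

include hA hirr hH hc in
/-- Few indices with `H (X i) ≤ s` have a count far from its conditional mean `(n - 1) H (X i)`:
Markov's inequality, applied to the second moments of `integral_indicator_mul_sq_le`. -/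
theorem measureReal_card_count_sub_ge {s β θ : ℝ} (hs : 0 ≤ s) (hβ : 0 < β) (hθ : 0 < θ) :
    P.real {ω | β < ((Finset.univ.filter fun i => H (X i ω) ≤ s ∧
      θ ≤ |(c ω i : ℝ) - (n - 1) * H (X i ω)|).card : ℝ)}
      ≤ n ^ 2 * (s * μ.real {x | H x ≤ s}) / (β * θ ^ 2) := by
  have hax : ∀ x, H x = ∫ t, A.indicator (fun _ => (1 : ℝ)) (t, x) ∂μ := by
    intro x
    have h1 : MeasurableSet {t | (t, x) ∈ A} := measurable_prodMk_right hA
    have h2 : (fun t => A.indicator (fun _ => (1 : ℝ)) (t, x))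
        = {t | (t, x) ∈ A}.indicator fun _ => 1 := rfl
    rw [hH, h2, integral_indicator_const _ h1, smul_eq_mul, mul_one]
  have h1 := fun i => integral_indicator_mul_sq_le hX hindep hlaw
    (a := fun t x => A.indicator (fun _ => 1) (t, x)) (measurable_const.indicator hA)
    (fun t x => indicator_nonneg (fun _ _ => zero_le_one) _)
    (fun t x => indicator_le_self' (fun _ _ => zero_le_one) _) hax s _
    (Finset.notMem_erase i Finset.univ)
  have h2 : ∀ ω i, ∑ k ∈ Finset.univ.erase i, (A.indicator (fun _ => (1 : ℝ)) (X k ω, X i ω)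
      - H (X i ω)) = (c ω i : ℝ) - (n - 1) * H (X i ω) := by
    intro ω i
    have h3 : A.indicator (fun _ => (1 : ℝ)) (X i ω, X i ω) = 0 := indicator_of_notMem (hirr _) _
    rw [Finset.sum_sub_distrib, Finset.sum_const, Finset.card_erase_of_mem (Finset.mem_univ i),
      Finset.card_univ, Fintype.card_fin, nsmul_eq_mul, Nat.cast_sub i.pos, Nat.cast_one, hc,
      ← Finset.add_sum_erase _ _ (Finset.mem_univ i), h3, zero_add]
  simp only [h2] at h1
  set Z : Ω → ℝ := fun ω => ∑ i, {x | H x ≤ s}.indicator 1 (X i ω) *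
    ((c ω i : ℝ) - (n - 1) * H (X i ω)) ^ 2 with hZ
  have hZint : Integrable Z P := integrable_finsetSum _ fun i _ => (h1 i).1
  have hind0 : ∀ x, 0 ≤ {x | H x ≤ s}.indicator (1 : E → ℝ) x := fun x =>
    indicator_nonneg (fun _ _ => zero_le_one) x
  have hZ0 : ∀ ω, 0 ≤ Z ω := fun ω =>
    Finset.sum_nonneg fun i _ => mul_nonneg (hind0 _) (sq_nonneg _)
  have hZle : ∫ ω, Z ω ∂P ≤ n ^ 2 * (s * μ.real {x | H x ≤ s}) := by
    rw [hZ, integral_finsetSum _ fun i _ => (h1 i).1]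
    refine (Finset.sum_le_card_nsmul _ _ (n * (s * μ.real {x | H x ≤ s})) fun i _ => ?_).trans ?_
    · refine (h1 i).2.trans ?_
      gcongr
      exact (Finset.card_le_univ _).trans (Fintype.card_fin n).le
    · rw [Finset.card_univ, Fintype.card_fin, nsmul_eq_mul]
      exact le_of_eq (by ring)
  have h4 := mul_meas_ge_le_integral_of_nonneg (Eventually.of_forall hZ0) hZint (β * θ ^ 2)
  rw [le_div_iff₀ (by positivity), mul_comm]
  refine le_trans ?_ (h4.trans hZle)
  refine mul_le_mul_of_nonneg_left (measureReal_mono fun ω hω => ?_) (by positivity)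
  have h5 : β < ((Finset.univ.filter fun i => H (X i ω) ≤ s ∧
      θ ≤ |(c ω i : ℝ) - (n - 1) * H (X i ω)|).card : ℝ) := hω
  calc β * θ ^ 2 ≤ ((Finset.univ.filter fun i => H (X i ω) ≤ s ∧
        θ ≤ |(c ω i : ℝ) - (n - 1) * H (X i ω)|).card : ℝ) * θ ^ 2 := by gcongr
    _ = ∑ i ∈ Finset.univ.filter fun i => H (X i ω) ≤ s ∧
        θ ≤ |(c ω i : ℝ) - (n - 1) * H (X i ω)|, θ ^ 2 := by
        rw [Finset.sum_const, nsmul_eq_mul]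
    _ ≤ ∑ i ∈ Finset.univ.filter fun i => H (X i ω) ≤ s ∧
        θ ≤ |(c ω i : ℝ) - (n - 1) * H (X i ω)|, {x | H x ≤ s}.indicator 1 (X i ω) *
          ((c ω i : ℝ) - (n - 1) * H (X i ω)) ^ 2 := by
        refine Finset.sum_le_sum fun i hi => ?_
        rw [Finset.mem_filter_univ] at hi
        rw [indicator_of_mem (show X i ω ∈ {x | H x ≤ s} from hi.1), Pi.one_apply, one_mul,
          ← sq_abs (_ - _)]
        have := hi.2
        gcongr
    _ ≤ Z ω := Finset.sum_le_sum_of_subset_of_nonneg (Finset.filter_subset _ _)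
        fun i _ _ => mul_nonneg (hind0 _) (sq_nonneg _)

include hA hirr hH hc in
/-- The empirical Kendall distribution is close to the Kendall distribution with probability
`1 - O(1/n)`. -/
theorem measureReal_not_levyClose_le {η : ℝ} (hη : 0 < η) {N : ℕ} (hN : 1 / η + 2 ≤ N)
    (hn : 4 / η ≤ n) (hcn : ∀ ω i, c ω i ≤ n) :
    P.real {ω | ¬ LevyClose (3 * η) (fun t => ((Finset.univ.filter fun i =>
      (c ω i : ℝ) / ((n : ℝ) + 1) ≤ t).card : ℝ) / n) fun t => μ.real {x | H x ≤ t}}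
      ≤ (4 / η ^ 3 + N / η ^ 2) / n := by
  have hn' : (0 : ℝ) < n := (by positivity : 0 < 4 / η).trans_le hn
  have hn0 : 0 < n := by exact_mod_cast hn'
  have hH0 : ∀ x, 0 ≤ H x := fun x => by rw [hH]; exact measureReal_nonneg
  have hH1 : ∀ x, H x ≤ 1 := fun x => by rw [hH]; exact measureReal_le_one
  have hHm : Measurable H := measurable_of_eq_measureReal hA hH
  have hKone : ∀ t : ℝ, 1 ≤ t → μ.real {x | H x ≤ t} = 1 := fun t ht => by
    have : {x | H x ≤ t} = univ := eq_univ_of_forall fun x => (hH1 x).trans ht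
    rw [this, probReal_univ]
  set B₀ : Set Ω := {ω | n * η < ((Finset.univ.filter fun i => H (X i ω) ≤ 1 ∧
      n * η / 2 ≤ |(c ω i : ℝ) - (n - 1) * H (X i ω)|).card : ℝ)} with hB₀
  set B : ℕ → Set Ω := fun j => {ω | n * η ≤ |((Finset.univ.filter fun i =>
    H (X i ω) ≤ j * η).card : ℝ) - n * μ.real {x | H x ≤ j * η}|} with hB
  have hsub : {ω | ¬ LevyClose (3 * η) (fun t => ((Finset.univ.filter fun i =>
      (c ω i : ℝ) / ((n : ℝ) + 1) ≤ t).card : ℝ) / n) fun t => μ.real {x | H x ≤ t}}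
      ⊆ B₀ ∪ ⋃ j ∈ Finset.range N, B j := by
    intro ω hω
    by_contra hcon
    simp only [mem_union, mem_iUnion, not_or, not_exists] at hcon
    obtain ⟨h1, h2⟩ := hcon
    refine hω (levyClose_of_grid hn0 (V := fun i => H (X i ω))
      (W := fun i => (c ω i : ℝ) / ((n : ℝ) + 1)) (K := fun t => μ.real {x | H x ≤ t})
      (fun a b hab => measureReal_mono fun x hx => le_trans hx hab)
      (fun t => measureReal_nonneg) ?_ hKone
      (fun i => by positivity) ?_ hη hN ?_ ?_)
    · intro t ht
      have : {x | H x ≤ t} = ∅ :=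
        eq_empty_of_forall_notMem fun x hx => absurd (hH0 x) (not_le.2 (lt_of_le_of_lt hx ht))
      rw [this, measureReal_empty]
    · intro i
      rw [div_le_one (by positivity)]
      have : (c ω i : ℝ) ≤ n := by exact_mod_cast hcn ω i
      linarith
    · refine le_trans (Nat.cast_le.2 (Finset.card_le_card fun i hi => ?_)) (not_lt.1 h1)
      simp only [Finset.mem_filter_univ] at hi ⊢
      refine ⟨hH1 _, ?_⟩
      have h3 : (c ω i : ℝ) / ((n : ℝ) + 1) - H (X i ω)
          = ((c ω i : ℝ) - (n - 1) * H (X i ω) - 2 * H (X i ω)) / (n + 1) := by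
        field_simp
        ring
      rw [h3, abs_div, abs_of_pos (by positivity : (0 : ℝ) < n + 1),
        lt_div_iff₀ (by positivity)] at hi
      have h4 := abs_sub ((c ω i : ℝ) - (n - 1) * H (X i ω)) (2 * H (X i ω))
      rw [abs_of_nonneg (by linarith [hH0 (X i ω)] : 0 ≤ 2 * H (X i ω))] at h4
      rw [div_le_iff₀ hη] at hn
      nlinarith [hH1 (X i ω)]
    · intro j hj
      exact (not_le.1 (h2 j hj)).le
  have h3 : P.real B₀ ≤ 4 / η ^ 3 / n := by
    refine (measureReal_card_count_sub_ge hX hindep hlaw hA hirr hH hc zero_le_one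
      (by positivity) (by positivity)).trans ?_
    rw [hKone 1 le_rfl]
    refine le_of_eq ?_
    field_simp
    ring
  have h4 : ∀ j, P.real (B j) ≤ 1 / η ^ 2 / n := by
    intro j
    refine (measureReal_card_sub_ge hX hindep hlaw hHm (j * η) (by positivity)).trans ?_
    have : μ.real {x | H x ≤ j * η} ≤ 1 := measureReal_le_one
    calc _ ≤ n * 1 / (n * η) ^ 2 := by gcongr
      _ = 1 / η ^ 2 / n := by field_simp
  calc _ ≤ P.real (B₀ ∪ ⋃ j ∈ Finset.range N, B j) := measureReal_mono hsub
    _ ≤ P.real B₀ + P.real (⋃ j ∈ Finset.range N, B j) := measureReal_union_le _ _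
    _ ≤ P.real B₀ + ∑ j ∈ Finset.range N, P.real (B j) := by
        gcongr
        exact measureReal_biUnion_finset_le _ _
    _ ≤ 4 / η ^ 3 / n + ∑ j ∈ Finset.range N, 1 / η ^ 2 / n := by
        gcongr with j _
        exact h4 j
    _ = _ := by
        rw [Finset.sum_const, Finset.card_range, nsmul_eq_mul]
        ring

include hA hirr hH hc in
/-- With probability close to `1`, the empirical Kendall distribution is bounded below by a multiple
of the rescaled Kendall distribution, uniformly near `0`. -/
theorem measureReal_not_kendall_le {M L s₀ : ℝ} (hM : 2 ≤ M) (hL : 0 < L)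
    (hs₀ : 1 / (M * n) ≤ s₀) (hn : 0 < n)
    (hK : ∀ s ∈ Icc 0 s₀, L * s ≤ μ.real {x | H x ≤ s}) :
    P.real {ω | ¬ ∀ t ∈ Icc 0 s₀, μ.real {x | H x ≤ t / (2 * M)} ≤
      2 * (((Finset.univ.filter fun i => (c ω i : ℝ) / ((n : ℝ) + 1) ≤ t).card : ℝ) / n)}
      ≤ 32 / M + 32 * M / L := by
  have hn' : (0 : ℝ) < n := by exact_mod_cast hn
  have hM0 : 0 < M := by linarith
  have hHm : Measurable H := measurable_of_eq_measureReal hA hH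
  set K : ℝ → ℝ := fun t => μ.real {x | H x ≤ t} with hKdef
  set B₁ : ℕ → Set Ω := fun j => {ω | n * K (2 ^ j / (M * n)) / 4 <
    ((Finset.univ.filter fun i => H (X i ω) ≤ 2 ^ j / (M * n) ∧
      2 ^ j / 2 ≤ |(c ω i : ℝ) - (n - 1) * H (X i ω)|).card : ℝ)} with hB₁
  set B₂ : ℕ → Set Ω := fun j => {ω | n * K (2 ^ j / (M * n)) / 4 ≤
    |((Finset.univ.filter fun i => H (X i ω) ≤ 2 ^ j / (M * n)).card : ℝ)
      - n * K (2 ^ j / (M * n))|} with hB₂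
  obtain ⟨J, hJ⟩ := pow_unbounded_of_one_lt (s₀ * (M * n)) (one_lt_two : (1 : ℝ) < 2)
  set S := (Finset.range J).filter fun j => (2 : ℝ) ^ j / (M * n) ≤ s₀ with hS
  have hmemS : ∀ j : ℕ, (2 : ℝ) ^ j / (M * n) ≤ s₀ → j ∈ S := by
    intro j hj
    rw [hS, Finset.mem_filter, Finset.mem_range]
    refine ⟨?_, hj⟩
    rw [div_le_iff₀ (by positivity)] at hj
    exact (pow_lt_pow_iff_right₀ (one_lt_two : (1 : ℝ) < 2)).1 (hj.trans_lt hJ)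
  have hKpos : ∀ j ∈ S, L * (2 ^ j / (M * n)) ≤ K (2 ^ j / (M * n)) := by
    intro j hj
    exact hK _ ⟨by positivity, (Finset.mem_filter.1 hj).2⟩
  have hsub : {ω | ¬ ∀ t ∈ Icc 0 s₀, μ.real {x | H x ≤ t / (2 * M)} ≤
      2 * (((Finset.univ.filter fun i => (c ω i : ℝ) / ((n : ℝ) + 1) ≤ t).card : ℝ) / n)}
      ⊆ (⋃ j ∈ S, B₁ j) ∪ ⋃ j ∈ S, B₂ j := by
    intro ω hω
    by_contra hcon
    simp only [mem_union, mem_iUnion, not_or, not_exists] at hcon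
    obtain ⟨h1, h2⟩ := hcon
    refine hω (kendall_le_of_dyadic hn (c ω) (K := K) (fun a b hab =>
      measureReal_mono fun x hx => le_trans hx hab) hM hs₀ fun j hj => ?_)
    exact half_le_card_lt_two_pow hn (c ω) (V := fun i => H (X i ω)) hM j
      (fun i => by rw [hH]; exact measureReal_nonneg) (not_lt.1 (h1 j (hmemS j hj)))
      (not_le.1 (h2 j (hmemS j hj))).le
  have h1 : ∀ j ∈ S, P.real (B₁ j) ≤ 16 / M * (1 / 2) ^ j := by
    intro j hj
    have hk := hKpos j hj
    have hk0 : 0 < K (2 ^ j / (M * n)) := lt_of_lt_of_le (by positivity) hk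
    refine (measureReal_card_count_sub_ge hX hindep hlaw hA hirr hH hc
      (by positivity : (0 : ℝ) ≤ 2 ^ j / (M * n)) (by positivity) (by positivity)).trans ?_
    refine le_of_eq ?_
    change (n : ℝ) ^ 2 * (2 ^ j / (M * n) * K (2 ^ j / (M * n))) /
      (n * K (2 ^ j / (M * n)) / 4 * (2 ^ j / 2) ^ 2) = _
    generalize K (2 ^ j / (M * n)) = k at hk0
    rw [one_div, inv_pow]
    field_simp
    norm_num
  have h2 : ∀ j ∈ S, P.real (B₂ j) ≤ 16 * M / L * (1 / 2) ^ j := by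
    intro j hj
    have hk := hKpos j hj
    have hk0 : 0 < K (2 ^ j / (M * n)) := lt_of_lt_of_le (by positivity) hk
    refine (measureReal_card_sub_ge hX hindep hlaw hHm _ (by positivity)).trans ?_
    change (n : ℝ) * K (2 ^ j / (M * n)) / (n * K (2 ^ j / (M * n)) / 4) ^ 2 ≤ _
    calc (n : ℝ) * K (2 ^ j / (M * n)) / (n * K (2 ^ j / (M * n)) / 4) ^ 2
        = 16 / (n * K (2 ^ j / (M * n))) := by
          generalize K (2 ^ j / (M * n)) = k at hk0
          field_simp
          norm_num
      _ ≤ 16 / (n * (L * (2 ^ j / (M * n)))) := by gcongr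
      _ = _ := by
        rw [one_div, inv_pow]
        field_simp
  have hgeo : ∑ j ∈ S, (1 / 2 : ℝ) ^ j ≤ 2 :=
    (Finset.sum_le_sum_of_subset_of_nonneg (Finset.filter_subset _ _)
      fun _ _ _ => by positivity).trans (sum_geometric_two_le J)
  calc _ ≤ P.real ((⋃ j ∈ S, B₁ j) ∪ ⋃ j ∈ S, B₂ j) := measureReal_mono hsub
    _ ≤ P.real (⋃ j ∈ S, B₁ j) + P.real (⋃ j ∈ S, B₂ j) := measureReal_union_le _ _
    _ ≤ ∑ j ∈ S, P.real (B₁ j) + ∑ j ∈ S, P.real (B₂ j) :=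
        add_le_add (measureReal_biUnion_finset_le _ _) (measureReal_biUnion_finset_le _ _)
    _ ≤ ∑ j ∈ S, 16 / M * (1 / 2) ^ j + ∑ j ∈ S, 16 * M / L * (1 / 2) ^ j :=
        add_le_add (Finset.sum_le_sum h1) (Finset.sum_le_sum h2)
    _ ≤ 16 / M * 2 + 16 * M / L * 2 := by
        rw [← Finset.mul_sum, ← Finset.mul_sum]
        gcongr
    _ = _ := by ring

end Concentration

/-! ### Uniform convergence of the diagonal quantile functions -/

/-- The function `v ↦ F (a G v)` for the upper inverse `G` of `F`, extended by its limit `1` to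
`v = 1`.  For the Williamson transform `F` of the radial law and `a = m` this is the diagonal
quantile function on `(0, 1]`; its value at `0` is the right limit there. -/
noncomputable def dilationProfile (a : ℝ) (F : ℝ → ℝ) (v : ℝ) : ℝ :=
  if v < 1 then F (a * upperInv F v) else 1

theorem IsWilliamsonCdf.monotoneOn_dilationProfile {F : ℝ → ℝ} (hF : IsWilliamsonCdf F) {a : ℝ}
    (ha : 0 ≤ a) : MonotoneOn (dilationProfile a F) (Icc 0 1) := by
  intro v hv w hw h
  unfold dilationProfile
  split_ifs with h1 h2 h2
  · exact hF.mono (mul_le_mul_of_nonneg_left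
      (hF.strictMonoOn_upperInv.monotoneOn ⟨hv.1, h1⟩ ⟨hw.1, h2⟩ h) ha)
  · exact hF.le_one _
  · exact absurd (h.trans_lt h2) h1
  · exact le_rfl

theorem IsWilliamsonCdf.dilationProfile_nonneg {F : ℝ → ℝ} (hF : IsWilliamsonCdf F) (a v : ℝ) :
    0 ≤ dilationProfile a F v := by
  unfold dilationProfile
  split_ifs
  · exact hF.nonneg _
  · exact zero_le_one

theorem IsWilliamsonCdf.continuousOn_dilationProfile {F : ℝ → ℝ} (hF : IsWilliamsonCdf F) {a : ℝ}
    (ha : 1 ≤ a) : ContinuousOn (dilationProfile a F) (Icc 0 1) := by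
  intro v hv
  rcases hv.2.eq_or_lt with h | h
  · subst h
    -- `v ≤ F (a G v) ≤ 1`
    have h1 : dilationProfile a F 1 = 1 := by simp [dilationProfile]
    rw [ContinuousWithinAt, h1]
    refine tendsto_of_tendsto_of_tendsto_of_le_of_le' (g := fun v => v) (h := fun _ => 1)
      (tendsto_id.mono_left nhdsWithin_le_nhds) tendsto_const_nhds ?_ ?_
    · filter_upwards [self_mem_nhdsWithin] with w hw
      unfold dilationProfile
      split_ifs with h2
      · have hw' : w ∈ Ico (0 : ℝ) 1 := ⟨hw.1, h2⟩
        calc w = F (upperInv F w) := (hF.apply_upperInv hw').symm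
          _ ≤ F (a * upperInv F w) :=
            hF.mono (le_mul_of_one_le_left (hF.upperInv_nonneg hw') ha)
      · exact hw.2
    · filter_upwards with w
      unfold dilationProfile
      split_ifs
      · exact hF.le_one _
      · exact le_rfl
  · have h1 : ContinuousWithinAt (fun w => F (a * upperInv F w)) (Icc 0 1) v := by
      have h2 : ContinuousWithinAt (fun w => F (a * upperInv F w)) (Ico 0 1) v :=
        hF.cont.continuousAt.comp_continuousWithinAt
          (continuousWithinAt_const.mul (hF.continuousOn_upperInv v ⟨hv.1, h⟩))
      refine h2.mono_of_mem_nhdsWithin ?_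
      filter_upwards [self_mem_nhdsWithin, mem_nhdsWithin_of_mem_nhds (Iio_mem_nhds h)]
        with w hw hw2 using ⟨hw.1, hw2⟩
    refine h1.congr_of_eventuallyEq ?_ (by simp [dilationProfile, h])
    filter_upwards [mem_nhdsWithin_of_mem_nhds (Iio_mem_nhds h)] with w hw
    rw [dilationProfile, if_pos (mem_Iio.1 hw)]

/-- Monotone functions that are close to a continuous function on a fine grid are uniformly
close to it; at the left end point a lower bound suffices. -/
theorem exists_grid_uniform {g : ℝ → ℝ} (hg : ContinuousOn g (Icc 0 1)) {ε : ℝ} (hε : 0 < ε) :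
    ∃ N : ℕ, 0 < N ∧ ∀ h : ℝ → ℝ, MonotoneOn h (Icc 0 1) → g 0 - ε < h 0 → h 1 = g 1 →
      (∀ k ∈ Finset.Ioo 0 N, |h ((k : ℝ) / N) - g ((k : ℝ) / N)| < ε) →
      ∀ v ∈ Icc (0 : ℝ) 1, |h v - g v| < 2 * ε := by
  have huc := isCompact_Icc.uniformContinuousOn_of_continuous hg
  rw [Metric.uniformContinuousOn_iff] at huc
  obtain ⟨δ, hδ, hgδ⟩ := huc ε hε
  obtain ⟨N, hN⟩ := exists_nat_gt (1 / δ)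
  have hN0 : (0 : ℝ) < N := (by positivity : 0 < 1 / δ).trans hN
  have hNδ : 1 / (N : ℝ) < δ := by
    rw [div_lt_iff₀ hN0]
    rw [div_lt_iff₀ hδ] at hN
    linarith
  refine ⟨N, by exact_mod_cast hN0, fun h hh h0 h1 hk v hv => ?_⟩
  have hlow : ∀ k : ℕ, k ≤ N → g ((k : ℝ) / N) - ε < h ((k : ℝ) / N) := by
    intro k hkN
    rcases Nat.eq_zero_or_pos k with rfl | hk0
    · simpa using h0
    rcases hkN.eq_or_lt with rfl | hkN
    · rw [div_self hN0.ne', h1]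
      linarith
    · linarith [(abs_lt.1 (hk k (Finset.mem_Ioo.2 ⟨hk0, hkN⟩))).1]
  have hupp : ∀ k : ℕ, 0 < k → k ≤ N → h ((k : ℝ) / N) < g ((k : ℝ) / N) + ε := by
    intro k hk0 hkN
    rcases hkN.eq_or_lt with rfl | hkN
    · rw [div_self hN0.ne', h1]
      linarith
    · linarith [(abs_lt.1 (hk k (Finset.mem_Ioo.2 ⟨hk0, hkN⟩))).2]
  have hmem : ∀ k : ℕ, k ≤ N → (k : ℝ) / N ∈ Icc (0 : ℝ) 1 := fun k hkN =>
    ⟨by positivity, (div_le_one hN0).2 (by exact_mod_cast hkN)⟩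
  rcases hv.2.eq_or_lt with h2 | h2
  · rw [h2, h1, sub_self, abs_zero]
    positivity
  set k := ⌊v * N⌋₊ with hkdef
  have hk1 : (k : ℝ) / N ≤ v := by
    rw [div_le_iff₀ hN0]
    exact Nat.floor_le (mul_nonneg hv.1 hN0.le)
  have hk2 : v < ((k + 1 : ℕ) : ℝ) / N := by
    rw [lt_div_iff₀ hN0]
    push_cast
    exact Nat.lt_floor_add_one _
  have hkN : k + 1 ≤ N := by
    have : (k : ℝ) < N := by
      rw [div_le_iff₀ hN0] at hk1
      nlinarith
    have : k < N := by exact_mod_cast this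
    omega
  have hstep : ((k + 1 : ℕ) : ℝ) / N = (k : ℝ) / N + 1 / N := by
    push_cast
    ring
  have hd1 := hgδ v hv _ (hmem k (by omega)) (by
    rw [Real.dist_eq, abs_lt]
    constructor <;> linarith)
  have hd2 := hgδ v hv _ (hmem (k + 1) hkN) (by
    rw [Real.dist_eq, abs_lt]
    constructor <;> linarith)
  rw [Real.dist_eq, abs_lt] at hd1 hd2
  have hm1 := hh (hmem k (by omega)) hv hk1
  have hm2 := hh hv (hmem (k + 1) hkN) hk2.le
  rw [abs_lt]
  constructor
  · linarith [hlow k (by omega)]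
  · linarith [hupp (k + 1) (Nat.succ_pos k) hkN]

section Convergence

variable {Ω : Type*} [MeasurableSpace Ω] {P : Measure Ω} [IsProbabilityMeasure P] {m q : ℕ}
  {e : Fin (q + 1) ↪ Fin m} {μ : Measure (Fin m → ℝ)} [IsProbabilityMeasure μ]
  {T : ℕ → Ω → Fin m → ℝ}

/-- The law of the inverse estimated radius for the first `n` observations. -/
noncomputable def sampleRadialLaw (e : Fin (q + 1) ↪ Fin m) (T : ℕ → Ω → Fin m → ℝ) (n : ℕ)
    (ω : Ω) : Measure ℝ :=
  gnzLaw (subsample e (fun i => T i ω) n)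

omit [MeasurableSpace Ω] in
theorem cast_gnzCount_subsample (n : ℕ) (ω : Ω) (i : Fin n) :
    (gnzCount (subsample e (fun i => T i ω) n) i : ℝ)
      = ∑ k : Fin n, {p : (Fin m → ℝ) × (Fin m → ℝ) | ∀ l, p.1 (e l) < p.2 (e l)}.indicator
          (fun _ => (1 : ℝ)) (T k ω, T i ω) := by
  rw [gnzCount_eq_card, Finset.card_filter, Nat.cast_sum]
  refine Finset.sum_congr rfl fun k _ => ?_
  by_cases h : ∀ l, subsample e (fun i => T i ω) n k l < subsample e (fun i => T i ω) n i l
  · rw [if_pos h, Nat.cast_one, indicator_of_mem]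
    exact h
  · rw [if_neg h, Nat.cast_zero, indicator_of_notMem]
    exact h

theorem measurableSet_forall_lt :
    MeasurableSet {p : (Fin m → ℝ) × (Fin m → ℝ) | ∀ l, p.1 (e l) < p.2 (e l)} := by
  rw [ofPred_forall]
  exact MeasurableSet.iInter fun l => measurableSet_lt
    ((measurable_pi_apply _).comp measurable_fst) ((measurable_pi_apply _).comp measurable_snd)

omit [MeasurableSpace Ω] in
theorem kendallCdf_sampleRadialLaw (hq : 0 < q) {n : ℕ} (hn : 0 < n) (ω : Ω) (t : ℝ) :
    kendallCdf q (sampleRadialLaw e T n ω) t = ((Finset.univ.filter fun i : Fin n =>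
      (gnzCount (subsample e (fun i => T i ω) n) i : ℝ) / ((n : ℝ) + 1) ≤ t).card : ℝ) / n :=
  kendallCdf_gnzLaw hn (by omega) (subsample e (fun i => T i ω) n) t

variable (hq : 0 < q) (hmeas : ∀ i, Measurable (T i)) (hindep : iIndepFun T P)
  (hlaw : ∀ i, P.map (T i) = μ) {π : Measure ℝ}
  (hKendall : ∀ s, kendallCdf q π s = μ.real {x | μ.real {t | ∀ l, t (e l) < x (e l)} ≤ s})
include hq hmeas hindep hlaw hKendall

/-- Consistency of the empirical Kendall distribution in Lévy distance. -/
theorem tendsto_measureReal_not_levyClose {δ : ℝ} (hδ : 0 < δ) :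
    Tendsto (fun n : ℕ => P.real {ω | ¬ LevyClose δ (kendallCdf q (sampleRadialLaw e T n ω))
      (kendallCdf q π)}) atTop (𝓝 0) := by
  obtain ⟨N, hN⟩ := exists_nat_ge (1 / (δ / 3) + 2)
  have hlim : Tendsto (fun n : ℕ => (4 / (δ / 3) ^ 3 + N / (δ / 3) ^ 2) / n) atTop (𝓝 0) :=
    tendsto_const_nhds.div_atTop tendsto_natCast_atTop_atTop
  refine tendsto_of_tendsto_of_tendsto_of_le_of_le' tendsto_const_nhds hlim
    (Eventually.of_forall fun n => measureReal_nonneg) ?_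
  filter_upwards [tendsto_natCast_atTop_atTop.eventually_ge_atTop (4 / (δ / 3)),
    eventually_gt_atTop 0] with n hn hn0
  have h1 := measureReal_not_levyClose_le (X := fun i : Fin n => T i) (fun i => hmeas i)
    (hindep.precomp Fin.val_injective) (fun i => hlaw i) (measurableSet_forall_lt (e := e))
    (fun x hx => lt_irrefl _ (hx 0)) (fun x => rfl) (cast_gnzCount_subsample n)
    (by positivity : 0 < δ / 3) hN hn fun ω i => by
      rw [gnzCount_eq_card]
      exact (Finset.card_le_univ _).trans (Fintype.card_fin n).le
  refine le_of_eq_of_le ?_ h1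
  congr 1
  ext ω
  rw [mem_ofPred_eq, mem_ofPred_eq, mul_div_cancel₀ _ (by norm_num : (3 : ℝ) ≠ 0)]
  rw [show kendallCdf q π = _ from funext hKendall,
    show kendallCdf q (sampleRadialLaw e T n ω) = _ from
      funext fun t => kendallCdf_sampleRadialLaw hq hn0 ω t]
  rfl

/-- If the radial law has a positive lower end point, the hypothesis of `exists_delta_endpoint` on
the Kendall distribution of the estimated law holds with probability close to `1`. -/
theorem exists_eventually_kendall_le [IsProbabilityMeasure π] (hpos : ∀ᵐ z ∂π, 0 < z)
    (hz₀ : 0 < upperInv (williamsonCdf q π) 0) {η : ℝ} (hη : 0 < η) :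
    ∃ M > 0, ∃ t₀ > 0, ∀ᶠ n : ℕ in atTop, P.real {ω | ¬ ∀ t ∈ Icc 0 t₀,
      kendallCdf q π (t / (2 * M)) ≤ 2 * kendallCdf q (sampleRadialLaw e T n ω) t} ≤ η := by
  -- both terms of the bound `32 / M + 32 M / L` are at most `η / 2`
  set M : ℝ := 2 + 64 / η with hM
  have hM2 : 2 ≤ M := by
    have : 0 < 64 / η := by positivity
    linarith
  have hM0 : 0 < M := by linarith
  set L : ℝ := 64 * M / η with hL
  have hL0 : 0 < L := by positivity
  obtain ⟨s₀, hs₀, hs⟩ := exists_mul_le_kendallCdf q hq π hpos hz₀ L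
  refine ⟨M, hM0, s₀, hs₀, ?_⟩
  have hlim : Tendsto (fun n : ℕ => 1 / (M * n)) atTop (𝓝 0) :=
    tendsto_const_nhds.div_atTop (tendsto_natCast_atTop_atTop.const_mul_atTop hM0)
  filter_upwards [hlim.eventually (gt_mem_nhds hs₀), eventually_gt_atTop 0] with n hn hn0
  have h1 := measureReal_not_kendall_le (X := fun i : Fin n => T i) (fun i => hmeas i)
    (hindep.precomp Fin.val_injective) (fun i => hlaw i) (measurableSet_forall_lt (e := e))
    (fun x hx => lt_irrefl _ (hx 0)) (fun x => rfl) (cast_gnzCount_subsample n) hM2 hL0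
    (le_of_lt hn) hn0 fun s h => (hs s h).trans (hKendall s).le
  have h2 : 32 / M + 32 * M / L ≤ η := by
    have h3 : 32 / M ≤ η / 2 := by
      rw [div_le_iff₀ hM0, hM]
      have : η / 2 * (2 + 64 / η) = η + 32 := by field_simp; ring
      linarith
    have h4 : 32 * M / L = η / 2 := by
      rw [hL]
      field_simp
      norm_num
    linarith
  refine le_trans (le_of_eq ?_) (h1.trans h2)
  congr 1
  ext ω
  simp only [mem_ofPred_eq, hKendall, kendallCdf_sampleRadialLaw hq hn0 ω]

/-- The estimated profile converges uniformly in probability. -/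
theorem tendsto_measureReal_dilationProfile [IsProbabilityMeasure π] (hpos : ∀ᵐ z ∂π, 0 < z)
    {a : ℝ} (ha : 1 ≤ a) {ε : ℝ} (hε : 0 < ε) :
    Tendsto (fun n : ℕ => P.real {ω | ∃ v ∈ Icc (0 : ℝ) 1, ε ≤
      |dilationProfile a (williamsonCdf q (sampleRadialLaw e T n ω)) v
        - dilationProfile a (williamsonCdf q π) v|}) atTop (𝓝 0) := by
  have ha0 : 0 < a := by linarith
  have hF := isWilliamsonCdf_williamsonCdf q hq π hpos
  set F := williamsonCdf q π with hFdef
  obtain ⟨N, hN, hgrid⟩ := exists_grid_uniform (hF.continuousOn_dilationProfile ha) (half_pos hε)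
  have hvk : ∀ k ∈ Finset.Ioo 0 N, (k : ℝ) / N ∈ Ioo (0 : ℝ) 1 := by
    intro k hk
    rw [Finset.mem_Ioo] at hk
    have h1 : (0 : ℝ) < k := by exact_mod_cast hk.1
    have h2 : (k : ℝ) < N := by exact_mod_cast hk.2
    have h3 : (0 : ℝ) < N := h1.trans h2
    exact ⟨by positivity, (div_lt_one h3).2 h2⟩
  have hstab : ∀ k : ℕ, ∃ δ > 0, k ∈ Finset.Ioo 0 N → ∀ ρ : Measure ℝ, IsProbabilityMeasure ρ →
      (∀ᵐ z ∂ρ, 0 < z) → LevyClose δ (kendallCdf q ρ) (kendallCdf q π) →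
      |williamsonCdf q ρ (a * upperInv (williamsonCdf q ρ) ((k : ℝ) / N))
        - F (a * upperInv F ((k : ℝ) / N))| < ε / 2 := by
    intro k
    by_cases hk : k ∈ Finset.Ioo 0 N
    · obtain ⟨δ, hδ, h⟩ := exists_delta_stability q hq π hpos (hvk k hk) ha0 (half_pos hε)
      exact ⟨δ, hδ, fun _ => h⟩
    · exact ⟨1, one_pos, fun h => absurd h hk⟩
  choose δ hδ hδk using hstab
  -- the bad events at the left end point
  have hend : ∀ η > 0, ∃ B : ℕ → Set Ω, (∀ᶠ n in atTop, P.real (B n) ≤ η) ∧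
      ∀ n, 0 < n → ∀ ω ∉ B n, F (a * upperInv F 0) - ε / 2
        < dilationProfile a (williamsonCdf q (sampleRadialLaw e T n ω)) 0 := by
    intro η hη
    have hρ : ∀ n, 0 < n → ∀ ω, IsWilliamsonCdf (williamsonCdf q (sampleRadialLaw e T n ω)) := by
      intro n hn ω
      have : IsProbabilityMeasure (sampleRadialLaw e T n ω) := isProbabilityMeasure_gnzLaw hn _
      exact isWilliamsonCdf_williamsonCdf q hq _
        ((ae_one_le_gnzLaw (by omega) (subsample e (fun i => T i ω) n)).mono
          fun z hz => one_pos.trans_le hz)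
    rcases (hF.upperInv_nonneg (v := 0) (by simp)).eq_or_lt with hz₀ | hz₀
    · refine ⟨fun _ => ∅, Eventually.of_forall fun n => by simpa using hη.le, fun n hn ω _ => ?_⟩
      rw [← hz₀, mul_zero, hF.zero_of_nonpos 0 le_rfl]
      exact lt_of_lt_of_le (by linarith) ((hρ n hn ω).dilationProfile_nonneg a 0)
    · obtain ⟨M, hM, t₀, ht₀, hev⟩ := exists_eventually_kendall_le hq hmeas hindep hlaw hKendall
        hpos hz₀ (half_pos hη)
      obtain ⟨δ', hδ', h⟩ := exists_delta_endpoint q hq π hpos hz₀ hM ht₀ ha0 (half_pos hε)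
      refine ⟨fun n => {ω | ¬ ∀ t ∈ Icc 0 t₀,
        kendallCdf q π (t / (2 * M)) ≤ 2 * kendallCdf q (sampleRadialLaw e T n ω) t} ∪
        {ω | ¬ LevyClose δ' (kendallCdf q (sampleRadialLaw e T n ω)) (kendallCdf q π)}, ?_, ?_⟩
      · filter_upwards [hev, (tendsto_measureReal_not_levyClose hq hmeas hindep hlaw hKendall
          hδ').eventually (gt_mem_nhds (half_pos hη))] with n h1 h2
        exact (measureReal_union_le _ _).trans (by linarith)
      · intro n hn ω hω
        rw [mem_union, not_or, mem_ofPred_eq, mem_ofPred_eq, not_not, not_not] at hω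
        have hone := ae_one_le_gnzLaw (by omega) (subsample e (fun i => T i ω) n)
        refine (h (sampleRadialLaw e T n ω) (isProbabilityMeasure_gnzLaw hn _) hone
          (gnzLaw_real_Iic_one_pos hn (by omega) _) hω.1 hω.2).trans_le ?_
        have := isProbabilityMeasure_gnzLaw hn (subsample e (fun i => T i ω) n)
        -- the estimated radial law lives on `[1, ∞)`
        have h1 : williamsonCdf q (sampleRadialLaw e T n ω) 1 ≤ 0 := by
          have := williamsonCdf_le_of_ae_le q hq (gnzLaw (subsample e (fun i => T i ω) n))
            (hone.mono fun z hz => one_pos.trans_le hz) hone one_pos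
          rwa [div_one, sub_self, zero_pow (by omega), zero_mul] at this
        rw [dilationProfile, if_pos one_pos]
        refine (hρ n hn ω).mono (le_mul_of_one_le_right ha0.le ?_)
        exact ((hρ n hn ω).le_upperInv_iff (by simp)).2 h1
  refine tendsto_order.2 ⟨fun x hx => Eventually.of_forall fun n => hx.trans_le measureReal_nonneg,
    fun η hη => ?_⟩
  obtain ⟨B, hB, hBend⟩ := hend (η / 2) (half_pos hη)
  have hsum : Tendsto (fun n : ℕ => ∑ k ∈ Finset.Ioo 0 N, P.real {ω | ¬ LevyClose (δ k)
      (kendallCdf q (sampleRadialLaw e T n ω)) (kendallCdf q π)}) atTop (𝓝 0) := by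
    have := tendsto_finsetSum (Finset.Ioo 0 N) fun k _ =>
      tendsto_measureReal_not_levyClose hq hmeas hindep hlaw hKendall (hδ k)
    simpa using this
  filter_upwards [hB, hsum.eventually (gt_mem_nhds (half_pos hη)), eventually_gt_atTop 0]
    with n h1 h2 hn
  have hsub : {ω | ∃ v ∈ Icc (0 : ℝ) 1, ε ≤
      |dilationProfile a (williamsonCdf q (sampleRadialLaw e T n ω)) v
        - dilationProfile a F v|} ⊆ B n ∪ ⋃ k ∈ Finset.Ioo 0 N, {ω | ¬ LevyClose (δ k)
      (kendallCdf q (sampleRadialLaw e T n ω)) (kendallCdf q π)} := by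
    rintro ω ⟨v, hv, hεv⟩
    by_contra hcon
    simp only [mem_union, mem_iUnion, not_or, not_exists] at hcon
    obtain ⟨h3, h4⟩ := hcon
    have hprob : IsProbabilityMeasure (sampleRadialLaw e T n ω) :=
      isProbabilityMeasure_gnzLaw hn _
    have hρpos := (ae_one_le_gnzLaw (by omega) (subsample e (fun i => T i ω) n)).mono
      fun z hz => one_pos.trans_le hz
    have hρ : IsWilliamsonCdf (williamsonCdf q (sampleRadialLaw e T n ω)) :=
      isWilliamsonCdf_williamsonCdf q hq _ hρpos
    have := hgrid _ (hρ.monotoneOn_dilationProfile ha0.le)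
      (by
        have := hBend n hn ω h3
        rwa [dilationProfile, if_pos one_pos])
      (by simp [dilationProfile])
      (fun k hk => by
        rw [dilationProfile, dilationProfile, if_pos (hvk k hk).2, if_pos (hvk k hk).2]
        exact hδk k hk _ hprob hρpos (not_not.1 (h4 k hk))) v hv
    linarith
  calc _ ≤ P.real (B n ∪ ⋃ k ∈ Finset.Ioo 0 N, {ω | ¬ LevyClose (δ k)
      (kendallCdf q (sampleRadialLaw e T n ω)) (kendallCdf q π)}) := measureReal_mono hsub
    _ ≤ P.real (B n) + ∑ k ∈ Finset.Ioo 0 N, P.real {ω | ¬ LevyClose (δ k)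
      (kendallCdf q (sampleRadialLaw e T n ω)) (kendallCdf q π)} :=
        (measureReal_union_le _ _).trans (add_le_add le_rfl (measureReal_biUnion_finset_le _ _))
    _ < η := by linarith

end Convergence

theorem gnzDiagonalQuantile_zero (m : ℕ) {n d : ℕ} (x : Fin n → Fin d → ℝ) :
    gnzDiagonalQuantile m x 0 = 0 := by
  have h0 : (0 : ℝ) ∈ {u : ℝ | u ∈ Icc (0 : ℝ) 1 ∧ 0 ≤ gnzDiagonal m x u} := by
    refine ⟨by simp, ?_⟩
    unfold gnzDiagonal gnzPsi
    positivity
  exact le_antisymm (csInf_le ⟨0, fun u hu => hu.1.1⟩ h0) (le_csInf ⟨0, h0⟩ fun u hu => hu.1.1)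

theorem gnzDiagonalQuantile_eq_dilationProfile {n q : ℕ} (hn : 0 < n) (hq : 0 < q) {m : ℕ}
    (hm : 0 < m) (x : Fin n → Fin (q + 1) → ℝ) {v : ℝ} (hv : v ∈ Ioc (0 : ℝ) 1) :
    gnzDiagonalQuantile m x v = dilationProfile m (williamsonCdf q (gnzLaw x)) v := by
  rw [gnzDiagonalQuantile_eq (by omega) hm x hv, dilationProfile]
  split_ifs with h
  · exact gnzPsi_div hn (by omega) hm x ⟨hv.1.le, h⟩
  · rw [le_antisymm hv.2 (not_lt.1 h), gnzPhi_one hn, zero_div, gnzPsi_zero hn]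

theorem mainTheorem2
    {Ω : Type*} [MeasurableSpace Ω] (P : Measure Ω) [IsProbabilityMeasure P]
    {m d : ℕ} (hd : 2 ≤ d) (e : Fin d ↪ Fin m)
    (μ : Measure (Fin m → ℝ)) [IsProbabilityMeasure μ]
    (hcont : ∀ j, Continuous (marginalCdf μ j))
    (C : (Fin m → ℝ) → ℝ) (hC : IsCopulaOf C μ) (hArch : IsArchimedean C)
    (T : ℕ → Ω → Fin m → ℝ) (hmeas : ∀ i, Measurable (T i))
    (hindep : iIndepFun T P) (hlaw : ∀ i, P.map (T i) = μ) :
    (∀ (n : ℕ) (ω : Ω), ∀ v ∈ Ioc (0 : ℝ) 1,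
      gnzDiagonalQuantile m (subsample e (fun i => T i ω) n) v
        = gnzPsi (subsample e (fun i => T i ω) n)
            (gnzPhi (subsample e (fun i => T i ω) n) v / m)) ∧
    (∀ ε : ℝ, 0 < ε →
      Tendsto (fun n : ℕ => P {ω | ∃ v ∈ Icc (0 : ℝ) 1,
        ε ≤ |gnzDiagonalQuantile m (subsample e (fun i => T i ω) n) v - diagonalQuantile C v|})
        atTop (𝓝 0)) ∧
    (∀ α ∈ Ioo (0 : ℝ) 1,
      TendstoInMeasure P
        (fun (n : ℕ) (ω : Ω) => gnzLocalLevel m (subsample e (fun i => T i ω) n) α)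
        atTop (fun _ => 1 - diagonalQuantile C (1 - α))) := by
  obtain ⟨q, rfl⟩ : ∃ q, d = q + 1 := ⟨d - 1, by omega⟩
  have hq : 0 < q := by omega
  have hdm : q + 1 ≤ m := by simpa using Fintype.card_le_of_embedding e
  have hm : 0 < m := by omega
  obtain ⟨φ, hφ, hCφ⟩ := hArch
  obtain ⟨π, hπ, hpos, hW, hKendall⟩ := exists_radial_law hcont hC hφ hCφ hq e
  have hF := isWilliamsonCdf_williamsonCdf q hq π hpos
  have htrue : ∀ v ∈ Ioc (0 : ℝ) 1,
      diagonalQuantile C v = dilationProfile m (williamsonCdf q π) v := by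
    intro v hv
    rw [dilationProfile]
    split_ifs with h
    · exact hφ.diagonalQuantile_eq_williamsonCdf hm hCφ hF hW ⟨hv.1, h⟩
    · rw [hφ.diagonalQuantile_eq hm hCφ hv, le_antisymm hv.2 (not_lt.1 h), hφ.map_one,
        ENNReal.zero_div, hφ.generatorInverse_zero]
  have hunif : ∀ ε : ℝ, 0 < ε → Tendsto (fun n : ℕ => P {ω | ∃ v ∈ Icc (0 : ℝ) 1,
      ε ≤ |gnzDiagonalQuantile m (subsample e (fun i => T i ω) n) v - diagonalQuantile C v|})
      atTop (𝓝 0) := by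
    intro ε hε
    have h1 := tendsto_measureReal_dilationProfile hq hmeas hindep hlaw hKendall hpos
      (by exact_mod_cast hm : (1 : ℝ) ≤ m) hε
    simp only [measureReal_def] at h1
    rw [ENNReal.tendsto_toReal_zero_iff fun n => measure_ne_top _ _] at h1
    refine tendsto_of_tendsto_of_tendsto_of_le_of_le' tendsto_const_nhds h1
      (Eventually.of_forall fun n => zero_le) ?_
    filter_upwards [eventually_gt_atTop 0] with n hn
    refine measure_mono ?_
    rintro ω ⟨v, hv, h2⟩
    rcases hv.1.eq_or_lt with h0 | h0
    · rw [← h0, gnzDiagonalQuantile_zero, hφ.diagonalQuantile_zero hCφ, sub_self, abs_zero] at h2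
      exact absurd h2 (not_le.2 hε)
    · rw [htrue v ⟨h0, hv.2⟩, gnzDiagonalQuantile_eq_dilationProfile hn hq hm _ ⟨h0, hv.2⟩] at h2
      exact ⟨v, hv, h2⟩
  refine ⟨fun n ω v hv => gnzDiagonalQuantile_eq hd hm _ hv, hunif, fun α hα => ?_⟩
  rw [tendstoInMeasure_iff_dist]
  intro ε hε
  refine tendsto_of_tendsto_of_tendsto_of_le_of_le tendsto_const_nhds (hunif ε hε)
    (fun n => zero_le) fun n => measure_mono fun ω hω => ?_
  refine ⟨1 - α, ⟨by linarith [hα.2], by linarith [hα.1]⟩, ?_⟩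
  have h1 : ε ≤ dist (gnzLocalLevel m (subsample e (fun i => T i ω) n) α)
    (1 - diagonalQuantile C (1 - α)) := hω
  rwa [gnzLocalLevel, Real.dist_eq, sub_sub_sub_cancel_left, abs_sub_comm] at h1
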